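/- Let $\Sigma$ be a $3$-manifold with a fixed smooth Riemannian metric $\hat g$ (Levi-Civita connection $\hat\nabla$, curvature $\hat R$). Let $\mathbf g=-n^2dt^2+g_{ij}(dx^i+Y^idt)(dx^j+Y^jdt)$ be a vacuum metric ($\mathbf{Ric}(\mathbf g)=0$) of class $C^2$ on $I\times\Sigma$, $I\subset\mathbb R$ open, with $n>0$ and $g$ Riemannian, in CMCSH gauge: with $\mathbf T=n^{-1}(\partial_t-Y)$ and $k=-\frac12\mathcal L_{\mathbf T}g$ one has $\mathrm{Tr}\,k=t$ and $g^{ij}(\Gamma^l_{ij}-\hat\Gamma^l_{ij})=0$. Let $u$ be a $C^2$ optical function ($\mathbf g^{\mu\nu}\partial_\mu u\,\partial_\nu u=0$, $b^{-1}:=\mathbf T(u)>0$) on an open region, $S=S_{t,u}$ the surfaces on which $t$ and $u$ are constant, $N=-\nabla u/|\nabla u|_g$ their outward unit normal in $\Sigma_t$, $\Pi=g-N\otimes N$, $e_1,e_2$ a $C^1$ orthonormal frame of $S$, $L=\mathbf T+N$, $\underline L=\mathbf T-N$, and $$\alpha_{AB}=\mathbf R(L,e_A,L,e_B),\quad \beta_A=\tfrac12\mathbf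 R(e_A,L,\underline L,L),\quad \underline\beta_A=\tfrac12\mathbf R(e_A,\underline L,\underline L,L),\quad \rho=\tfrac14\mathbf R(\underline L,L,\underline L,L),\quad \sigma=\tfrac14{}^\star\mathbf R(\underline L,L,\underline L,L).$$ Let $\hat k=k-\frac13(\mathrm{Tr}\,k)g$, $\delta=\hat k_{NN}$, $\epsilon_A=\hat k_{AN}$, $\hat\epsilon_{AB}=\hat k_{AB}+\frac12\delta_{AB}\,\delta$ (here $\delta_{AB}$ is the Kronecker symbol), let $\slashed\pi$ be the collection $\hat\epsilon,\epsilon,\delta,\nabla_N\log n,\slashed\nabla\log n,\mathrm{Tr}\,k$, and let $\check\pi$ be the collection of $\slashed\pi$ and $\hat\nabla g$. Let $\chi_{AB}=\langle\mathbf D_AL,e_B\rangle$, $\theta_{AB}=\langle\mathbf D_AN,e_B\rangle$ (with trace-free parts $\hat\chi,\hat\theta$) and let $F$ be the collection $\hat\chi,\slashed\nabla\log b,\hat\theta$. ($\slashed\nabla\log b=\slashed\nabla\log a$, $a$ being the null lapse of the affine null generator of a cone $u=\mathrm{const}$.) Denote by $\mathrm{er}$ any $S$-tangent tensor of the form $(\check\pi+F)\cdot\check\pi+\mathrm{tr}\chi\,\check\pi$,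 that is, one whose components in the frame $N,e_1,e_2$ are bilinear expressions with universal constant coefficients in the frame components of $(\check\pi,F,\mathrm{tr}\chi)$ and of $\check\pi$; denote by $g\cdot\hat R$ linear expressions with universal constant coefficients in the frame components of $g_{ip}\hat R^p{}_{jlm}$. Say that an $S$-tangent tensor field is formed from $(g\cdot\hat\nabla g,k)$ if it is a sum, with universal constant coefficients, of contractions, by $g$ and by the volume forms of $g$ and of $S$, of the projections of $\hat\nabla g$ and $k$ by $N$ and $\Pi$. Then: (a) There are scalars $\pi,\underline\pi$ and $S$-tangent $2$-tensor fields $\pi_{AB},\pi'_{AB},\underline\pi_{AB},\underline\pi'_{AB}$ formed from $(g\cdot\hat\nabla g,k)$ with $$\beta_A=\slashed\nabla_A\pi+\slashed\nabla^B\pi_{AB}+(\slashed{\mathrm{curl}}\,\pi')_A+\mathrm{er}+g\cdot\hat R,\qquad \underline\beta_A=\slashed\nabla_A\underline\pi+\slashed\nabla^B\underline\pi_{AB}+(\slashed{\mathrm{curl}}\,\underline\pi')_A+\mathrm{er}+g\cdot\hat R.$$ (b) There are $S$-tangent vector fields $\pi^{(1)},\pi^{(2)}$ formed from $(g\cdot\hat\nabla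 g,k)$ with $$\rho=\slashed{\mathrm{div}}\,\pi^{(1)}+\mathrm{er}+g\cdot\hat R,\qquad \sigma=\slashed{\mathrm{curl}}\,\pi^{(2)}+\mathrm{er}.$$ (c) $\alpha=2\slashed\nabla_L\hat\epsilon+\slashed\nabla\slashed\pi+\mathrm{er}$, where $\slashed\nabla\slashed\pi$ is a sum of contractions, with universal constant coefficients, of the $S$-tangential covariant derivatives of the members of $\slashed\pi$. All the expressions are universal (the same for every such space-time, optical function and frame). In particular $\partial_tY$ does not occur in the principal terms or in $\mathrm{er}$. -/

import Mathlib

open scoped Manifold ContDiff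

noncomputable section

/-! ### Coordinates, Christoffel symbols and curvature -/

/-- Points of a coordinate patch `(t, x¹, x², x³)` of space-time; index `0` is time. -/
abbrev Coord := Fin 4 → ℝ

/-- The partial derivative `∂_a f`. -/
def pd {d : ℕ} (a : Fin d) (f : (Fin d → ℝ) → ℝ) (x : Fin d → ℝ) : ℝ :=
  fderiv ℝ f x (Pi.single a 1)

/-- `Γ^c_{ab}` of a (pseudo-)Riemannian metric given by its components. -/
def christoffel {d : ℕ} (G : (Fin d → ℝ) → Matrix (Fin d) (Fin d) ℝ) (x : Fin d → ℝ)
    (c a b : Fin d) : ℝ :=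
  2⁻¹ * ∑ e, (G x)⁻¹ c e *
    (pd a (fun y => G y b e) x + pd b (fun y => G y a e) x - pd e (fun y => G y a b) x)

/-- `R^p_{bcd} = ∂_c Γ^p_{db} - ∂_d Γ^p_{cb} + Γ^p_{cm} Γ^m_{db} - Γ^p_{dm} Γ^m_{cb}`. -/
def riemannUp {d : ℕ} (G : (Fin d → ℝ) → Matrix (Fin d) (Fin d) ℝ) (x : Fin d → ℝ)
    (p b c e : Fin d) : ℝ :=
  pd c (fun y => christoffel G y p e b) x - pd e (fun y => christoffel G y p c b) x
    + ∑ m, christoffel G x p c m * christoffel G x m e b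
    - ∑ m, christoffel G x p e m * christoffel G x m c b

/-- `R_{abcd} = G_{ap} R^p_{bcd}`. -/
def riemannDown {d : ℕ} (G : (Fin d → ℝ) → Matrix (Fin d) (Fin d) ℝ) (x : Fin d → ℝ)
    (a b c e : Fin d) : ℝ :=
  ∑ p, G x a p * riemannUp G x p b c e

/-- `Ric_{be} = R^p_{bpe}`. -/
def ricci {d : ℕ} (G : (Fin d → ℝ) → Matrix (Fin d) (Fin d) ℝ) (x : Fin d → ℝ)
    (b e : Fin d) : ℝ :=
  ∑ p, riemannUp G x p b p e

/-! ### The space-time metric in a coordinate patch -/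

/-- Components, in a patch `(t, x¹, x², x³)` whose spatial coordinates do not depend on time, of
the lapse `n`, the shift `Y`, the metrics `g` of the slices `{t = const}` and the fixed background
metric `gh` of the spatial manifold. -/
structure LocalMetric where
  n : Coord → ℝ
  Y : Coord → Fin 3 → ℝ
  g : Coord → Matrix (Fin 3) (Fin 3) ℝ
  gh : (Fin 3 → ℝ) → Matrix (Fin 3) (Fin 3) ℝ

namespace LocalMetric

variable (F : LocalMetric)

/-- The coframe component `(dx^i + Y^i dt)(∂_a)`. -/
def coframe (x : Coord) (i : Fin 3) (a : Fin 4) : ℝ :=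
  Fin.cases (F.Y x i) (fun m => if m = i then 1 else 0) a

/-- The Lorentz metric `- n² dt ⊗ dt + g_{ij} (dx^i + Y^i dt) ⊗ (dx^j + Y^j dt)`. -/
def G (x : Coord) : Matrix (Fin 4) (Fin 4) ℝ := Matrix.of fun a b =>
  -(F.n x) ^ 2 * (if a = 0 then 1 else 0) * (if b = 0 then 1 else 0)
    + ∑ i, ∑ j, F.g x i j * F.coframe x i a * F.coframe x j b

/-- The metric of the slice at time `t`, as a metric on the spatial patch. -/
def slice (t : ℝ) (y : Fin 3 → ℝ) : Matrix (Fin 3) (Fin 3) ℝ :=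
  F.g (Fin.cons t y : Fin 4 → ℝ)

/-- The vector field `U^l = g^{ij} (Γ^l_{ij} - \hat Γ^l_{ij})`. -/
def U (x : Coord) (l : Fin 3) : ℝ :=
  ∑ i, ∑ j, (F.g x)⁻¹ i j *
    (christoffel (F.slice (x 0)) (Fin.tail x) l i j - christoffel F.gh (Fin.tail x) l i j)

/-- The second fundamental form `k = - 1/2 L_T g`, that is
`k_{ij} = - (2 n)⁻¹ (∂_t g_{ij} - (L_Y g)_{ij})`. -/
def k (x : Coord) (i j : Fin 3) : ℝ :=
  -(2 * F.n x)⁻¹ * (pd 0 (fun y => F.g y i j) x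
    - ∑ m, (F.Y x m * pd m.succ (fun y => F.g y i j) x
        + F.g x m j * pd i.succ (fun y => F.Y y m) x
        + F.g x i m * pd j.succ (fun y => F.Y y m) x))

/-- `Tr k = g^{ij} k_{ij}`. -/
def trk (x : Coord) : ℝ := ∑ i, ∑ j, (F.g x)⁻¹ i j * F.k x i j

/-- The trace-free part of `k`. -/
def khat (x : Coord) (i j : Fin 3) : ℝ := F.k x i j - 3⁻¹ * F.trk x * F.g x i j

/-- `(\hat ∇ g)_{mij} = \hat ∇_m g_{ij}`. -/
def Dg (x : Coord) (m i j : Fin 3) : ℝ :=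
  pd m.succ (fun y => F.g y i j) x
    - ∑ p, christoffel F.gh (Fin.tail x) p m i * F.g x p j
    - ∑ p, christoffel F.gh (Fin.tail x) p m j * F.g x i p

/-- The space-time inner product of two vectors. -/
def inn (x : Coord) (V W : Fin 4 → ℝ) : ℝ := ∑ a, ∑ b, F.G x a b * V a * W b

/-- The derivative of a function along a space-time vector field. -/
def dir (X : Coord → Fin 4 → ℝ) (f : Coord → ℝ) (x : Coord) : ℝ := ∑ a, X x a * pd a f x

/-- The covariant derivative `𝐃_X V` of the Lorentz metric. -/
def D (X V : Coord → Fin 4 → ℝ) (x : Coord) (c : Fin 4) : ℝ :=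
  dir X (fun y => V y c) x + ∑ a, ∑ b, christoffel F.G x c a b * X x a * V x b

/-- The space-time curvature `𝐑(X, Y, Z, W)`. -/
def Rm (x : Coord) (X Y Z W : Fin 4 → ℝ) : ℝ :=
  ∑ a, ∑ b, ∑ c, ∑ e, riemannDown F.G x a b c e * X a * Y b * Z c * W e

/-- The future unit normal `T = n⁻¹ (∂_t - Y)` of the slices. -/
def T (x : Coord) : Fin 4 → ℝ := Fin.cons (F.n x)⁻¹ fun i => -(F.n x)⁻¹ * F.Y x i

/-- The part of space-time described by times in `I` and spatial coordinates in `V`. -/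
def patch (I : Set ℝ) (V : Set (Fin 3 → ℝ)) : Set Coord := {x | x 0 ∈ I ∧ Fin.tail x ∈ V}

/-- The components are those of a vacuum space-time in CMCSH gauge over `I × V`. -/
structure IsSolution (I : Set ℝ) (V : Set (Fin 3 → ℝ)) : Prop where
  n_smooth : ContDiffOn ℝ 2 F.n (patch I V)
  Y_smooth : ∀ i, ContDiffOn ℝ 2 (fun x => F.Y x i) (patch I V)
  g_smooth : ∀ i j, ContDiffOn ℝ 2 (fun x => F.g x i j) (patch I V)
  gh_smooth : ∀ i j, ContDiffOn ℝ ∞ (fun y => F.gh y i j) V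
  n_pos : ∀ x ∈ patch I V, 0 < F.n x
  g_pos : ∀ x ∈ patch I V, (F.g x).PosDef
  gh_pos : ∀ y ∈ V, (F.gh y).PosDef
  cmc : ∀ x ∈ patch I V, F.trk x = x 0
  harmonic : ∀ x ∈ patch I V, ∀ l, F.U x l = 0
  vacuum : ∀ x ∈ patch I V, ∀ a b, ricci F.G x a b = 0

end LocalMetric

/-! ### Contraction patterns

At a point of the surface `S` let `f₀ = N`, `f₁ = e₁`, `f₂ = e₂` be a `g`-orthonormal frame of the
slice with `e₁`, `e₂` tangent to `S`. A tensor of the slice is an array over `Fin 3`, and an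
`S`-tangent tensor is an array over `Fin 2`. In such a frame the components of `g`, `g⁻¹`, of the
induced metric and of the volume forms are constants, and the two projections of a tensor by `N`
and by `Π = g - N ⊗ N` are its components along `f₀` and along `f₁, f₂`. A tensor expression that
is a sum of contractions of projections of `T` with `g` is thus a linear map with constant
coefficients of the array of `T` that commutes with rotations of `(e₁, e₂)`. -/

/-- The rotation by the angle `φ` in the plane of `e₁, e₂`. -/
def rot2 (φ : ℝ) : Matrix (Fin 2) (Fin 2) ℝ :=
  !![Real.cos φ, Real.sin φ; -Real.sin φ, Real.cos φ]

/-- The same rotation acting on `N, e₁, e₂`. -/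
def rot3 (φ : ℝ) : Matrix (Fin 3) (Fin 3) ℝ :=
  !![1, 0, 0; 0, Real.cos φ, Real.sin φ; 0, -Real.sin φ, Real.cos φ]

/-- How arrays of frame components change when the frame is rotated. -/
class FrameRotation (V : Type) where
  rot : ℝ → V → V

instance : FrameRotation ℝ := ⟨fun _ v => v⟩

instance {V W : Type} [FrameRotation V] [FrameRotation W] : FrameRotation (V × W) :=
  ⟨fun φ v => (FrameRotation.rot φ v.1, FrameRotation.rot φ v.2)⟩

instance {V : Type} [AddCommGroup V] [Module ℝ V] [FrameRotation V] :
    FrameRotation (Fin 2 → V) :=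
  ⟨fun φ v A => ∑ B, rot2 φ A B • FrameRotation.rot φ (v B)⟩

instance {V : Type} [AddCommGroup V] [Module ℝ V] [FrameRotation V] :
    FrameRotation (Fin 3 → V) :=
  ⟨fun φ v a => ∑ b, rot3 φ a b • FrameRotation.rot φ (v b)⟩

/-- Independence of the choice of `e₁, e₂`: a linear map of arrays that commutes with rotations
sends (the components of) tensor fields to `S`-tangent tensor fields. -/
def IsFrameInvariant {V W : Type} [AddCommGroup V] [Module ℝ V] [AddCommGroup W] [Module ℝ W]
    [FrameRotation V] [FrameRotation W] (P : V →ₗ[ℝ] W) : Prop :=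
  ∀ φ v, P (FrameRotation.rot φ v) = FrameRotation.rot φ (P v)

/-- Arrays of `S`-tangent `1`-tensors. -/
abbrev S1 := Fin 2 → ℝ

/-- Arrays of `S`-tangent `2`-tensors. -/
abbrev S2 := Fin 2 → Fin 2 → ℝ

/-- Arrays of `3`-tensors of the slice. -/
abbrev Sigma3 := Fin 3 → Fin 3 → Fin 3 → ℝ

/-- Arrays of the pair `(\hat ∇ g, k)`. -/
abbrev GKData := Sigma3 × (Fin 3 → Fin 3 → ℝ)

/-- Arrays of the collection `\hat ε, ε, δ, ∇_N log n, ∇̸ log n, Tr k`. -/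
abbrev SlpData := S2 × S1 × ℝ × ℝ × S1 × ℝ

/-- Arrays of the preceding collection together with `\hat ∇ g`. -/
abbrev PiData := SlpData × Sigma3

/-- Arrays of the preceding collection together with `\hat χ, ∇̸ log a, \hat θ` and `tr χ`. An error
term `(π + F) · π + tr χ π` is a bilinear map with constant coefficients of such an array and of one
in `PiData`. -/
abbrev FactorData := PiData × S2 × S1 × S2 × ℝ

/-- Arrays of `4`-tensors of the slice. -/
abbrev HatData := Fin 3 → Fin 3 → Fin 3 → Fin 3 → ℝ

/-- The area form of `S` in the frame `e₁, e₂`. -/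
def eps2 : Matrix (Fin 2) (Fin 2) ℝ := !![0, 1; -1, 0]

/-- The space-time volume form in the frame `T, N, e₁, e₂`. -/
def eps4 (a b c d : Fin 4) : ℝ :=
  Matrix.det (Matrix.of fun i j : Fin 4 => if ![a, b, c, d] i = j then (1 : ℝ) else 0)

/-! ### The canonical null frame of an optical function -/

/-- Components of the metric, an optical function `u`, and two vector fields `e₁, e₂` tangent to
the slices. -/
structure LocalFrame extends LocalMetric where
  u : Coord → ℝ
  e : Fin 2 → Coord → Fin 3 → ℝ

namespace LocalFrame

open LocalMetric

variable (F : LocalFrame)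

/-- `|∇u|_g`. -/
def gradNorm (x : Coord) : ℝ :=
  Real.sqrt (∑ i : Fin 3, ∑ j : Fin 3, (F.g x)⁻¹ i j * pd i.succ F.u x * pd j.succ F.u x)

/-- The unit normal, in the slice, of `S = {t = const, u = const}`, pointing to decreasing `u`
(the outward side of the outgoing cones `{u = const}`). -/
def N (x : Coord) (i : Fin 3) : ℝ :=
  -(F.gradNorm x)⁻¹ * ∑ j : Fin 3, (F.g x)⁻¹ i j * pd j.succ F.u x

/-- The frame `N, e₁, e₂` of the slice. -/
def f (a : Fin 3) (x : Coord) : Fin 3 → ℝ := (Fin.cons (F.N x) fun A => F.e A x : Fin 3 → _) a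

/-- A vector field tangent to the slices as a space-time vector field. -/
def lift (X : Coord → Fin 3 → ℝ) (x : Coord) : Fin 4 → ℝ := Fin.cons 0 (X x)

/-- `e_A` as a space-time vector field. -/
def eS (A : Fin 2) : Coord → Fin 4 → ℝ := lift (F.e A)

/-- `N` as a space-time vector field. -/
def NS : Coord → Fin 4 → ℝ := lift F.N

/-- The null vector field `L = T + N`. -/
def L (x : Coord) : Fin 4 → ℝ := F.T x + F.NS x

/-- The null vector field `\underline L = T - N`. -/
def Lb (x : Coord) : Fin 4 → ℝ := F.T x - F.NS x

/-- The null lapse `b`, where `b⁻¹ = T(u)`. -/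
def b (x : Coord) : ℝ := (dir F.T F.u x)⁻¹

/-- `u` is an optical function on `W` with `T(u) > 0`, and `e₁, e₂` is a `g`-orthonormal frame of
the surfaces `S = {t = const, u = const}`. -/
structure IsCanonical (W : Set Coord) : Prop where
  u_smooth : ContDiffOn ℝ 2 F.u W
  e_smooth : ∀ A i, ContDiffOn ℝ 1 (fun x => F.e A x i) W
  eikonal : ∀ x ∈ W, ∑ a, ∑ c, (F.G x)⁻¹ a c * pd a F.u x * pd c F.u x = 0
  T_u_pos : ∀ x ∈ W, 0 < dir F.T F.u x
  tangent : ∀ x ∈ W, ∀ A, dir (F.eS A) F.u x = 0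
  orthonormal : ∀ x ∈ W, ∀ A B, ∑ i, ∑ j, F.g x i j * F.e A x i * F.e B x j =
    if A = B then 1 else 0

/-! #### Frame components -/

/-- The frame components of `k`. -/
def kF (x : Coord) (a c : Fin 3) : ℝ := ∑ i, ∑ j, F.k x i j * F.f a x i * F.f c x j

/-- The frame components of the trace-free part of `k`. -/
def khF (x : Coord) (a c : Fin 3) : ℝ := ∑ i, ∑ j, F.khat x i j * F.f a x i * F.f c x j

/-- The frame components of `\hat ∇ g`. -/
def DgF (x : Coord) (a c d : Fin 3) : ℝ :=
  ∑ m, ∑ i, ∑ j, F.Dg x m i j * F.f a x m * F.f c x i * F.f d x j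

/-- The frame components of `g · \hat R`, that is `g_{ip} \hat R^p_{jlm}`. -/
def hatR (x : Coord) (a c d h : Fin 3) : ℝ :=
  ∑ i, ∑ p, ∑ j, ∑ l, ∑ m, F.g x i p * riemannUp F.gh (Fin.tail x) p j l m
    * F.f a x i * F.f c x j * F.f d x l * F.f h x m

/-- `δ = \hat k_{NN}`. -/
def delta (x : Coord) : ℝ := F.khF x 0 0

/-- `ε_A = \hat k_{AN}`. -/
def ep (x : Coord) (A : Fin 2) : ℝ := F.khF x A.succ 0

/-- `\hat ε`, the trace-free part of `ε_{AB} = \hat k_{AB}`, namely `ε_{AB} + δ_{AB} δ / 2`. -/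
def eh (x : Coord) (A B : Fin 2) : ℝ :=
  F.khF x A.succ B.succ + (if A = B then 2⁻¹ * F.delta x else 0)

/-- `∇_N log n`. -/
def NLogn (x : Coord) : ℝ := dir F.NS (fun y => Real.log (F.n y)) x

/-- `∇̸_A log n`. -/
def sLogn (x : Coord) (A : Fin 2) : ℝ := dir (F.eS A) (fun y => Real.log (F.n y)) x

/-- `∇̸_A log b`. It equals `∇̸_A log a`, as `a` differs from `b` on each cone by a constant. -/
def sLogb (x : Coord) (A : Fin 2) : ℝ := dir (F.eS A) (fun y => Real.log (F.b y)) x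

/-- `χ_{AB} = ⟨𝐃_A L, e_B⟩`. -/
def chi (x : Coord) (A B : Fin 2) : ℝ := F.inn x (F.D (F.eS A) F.L x) (F.eS B x)

/-- `θ_{AB} = ⟨𝐃_A N, e_B⟩`. -/
def theta (x : Coord) (A B : Fin 2) : ℝ := F.inn x (F.D (F.eS A) F.NS x) (F.eS B x)

/-- The trace of an `S`-tangent `2`-tensor. -/
def trS (T : S2) : ℝ := ∑ A, T A A

/-- The trace-free part `T - (tr T) γ / 2` of an `S`-tangent `2`-tensor. -/
def hatS (T : S2) : S2 := fun A B => T A B - (if A = B then 2⁻¹ * trS T else 0)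

/-- The arrays of `(\hat ∇ g, k)`. -/
def gk (x : Coord) : GKData := (F.DgF x, F.kF x)

/-- The arrays of `\hat ε, ε, δ, ∇_N log n, ∇̸ log n, Tr k`. -/
def slp (x : Coord) : SlpData :=
  (F.eh x, F.ep x, F.delta x, F.NLogn x, F.sLogn x, F.trk x)

/-- The arrays of `\hat ε, ε, δ, ∇_N log n, ∇̸ log n, Tr k` and `\hat ∇ g`. -/
def ckpi (x : Coord) : PiData := (F.slp x, F.DgF x)

/-- The arrays of the possible first factors of an error term. -/
def factor (x : Coord) : FactorData :=
  (F.ckpi x, hatS (F.chi x), F.sLogb x, hatS (F.theta x), trS (F.chi x))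

/-! #### Derivatives of `S`-tangent tensor fields -/

/-- `⟨𝐃_X e_A, e_B⟩`. -/
def conn (X : Coord → Fin 4 → ℝ) (x : Coord) (A B : Fin 2) : ℝ :=
  F.inn x (F.D X (F.eS A) x) (F.eS B x)

/-- `(∇̸_X ξ)_A`. -/
def cov1 (X : Coord → Fin 4 → ℝ) (ξ : Coord → S1) (x : Coord) (A : Fin 2) : ℝ :=
  dir X (fun y => ξ y A) x - ∑ B, F.conn X x A B * ξ x B

/-- `(∇̸_X T)_{AB}`. -/
def cov2 (X : Coord → Fin 4 → ℝ) (T : Coord → S2) (x : Coord) (A B : Fin 2) : ℝ :=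
  dir X (fun y => T y A B) x - ∑ C, F.conn X x A C * T x C B - ∑ C, F.conn X x B C * T x A C

/-- `∇̸_A h` for a scalar. -/
def grad (h : Coord → ℝ) (x : Coord) (A : Fin 2) : ℝ := dir (F.eS A) h x

/-- `div ξ = ∇̸^A ξ_A`. -/
def div1 (ξ : Coord → S1) (x : Coord) : ℝ := ∑ A, F.cov1 (F.eS A) ξ x A

/-- `curl ξ = ∈^{AB} ∇̸_A ξ_B`. -/
def curl1 (ξ : Coord → S1) (x : Coord) : ℝ := ∑ A, ∑ B, eps2 A B * F.cov1 (F.eS A) ξ x B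

/-- `∇̸^B T_{AB}`. -/
def div2 (T : Coord → S2) (x : Coord) (A : Fin 2) : ℝ := ∑ B, F.cov2 (F.eS B) T x A B

/-- `(curl T)_A = ∈^{BC} ∇̸_B T_{AC}`. -/
def curl2 (T : Coord → S2) (x : Coord) (A : Fin 2) : ℝ :=
  ∑ B, ∑ C, eps2 B C * F.cov2 (F.eS B) T x A C

/-- The `S`-tangential covariant derivatives of `\hat ε, ε, δ, ∇_N log n, ∇̸ log n, Tr k`; the
first index is that of the derivative. -/
def gradSlp (x : Coord) : Fin 2 → SlpData := fun C =>
  (F.cov2 (F.eS C) F.eh x, F.cov1 (F.eS C) F.ep x, F.grad F.delta x C, F.grad F.NLogn x C,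
    F.cov1 (F.eS C) F.sLogn x, F.grad F.trk x C)

/-! #### Null components of the curvature -/

/-- `α_{AB} = 𝐑(L, e_A, L, e_B)`. -/
def alpha (x : Coord) (A B : Fin 2) : ℝ := F.Rm x (F.L x) (F.eS A x) (F.L x) (F.eS B x)

/-- `β_A = 𝐑(e_A, L, \underline L, L) / 2`. -/
def beta (x : Coord) (A : Fin 2) : ℝ := 2⁻¹ * F.Rm x (F.eS A x) (F.L x) (F.Lb x) (F.L x)

/-- `\underline β_A = 𝐑(e_A, \underline L, \underline L, L) / 2`. -/
def betab (x : Coord) (A : Fin 2) : ℝ := 2⁻¹ * F.Rm x (F.eS A x) (F.Lb x) (F.Lb x) (F.L x)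

/-- `ρ = 𝐑(\underline L, L, \underline L, L) / 4`. -/
def rho (x : Coord) : ℝ := 4⁻¹ * F.Rm x (F.Lb x) (F.L x) (F.Lb x) (F.L x)

/-- The orthonormal frame `T, N, e₁, e₂` of space-time. -/
def E (a : Fin 4) (x : Coord) : Fin 4 → ℝ := ![F.T x, F.NS x, F.eS 0 x, F.eS 1 x] a

/-- The signs `⟨E_a, E_a⟩`. -/
def eta (a : Fin 4) : ℝ := if a = 0 then -1 else 1

/-- The components of a vector in the frame `T, N, e₁, e₂`. -/
def compE (x : Coord) (X : Fin 4 → ℝ) (a : Fin 4) : ℝ := eta a * F.inn x X (F.E a x)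

/-- The Hodge dual `⋆𝐑(X, Y, Z, W) = 1/2 ∈(X, Y, E^c, E^d) 𝐑(E_c, E_d, Z, W)`. -/
def dualRm (x : Coord) (X Y Z W : Fin 4 → ℝ) : ℝ :=
  2⁻¹ * ∑ a, ∑ c, ∑ d, ∑ h, eps4 a c d h * F.compE x X a * F.compE x Y c * eta d * eta h
    * F.Rm x (F.E d x) (F.E h x) Z W

/-- `σ = ⋆𝐑(\underline L, L, \underline L, L) / 4`. -/
def sigma (x : Coord) : ℝ := 4⁻¹ * F.dualRm x (F.Lb x) (F.L x) (F.Lb x) (F.L x)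

end LocalFrame

/-! ### Space-times over a 3-manifold -/

/-- The tangent space of a `3`-manifold at a point. -/
abbrev TS (M : Type*) [TopologicalSpace M] [ChartedSpace (EuclideanSpace ℝ (Fin 3)) M] (p : M) :=
  TangentSpace (𝓡 3) p

section charts

variable {M : Type*} [TopologicalSpace M] [ChartedSpace (EuclideanSpace ℝ (Fin 3)) M]

/-- The point of `M` with coordinates `y` in the chart `φ`. -/
def chartPt (φ : OpenPartialHomeomorph M (EuclideanSpace ℝ (Fin 3))) (y : Fin 3 → ℝ) : M :=
  φ.symm (WithLp.toLp 2 y)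

/-- The coordinate vector field `∂_i` of the chart `φ`. -/
def chartVec (φ : OpenPartialHomeomorph M (EuclideanSpace ℝ (Fin 3))) (y : Fin 3 → ℝ)
    (i : Fin 3) : TS M (chartPt φ y) :=
  mfderiv (𝓡 3) (𝓡 3) φ.symm (WithLp.toLp 2 y)
    (EuclideanSpace.single i (1 : ℝ) : EuclideanSpace ℝ (Fin 3))

/-- The components of a tangent vector in the chart `φ`. -/
def chartComp (φ : OpenPartialHomeomorph M (EuclideanSpace ℝ (Fin 3))) (p : M) (v : TS M p)
    (i : Fin 3) : ℝ :=
  let w : EuclideanSpace ℝ (Fin 3) := mfderiv (𝓡 3) (𝓡 3) φ p v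
  w i

/-- The spatial coordinates covered by the chart `φ`. -/
def chartDom (φ : OpenPartialHomeomorph M (EuclideanSpace ℝ (Fin 3))) : Set (Fin 3 → ℝ) :=
  {y | WithLp.toLp 2 y ∈ φ.target}

end charts

/-- Lapse, shift, slice metrics and background metric on `ℝ × M`. -/
structure SpacetimeData (M : Type*) [TopologicalSpace M]
    [ChartedSpace (EuclideanSpace ℝ (Fin 3)) M] where
  n : ℝ → M → ℝ
  Y : ℝ → (p : M) → TS M p
  g : ℝ → (p : M) → TS M p →ₗ[ℝ] TS M p →ₗ[ℝ] ℝ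
  gh : (p : M) → TS M p →ₗ[ℝ] TS M p →ₗ[ℝ] ℝ

/-- The components of the data in the chart `φ` of `M`. -/
def SpacetimeData.loc {M : Type*} [TopologicalSpace M]
    [ChartedSpace (EuclideanSpace ℝ (Fin 3)) M] (S : SpacetimeData M)
    (φ : OpenPartialHomeomorph M (EuclideanSpace ℝ (Fin 3))) : LocalMetric where
  n x := S.n (x 0) (chartPt φ (Fin.tail x))
  Y x := chartComp φ _ (S.Y (x 0) (chartPt φ (Fin.tail x)))
  g x := Matrix.of fun i j => S.g (x 0) (chartPt φ (Fin.tail x))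
    (chartVec φ (Fin.tail x) i) (chartVec φ (Fin.tail x) j)
  gh y := Matrix.of fun i j => S.gh (chartPt φ y) (chartVec φ y i) (chartVec φ y j)

/-- A vacuum space-time on `I × M` in CMCSH gauge relative to the background metric `gh`: the
regularity, positivity, gauge and Einstein equations hold in every chart of `M`. -/
structure CMCSHSpacetime (M : Type*) [TopologicalSpace M]
    [ChartedSpace (EuclideanSpace ℝ (Fin 3)) M] extends SpacetimeData M where
  I : Set ℝ
  I_open : IsOpen I
  solution : ∀ φ ∈ IsManifold.maximalAtlas (𝓡 3) ∞ M,
    (toSpacetimeData.loc φ).IsSolution I (chartDom φ)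

/-- A time-dependent function `u` and two time-dependent vector fields on `M`. -/
structure FrameData (M : Type*) [TopologicalSpace M]
    [ChartedSpace (EuclideanSpace ℝ (Fin 3)) M] where
  u : ℝ → M → ℝ
  e : Fin 2 → ℝ → (p : M) → TS M p

/-- The components of all the fields in the chart `φ` of `M`. -/
def FrameData.loc {M : Type*} [TopologicalSpace M]
    [ChartedSpace (EuclideanSpace ℝ (Fin 3)) M] (O : FrameData M) (S : SpacetimeData M)
    (φ : OpenPartialHomeomorph M (EuclideanSpace ℝ (Fin 3))) : LocalFrame where
  toLocalMetric := S.loc φ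
  u x := O.u (x 0) (chartPt φ (Fin.tail x))
  e A x := chartComp φ _ (O.e A (x 0) (chartPt φ (Fin.tail x)))

/-- The part of a region `W` of `ℝ × M` covered by the chart `φ`, in coordinates. -/
def chartRegion {M : Type*} [TopologicalSpace M]
    [ChartedSpace (EuclideanSpace ℝ (Fin 3)) M] (W : Set (ℝ × M))
    (φ : OpenPartialHomeomorph M (EuclideanSpace ℝ (Fin 3))) : Set Coord :=
  {x | Fin.tail x ∈ chartDom φ ∧ (x 0, chartPt φ (Fin.tail x)) ∈ W}

/-- An optical function `u` on an open region `W` of the space-time, with a local orthonormal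
frame `e₁, e₂` of the surfaces `{t = const, u = const}`; together with `L` and `\underline L` it
is the canonical null frame. -/
structure CanonicalFrame {M : Type*} [TopologicalSpace M]
    [ChartedSpace (EuclideanSpace ℝ (Fin 3)) M] (S : CMCSHSpacetime M) extends FrameData M where
  W : Set (ℝ × M)
  W_open : IsOpen W
  W_subset : ∀ q ∈ W, q.1 ∈ S.I
  canonical : ∀ φ ∈ IsManifold.maximalAtlas (𝓡 3) ∞ M,
    (toFrameData.loc S.toSpacetimeData φ).IsCanonical (chartRegion W φ)

end

/-! In the orthonormal frame `T`, `N`, `e₁`, `e₂` the vacuum equations allow curvature components to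
be traded for one another. Ric(N, e_A) = 0 and Ric(T, e_A) = 0 turn β and β̲ into −∑_B R(e_B, N,
e_B, e_A) ∓ ∑_B R(e_B, T, e_B, e_A) (`beta_eq`, `betab_eq`). The diagonal Ricci components give ρ =
−½ ∑ R(e_A, e_B, e_A, e_B) (`rho_eq`), and the Hodge dual gives σ = −R(N, T, e₁, e₂) (`sigma_eq`).
In each of these the last two arguments are tangent to S. In the Gauss and Codazzi equations exactly
those two arguments are the directions of differentiation, so only S-tangential derivatives occur.

Codazzi (`codazzi`) expresses R(·, T, ·, ·) by first derivatives of k. For the spatial components,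
the Christoffel symbols of the first kind of the slice are Γ_{l,ij} = C_{lij} + g_{lp} Γ̂^p_{ij},
with C the Koszul combination of ∇̂g. The curvature is then g·R̂, plus antisymmetrised derivatives
of C, plus C·C and k·k (`riemannDown_succ`, `gauss`). The potentials are read off from C and k.

For α, the vacuum equations leave the trace-free part of 2R(T, e_A, T, e_B) − R(e_B, T, N, e_A) −
R(e_A, T, N, e_B) (`alpha_eq`). The second variation equation contributes the derivative of k along
T and the Hessian of log n; Codazzi contributes the derivative of k along N and tangential
derivatives of ε. The two derivatives of k add up to 2∇̸_L.

Passing from the connection of the slice to that of S costs products of the coefficients ⟨𝐃 e_A, N⟩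
with components of k, C or ∇ log n. These coefficients are admissible first factors: T and L are
metrically dual to −n dt and −b du, so their exterior derivatives are explicit (`inn_D_sub_swap`).
The coefficients thereby reduce to ∇̸ log b, ∇̸ log n, k and θ, with no time derivative of the
shift, and θ is recovered from its trace-free part, tr χ and k (`linIn_theta`).

The frame is only of class C¹ whereas T is of class C². The Ricci identity is therefore applied to T
alone, and the Gauss equation is derived in coordinates, where two derivatives of the metric
suffice. Universality is tracked by `LinIn`, whose linear functional is chosen before any space-time
is given. -/

noncomputable section

/-! ### Partial derivatives -/

section PartialDerivatives

open Filter Topology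

variable {d : ℕ} {f h : (Fin d → ℝ) → ℝ} {x : Fin d → ℝ} {a b : Fin d}

theorem pd_add (hf : DifferentiableAt ℝ f x) (hh : DifferentiableAt ℝ h x) :
    pd a (fun y => f y + h y) x = pd a f x + pd a h x := by
  unfold pd; rw [fderiv_fun_add hf hh]; rfl

theorem pd_sub (hf : DifferentiableAt ℝ f x) (hh : DifferentiableAt ℝ h x) :
    pd a (fun y => f y - h y) x = pd a f x - pd a h x := by
  unfold pd; rw [fderiv_fun_sub hf hh]; rfl

theorem pd_mul (hf : DifferentiableAt ℝ f x) (hh : DifferentiableAt ℝ h x) :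
    pd a (fun y => f y * h y) x = pd a f x * h x + f x * pd a h x := by
  unfold pd; rw [fderiv_fun_mul hf hh]; simp; ring

theorem pd_const_mul (c : ℝ) (hf : DifferentiableAt ℝ f x) :
    pd a (fun y => c * f y) x = c * pd a f x := by
  unfold pd; rw [fderiv_const_mul hf]; simp

theorem pd_const (c : ℝ) : pd a (fun _ => c) x = 0 := by
  unfold pd; simp

theorem pd_sum {ι : Type*} {s : Finset ι} {f : ι → (Fin d → ℝ) → ℝ}
    (hf : ∀ i ∈ s, DifferentiableAt ℝ (f i) x) :
    pd a (fun y => ∑ i ∈ s, f i y) x = ∑ i ∈ s, pd a (f i) x := by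
  unfold pd; rw [fderiv_fun_sum hf]; simp

theorem pd_congr (hfh : f =ᶠ[𝓝 x] h) : pd a f x = pd a h x := by
  unfold pd; rw [hfh.fderiv_eq]

theorem contDiffAt_pd {n : WithTop ℕ∞} (hf : ContDiffAt ℝ (n + 1) f x) :
    ContDiffAt ℝ n (pd a f) x :=
  (hf.fderiv_right le_rfl).clm_apply contDiffAt_const

theorem contDiffAt_one_pd (hf : ContDiffAt ℝ 2 f x) : ContDiffAt ℝ 1 (pd a f) x :=
  contDiffAt_pd (by simpa [one_add_one_eq_two] using hf)

theorem differentiableAt_pd (hf : ContDiffAt ℝ 2 f x) : DifferentiableAt ℝ (pd a f) x :=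
  (contDiffAt_one_pd hf).differentiableAt (by norm_num)

theorem pd_pd_comm (hf : ContDiffAt ℝ 2 f x) : pd a (pd b f) x = pd b (pd a f) x := by
  have hd : DifferentiableAt ℝ (fderiv ℝ f) x :=
    (hf.fderiv_right (m := 1) (by norm_num [one_add_one_eq_two])).differentiableAt (by norm_num)
  have key : ∀ v w : Fin d → ℝ,
      fderiv ℝ (fun y => fderiv ℝ f y v) x w = fderiv ℝ (fderiv ℝ f) x w v := fun v w => by
    rw [fderiv_clm_apply hd (differentiableAt_const v)]; simp
  have hs := (hf.isSymmSndFDerivAt (by simp)) (Pi.single a 1) (Pi.single b 1)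
  unfold pd
  rw [key, key, hs]

theorem fderiv_eq_sum_pd (v : Fin d → ℝ) : fderiv ℝ f x v = ∑ a, v a * pd a f x := by
  conv_lhs => rw [← Finset.univ_sum_single v]
  rw [map_sum]
  refine Finset.sum_congr rfl fun a _ => ?_
  have : (Pi.single a (v a) : Fin d → ℝ) = v a • Pi.single a 1 := by
    rw [← Pi.single_smul]; simp
  rw [this, map_smul]; rfl

end PartialDerivatives

/-! ### Regularity of the inverse matrix -/

theorem contDiffAt_det {m : ℕ} {E : Type*} [NormedAddCommGroup E] [NormedSpace ℝ E]
    {n : WithTop ℕ∞} {A : E → Matrix (Fin m) (Fin m) ℝ} {x : E}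
    (hA : ∀ i j, ContDiffAt ℝ n (fun y => A y i j) x) :
    ContDiffAt ℝ n (fun y => (A y).det) x := by
  simp only [Matrix.det_apply']
  exact ContDiffAt.sum fun σ _ => contDiffAt_const.mul (contDiffAt_prod fun i _ => hA _ _)

/-- Cramer's rule: each entry is det⁻¹ times a cofactor, itself the determinant of a matrix of
entries of `A` and constants. -/
theorem contDiffAt_inv_apply {m : ℕ} {E : Type*} [NormedAddCommGroup E] [NormedSpace ℝ E]
    {n : WithTop ℕ∞} {A : E → Matrix (Fin m) (Fin m) ℝ} {x : E}
    (hA : ∀ i j, ContDiffAt ℝ n (fun y => A y i j) x) (hx : IsUnit (A x).det) (i j : Fin m) :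
    ContDiffAt ℝ n (fun y => (A y)⁻¹ i j) x := by
  have hadj : ContDiffAt ℝ n (fun y => (A y).adjugate i j) x := by
    simp only [Matrix.adjugate_apply]
    refine contDiffAt_det fun k l => ?_
    by_cases hk : k = j
    · subst hk; simp only [Matrix.updateRow_self]; exact contDiffAt_const
    · simp only [Matrix.updateRow_ne hk]; exact hA _ _
  have : (fun y => (A y)⁻¹ i j) = fun y => ((A y).det)⁻¹ * (A y).adjugate i j := by
    funext y; simp [Matrix.inv_def]
  rw [this]
  exact ((contDiffAt_det hA).inv hx.ne_zero).mul hadj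

/-! ### Christoffel symbols and curvature of a metric -/

section Metric

open Filter Topology

variable {d : ℕ} {G : (Fin d → ℝ) → Matrix (Fin d) (Fin d) ℝ} {x : Fin d → ℝ}

/-- Christoffel symbols of the first kind `Γ_{e,ab}`. -/
def chl (G : (Fin d → ℝ) → Matrix (Fin d) (Fin d) ℝ) (e a b : Fin d) (x : Fin d → ℝ) : ℝ :=
  2⁻¹ * (pd a (fun y => G y b e) x + pd b (fun y => G y a e) x - pd e (fun y => G y a b) x)

/-- `G` is a nondegenerate metric of class `C²` near `x`. -/
structure MetricAt (G : (Fin d → ℝ) → Matrix (Fin d) (Fin d) ℝ) (x : Fin d → ℝ) : Prop where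
  smooth : ∀ a b, ContDiffAt ℝ 2 (fun y => G y a b) x
  symm : ∀ᶠ y in 𝓝 x, ∀ a b, G y a b = G y b a
  det : IsUnit (G x).det

namespace MetricAt

theorem eventually (hG : MetricAt G x) : ∀ᶠ y in 𝓝 x, MetricAt G y := by
  have h1 : ∀ᶠ y in 𝓝 x, ∀ a b, ContDiffAt ℝ 2 (fun y => G y a b) y :=
    eventually_all.2 fun a => eventually_all.2 fun b => (hG.smooth a b).eventually (by simp)
  have h2 : ∀ᶠ y in 𝓝 x, (G y).det ≠ 0 :=
    (contDiffAt_det hG.smooth).continuousAt.eventually_ne hG.det.ne_zero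
  filter_upwards [h1, h2, hG.symm.eventually_nhds] with y h1 h2 h3
  exact ⟨h1, h3, isUnit_iff_ne_zero.2 h2⟩

theorem differentiableAt (hG : MetricAt G x) (a b : Fin d) :
    DifferentiableAt ℝ (fun y => G y a b) x := (hG.smooth a b).differentiableAt (by norm_num)

theorem pd_symm (hG : MetricAt G x) (c a b : Fin d) :
    pd c (fun y => G y a b) x = pd c (fun y => G y b a) x :=
  pd_congr (hG.symm.mono fun _ h => h a b)

theorem pd_pd_symm (hG : MetricAt G x) (c e a b : Fin d) :
    pd c (pd e fun y => G y a b) x = pd c (pd e fun y => G y b a) x :=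
  pd_congr (hG.eventually.mono fun _ h => h.pd_symm e a b)

theorem chl_symm (hG : MetricAt G x) (e a b : Fin d) : chl G e a b x = chl G e b a x := by
  unfold chl; rw [hG.pd_symm e a b]; ring

/-- Metric compatibility in coordinates. It replaces every first derivative of the metric by
Christoffel symbols of the first kind. -/
theorem chl_add (hG : MetricAt G x) (c a p : Fin d) :
    pd c (fun y => G y a p) x = chl G a c p x + chl G p c a x := by
  unfold chl; rw [hG.pd_symm c p a, hG.pd_symm p c a, hG.pd_symm a c p]; ring

theorem contDiffAt_chl (hG : MetricAt G x) (e a b : Fin d) : ContDiffAt ℝ 1 (chl G e a b) x :=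
  contDiffAt_const.mul (((contDiffAt_one_pd (hG.smooth _ _)).add
    (contDiffAt_one_pd (hG.smooth _ _))).sub (contDiffAt_one_pd (hG.smooth _ _)))

theorem contDiffAt_inv (hG : MetricAt G x) (a b : Fin d) :
    ContDiffAt ℝ 2 (fun y => (G y)⁻¹ a b) x := contDiffAt_inv_apply hG.smooth hG.det a b

theorem christoffel_eq (c a b : Fin d) :
    christoffel G x c a b = ∑ e, (G x)⁻¹ c e * chl G e a b x := by
  unfold christoffel chl; rw [Finset.mul_sum]; exact Finset.sum_congr rfl fun e _ => by ring

theorem contDiffAt_christoffel (hG : MetricAt G x) (c a b : Fin d) :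
    ContDiffAt ℝ 1 (fun y => christoffel G y c a b) x := by
  simp only [christoffel_eq]
  exact ContDiffAt.sum fun e _ =>
    ((hG.contDiffAt_inv c e).of_le (by norm_num)).mul (hG.contDiffAt_chl e a b)

theorem christoffel_symm (hG : MetricAt G x) (c a b : Fin d) :
    christoffel G x c a b = christoffel G x c b a := by
  simp only [christoffel_eq, hG.chl_symm _ a b]

theorem sum_mul_christoffel (hG : MetricAt G x) (e a b : Fin d) :
    ∑ c, G x e c * christoffel G x c a b = chl G e a b x := by
  simp only [christoffel_eq, Finset.mul_sum]
  rw [Finset.sum_comm]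
  have : ∀ f, ∑ c, G x e c * ((G x)⁻¹ c f * chl G f a b x)
      = (G x * (G x)⁻¹) e f * chl G f a b x := fun f => by
    rw [Matrix.mul_apply, Finset.sum_mul]; exact Finset.sum_congr rfl fun c _ => by ring
  simp only [this, Matrix.mul_nonsing_inv _ hG.det, Matrix.one_apply]
  simp

/-- The curvature in terms of Christoffel symbols of the first kind. -/
theorem riemannDown_eq (hG : MetricAt G x) (a b c e : Fin d) :
    riemannDown G x a b c e = pd c (chl G a e b) x - pd e (chl G a c b) x
      - ∑ m, chl G m c a x * christoffel G x m e b
      + ∑ m, chl G m e a x * christoffel G x m c b := by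
  -- Near `x` the product G_{ap} Γ^p_{eb} is Γ_{a,eb}, so by the Leibniz rule moving G past the
  -- derivative costs only ∂_c G_{ap}, which `chl_add` rewrites.
  have key : ∀ c e, ∑ p, G x a p * pd c (fun y => christoffel G y p e b) x
      = pd c (chl G a e b) x - ∑ p, (chl G a c p x + chl G p c a x) * christoffel G x p e b := by
    intro c e
    have h1 : pd c (chl G a e b) x
        = pd c (fun y => ∑ p, G y a p * christoffel G y p e b) x :=
      pd_congr (hG.eventually.mono fun y hy => (hy.sum_mul_christoffel a e b).symm)
    have hd : ∀ p, DifferentiableAt ℝ (fun y => christoffel G y p e b) x := fun p =>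
      (hG.contDiffAt_christoffel p e b).differentiableAt (by norm_num)
    rw [h1, pd_sum fun p _ => (hG.differentiableAt a p).fun_mul (hd p), ← Finset.sum_sub_distrib]
    refine Finset.sum_congr rfl fun p _ => ?_
    rw [pd_mul (hG.differentiableAt a p) (hd p), hG.chl_add]; ring
  have quad : ∀ c e, ∑ p, G x a p * ∑ m, christoffel G x p c m * christoffel G x m e b
      = ∑ m, chl G a c m x * christoffel G x m e b := by
    intro c e
    simp only [Finset.mul_sum]
    rw [Finset.sum_comm]
    refine Finset.sum_congr rfl fun m _ => ?_
    rw [← hG.sum_mul_christoffel, Finset.sum_mul]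
    exact Finset.sum_congr rfl fun p _ => by ring
  unfold riemannDown riemannUp
  simp only [mul_add, mul_sub, Finset.sum_add_distrib, Finset.sum_sub_distrib, key, quad, add_mul]
  ring

theorem pd_chl (hG : MetricAt G x) (c a e b : Fin d) :
    pd c (chl G a e b) x = 2⁻¹ * (pd c (pd e fun y => G y b a) x
      + pd c (pd b fun y => G y e a) x - pd c (pd a fun y => G y e b) x) := by
  have h := fun e a b => differentiableAt_pd (a := e) (hG.smooth a b)
  unfold chl
  rw [pd_const_mul _ (((h _ _ _).fun_add (h _ _ _)).fun_sub (h _ _ _)),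
    pd_sub ((h _ _ _).fun_add (h _ _ _)) (h _ _ _), pd_add (h _ _ _) (h _ _ _)]

theorem quad_comm (hG : MetricAt G x) (a b c e : Fin d) :
    ∑ m, chl G m a b x * christoffel G x m c e = ∑ m, chl G m c e x * christoffel G x m a b := by
  simp only [christoffel_eq, Finset.mul_sum]
  rw [Finset.sum_comm]
  refine Finset.sum_congr rfl fun m _ => Finset.sum_congr rfl fun k _ => ?_
  have : ((G x)⁻¹).IsSymm := by
    have : (G x).IsSymm := Matrix.IsSymm.ext fun i j => hG.symm.self_of_nhds j i
    unfold Matrix.IsSymm; rw [Matrix.transpose_nonsing_inv, this.eq]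
  rw [this.apply m k]; ring

theorem riemannDown_antisymm_right (hG : MetricAt G x) (a b c e : Fin d) :
    riemannDown G x a b c e = -riemannDown G x a b e c := by
  rw [hG.riemannDown_eq, hG.riemannDown_eq]; ring

/-- Once the index is lowered, the second-order part is a combination of ∂∂G whose pair symmetry
follows from the symmetry of G and of second partial derivatives; the quadratic part is matched by
`quad_comm`. -/
theorem riemannDown_pair (hG : MetricAt G x) (a b c e : Fin d) :
    riemannDown G x a b c e = riemannDown G x c e a b := by
  rw [hG.riemannDown_eq, hG.riemannDown_eq]
  simp only [hG.pd_chl]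
  have q1 := hG.quad_comm c a e b
  have q2 := hG.quad_comm e a c b
  simp only [fun m => hG.chl_symm m a c, fun m => hG.chl_symm m b c,
    fun m => hG.christoffel_symm m b e,
    fun m => hG.christoffel_symm m a e] at *
  rw [pd_pd_comm (a := c) (b := e) (hG.smooth b a), pd_pd_comm (a := a) (b := b) (hG.smooth e c),
    hG.pd_pd_symm b a e c, pd_pd_comm (a := a) (b := e) (hG.smooth b c),
    pd_pd_comm (a := a) (b := c) (hG.smooth b e), pd_pd_comm (a := b) (b := e) (hG.smooth a c),
    pd_pd_comm (a := b) (b := c) (hG.smooth a e), hG.pd_pd_symm e b a c, hG.pd_pd_symm c b a e,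
    hG.pd_pd_symm c a b e, hG.pd_pd_symm e a b c]
  linarith

theorem riemannDown_antisymm_left (hG : MetricAt G x) (a b c e : Fin d) :
    riemannDown G x a b c e = -riemannDown G x b a c e := by
  rw [hG.riemannDown_pair, hG.riemannDown_antisymm_right, hG.riemannDown_pair]

end MetricAt

end Metric

end

noncomputable section

/-! ### Calculus of the Levi-Civita connection in a coordinate patch -/

namespace LocalMetric

open Filter Topology

section Dir

variable {X : Coord → Fin 4 → ℝ} {f h : Coord → ℝ} {x : Coord}

theorem dir_eq_fderiv : dir X f x = fderiv ℝ f x (X x) := (fderiv_eq_sum_pd _).symm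

theorem dir_add (hf : DifferentiableAt ℝ f x) (hh : DifferentiableAt ℝ h x) :
    dir X (fun y => f y + h y) x = dir X f x + dir X h x := by
  simp only [dir_eq_fderiv, fderiv_fun_add hf hh]; rfl

theorem dir_sub (hf : DifferentiableAt ℝ f x) (hh : DifferentiableAt ℝ h x) :
    dir X (fun y => f y - h y) x = dir X f x - dir X h x := by
  simp only [dir_eq_fderiv, fderiv_fun_sub hf hh]; rfl

theorem dir_neg : dir X (fun y => -f y) x = -dir X f x := by
  simp only [dir_eq_fderiv, fderiv_fun_neg]; rfl

theorem dir_mul (hf : DifferentiableAt ℝ f x) (hh : DifferentiableAt ℝ h x) :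
    dir X (fun y => f y * h y) x = dir X f x * h x + f x * dir X h x := by
  simp only [dir_eq_fderiv, fderiv_fun_mul hf hh]; simp; ring

theorem dir_const_mul (c : ℝ) (hf : DifferentiableAt ℝ f x) :
    dir X (fun y => c * f y) x = c * dir X f x := by
  simp only [dir_eq_fderiv, fderiv_const_mul hf]; simp

theorem dir_const (c : ℝ) : dir X (fun _ => c) x = 0 := by
  simp [dir_eq_fderiv]

theorem dir_sum {ι : Type*} {s : Finset ι} {f : ι → Coord → ℝ}
    (hf : ∀ i ∈ s, DifferentiableAt ℝ (f i) x) :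
    dir X (fun y => ∑ i ∈ s, f i y) x = ∑ i ∈ s, dir X (f i) x := by
  simp only [dir_eq_fderiv, fderiv_fun_sum hf]; simp

theorem dir_congr (hfh : f =ᶠ[𝓝 x] h) : dir X f x = dir X h x := by
  simp only [dir_eq_fderiv, hfh.fderiv_eq]

theorem dir_add_field (X' : Coord → Fin 4 → ℝ) :
    dir (X + X') f x = dir X f x + dir X' f x := by
  simp [dir_eq_fderiv]

theorem dir_sum_field {ι : Type*} {s : Finset ι} (c : ι → ℝ) (Y : ι → Coord → Fin 4 → ℝ)
    (hX : X x = ∑ i ∈ s, c i • Y i x) : dir X f x = ∑ i ∈ s, c i * dir (Y i) f x := by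
  simp [dir_eq_fderiv, hX]

end Dir

variable (F : LocalMetric)

section Bilinear

variable (x : Coord)

theorem inn_add_left (V V' W : Fin 4 → ℝ) : F.inn x (V + V') W = F.inn x V W + F.inn x V' W := by
  simp [inn, mul_add, add_mul, Finset.sum_add_distrib]

theorem inn_sub_left (V V' W : Fin 4 → ℝ) : F.inn x (V - V') W = F.inn x V W - F.inn x V' W := by
  simp [inn, mul_sub, sub_mul, Finset.sum_sub_distrib]

theorem inn_smul_left (c : ℝ) (V W : Fin 4 → ℝ) : F.inn x (c • V) W = c * F.inn x V W := by
  simp only [inn, Finset.mul_sum, Pi.smul_apply, smul_eq_mul]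
  exact Finset.sum_congr rfl fun a _ => Finset.sum_congr rfl fun b _ => by ring

theorem inn_sum_left {ι : Type*} (s : Finset ι) (c : ι → ℝ) (V : ι → Fin 4 → ℝ) (W : Fin 4 → ℝ) :
    F.inn x (∑ i ∈ s, c i • V i) W = ∑ i ∈ s, c i * F.inn x (V i) W := by
  classical
  induction s using Finset.induction_on with
  | empty => simp [inn]
  | insert i s hi ih => rw [Finset.sum_insert hi, Finset.sum_insert hi, inn_add_left, ih,
      inn_smul_left]

variable {F x}

theorem inn_comm (hG : MetricAt F.G x) (V W : Fin 4 → ℝ) : F.inn x V W = F.inn x W V := by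
  unfold inn
  rw [Finset.sum_comm]
  exact Finset.sum_congr rfl fun a _ => Finset.sum_congr rfl fun b _ => by
    rw [hG.symm.self_of_nhds b a]; ring

end Bilinear

section Connection

variable {F} {x : Coord} {X Y Z V W : Coord → Fin 4 → ℝ}

theorem D_sum_left {ι : Type*} {s : Finset ι} (c : ι → ℝ) (Y : ι → Coord → Fin 4 → ℝ)
    (hX : X x = ∑ i ∈ s, c i • Y i x) : F.D X V x = ∑ i ∈ s, c i • F.D (Y i) V x := by
  funext e
  simp only [D, dir_sum_field c Y hX, Finset.sum_apply, Pi.smul_apply, smul_eq_mul, mul_add,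
    Finset.sum_add_distrib]
  congr 1
  simp only [hX, Finset.sum_apply, Pi.smul_apply, smul_eq_mul, Finset.mul_sum, Finset.sum_mul]
  calc _ = ∑ a, ∑ i ∈ s, ∑ b, christoffel F.G x e a b * (c i * Y i x a) * V x b :=
        Finset.sum_congr rfl fun a _ => Finset.sum_comm
    _ = ∑ i ∈ s, ∑ a, ∑ b, christoffel F.G x e a b * (c i * Y i x a) * V x b := Finset.sum_comm
    _ = _ := Finset.sum_congr rfl fun i _ => Finset.sum_congr rfl fun a _ =>
        Finset.sum_congr rfl fun b _ => by ring

theorem D_add_left (X X' V : Coord → Fin 4 → ℝ) : F.D (X + X') V x = F.D X V x + F.D X' V x := by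
  funext e
  simp only [D, dir_add_field, Pi.add_apply, mul_add, add_mul, Finset.sum_add_distrib]
  ring

theorem D_add_right (hV : ∀ a, DifferentiableAt ℝ (fun y => V y a) x)
    (hW : ∀ a, DifferentiableAt ℝ (fun y => W y a) x) :
    F.D X (fun y => V y + W y) x = F.D X V x + F.D X W x := by
  funext e
  simp only [D, Pi.add_apply, dir_add (hV _) (hW _), mul_add, Finset.sum_add_distrib]
  ring

theorem inn_D (hG : MetricAt F.G x) (X V : Coord → Fin 4 → ℝ) (w : Fin 4 → ℝ) :
    F.inn x (F.D X V x) w = ∑ f, w f * (∑ a, F.G x a f * dir X (fun y => V y a) x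
      + ∑ a, ∑ b, chl F.G f a b x * X x a * V x b) := by
  unfold inn D
  rw [Finset.sum_comm]
  refine Finset.sum_congr rfl fun f _ => ?_
  rw [mul_add, Finset.mul_sum, Finset.mul_sum]
  simp only [mul_add, add_mul, Finset.sum_add_distrib]
  congr 1
  · exact Finset.sum_congr rfl fun a _ => by ring
  · simp only [← hG.sum_mul_christoffel, Finset.mul_sum, Finset.sum_mul]
    rw [Finset.sum_comm]
    refine Finset.sum_congr rfl fun a _ => ?_
    rw [Finset.sum_comm]
    refine Finset.sum_congr rfl fun b _ => Finset.sum_congr rfl fun c _ => ?_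
    rw [hG.symm.self_of_nhds f c]; ring

/-- The Levi-Civita connection is metric. -/
theorem dir_inn (hG : MetricAt F.G x) (hV : ∀ a, DifferentiableAt ℝ (fun y => V y a) x)
    (hW : ∀ a, DifferentiableAt ℝ (fun y => W y a) x) :
    dir X (fun y => F.inn y (V y) (W y)) x
      = F.inn x (F.D X V x) (W x) + F.inn x (V x) (F.D X W x) := by
  have hd := hG.differentiableAt
  have hGs : ∀ a b, dir X (fun y => F.G y a b) x
      = ∑ c, X x c * chl F.G a c b x + ∑ c, X x c * chl F.G b c a x := fun a b => by
    simp only [dir, hG.chl_add, mul_add, Finset.sum_add_distrib]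
  rw [inn_comm hG (V x), inn_D hG, inn_D hG]
  unfold inn
  rw [dir_sum fun a _ => .fun_sum fun b _ => ((hd a b).fun_mul (hV a)).fun_mul (hW b)]
  have e1 : ∀ a, dir X (fun y => ∑ b, F.G y a b * V y a * W y b) x
      = ∑ b, ((∑ c, X x c * chl F.G a c b x * V x a * W x b)
        + (∑ c, X x c * chl F.G b c a x * V x a * W x b)
        + F.G x a b * dir X (fun y => V y a) x * W x b
        + F.G x a b * V x a * dir X (fun y => W y b) x) := fun a => by
    rw [dir_sum fun b _ => ((hd a b).fun_mul (hV a)).fun_mul (hW b)]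
    refine Finset.sum_congr rfl fun b _ => ?_
    rw [dir_mul ((hd a b).fun_mul (hV a)) (hW b), dir_mul (hd a b) (hV a), hGs]
    simp only [add_mul, Finset.sum_mul]
  simp only [e1, Finset.sum_add_distrib, mul_add, Finset.mul_sum]
  have s1 : ∑ a, ∑ b, ∑ c, X x c * chl F.G a c b x * V x a * W x b
      = ∑ a, ∑ c, ∑ b, V x a * (chl F.G a c b x * X x c * W x b) :=
    Finset.sum_congr rfl fun a _ => by
      rw [Finset.sum_comm]
      exact Finset.sum_congr rfl fun c _ => Finset.sum_congr rfl fun b _ => by ring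
  have s2 : ∑ a, ∑ b, ∑ c, X x c * chl F.G b c a x * V x a * W x b
      = ∑ b, ∑ c, ∑ a, W x b * (chl F.G b c a x * X x c * V x a) := by
    rw [Finset.sum_comm]
    refine Finset.sum_congr rfl fun b _ => ?_
    rw [Finset.sum_comm]
    exact Finset.sum_congr rfl fun c _ => Finset.sum_congr rfl fun a _ => by ring
  have s3 : ∑ a, ∑ b, F.G x a b * dir X (fun y => V y a) x * W x b
      = ∑ b, ∑ a, W x b * (F.G x a b * dir X (fun y => V y a) x) := by
    rw [Finset.sum_comm]
    exact Finset.sum_congr rfl fun b _ => Finset.sum_congr rfl fun a _ => by ring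
  have s4 : ∑ a, ∑ b, F.G x a b * V x a * dir X (fun y => W y b) x
      = ∑ a, ∑ b, V x a * (F.G x b a * dir X (fun y => W y b) x) :=
    Finset.sum_congr rfl fun a _ => Finset.sum_congr rfl fun b _ => by
      rw [hG.symm.self_of_nhds a b]; ring
  rw [s1, s2, s3, s4]; ring

/-- The components `⟨𝐃_b Z, ∂_f⟩`. -/
def covDown (F : LocalMetric) (Z : Coord → Fin 4 → ℝ) (b f : Fin 4) (y : Coord) : ℝ :=
  pd b (fun z => ∑ a, F.G z f a * Z z a) y - ∑ e, chl F.G e b f y * Z y e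

/-- Isolates ∇Z as a `2`-tensor with components independent of Y and w. If Z is C² these components
are C¹ and can be differentiated again, however rough the arguments are. -/
theorem inn_D_eq_covDown (hG : MetricAt F.G x) (hZ : ∀ a, DifferentiableAt ℝ (fun y => Z y a) x)
    (Y : Coord → Fin 4 → ℝ) (w : Fin 4 → ℝ) :
    F.inn x (F.D Y Z x) w = ∑ b, ∑ f, covDown F Z b f x * Y x b * w f := by
  rw [inn_D hG, Finset.sum_comm]
  refine Finset.sum_congr rfl fun f _ => ?_
  have h1 : ∀ b, covDown F Z b f x = ∑ a, F.G x f a * pd b (fun y => Z y a) x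
      + ∑ e, chl F.G f b e x * Z x e := fun b => by
    unfold covDown
    rw [pd_sum fun a _ => (hG.differentiableAt f a).fun_mul (hZ a), ← Finset.sum_add_distrib,
      ← Finset.sum_sub_distrib]
    refine Finset.sum_congr rfl fun a _ => ?_
    rw [pd_mul (hG.differentiableAt f a) (hZ a), hG.chl_add]; ring
  simp only [h1, dir, mul_add, add_mul, Finset.sum_add_distrib, Finset.mul_sum, Finset.sum_mul]
  congr 1
  · rw [Finset.sum_comm]
    refine Finset.sum_congr rfl fun b _ => Finset.sum_congr rfl fun a _ => ?_
    rw [hG.symm.self_of_nhds f a]; ring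
  · exact Finset.sum_congr rfl fun b _ => Finset.sum_congr rfl fun a _ => by ring

theorem contDiffAt_covDown (hG : MetricAt F.G x) (hZ : ∀ a, ContDiffAt ℝ 2 (fun y => Z y a) x)
    (b f : Fin 4) : ContDiffAt ℝ 1 (covDown F Z b f) x := by
  unfold covDown
  refine (contDiffAt_one_pd (ContDiffAt.sum fun a _ => (hG.smooth f a).mul (hZ a))).sub
    (ContDiffAt.sum fun e _ => (hG.contDiffAt_chl e b f).mul ((hZ e).of_le (by norm_num)))

/-- Derivative of a contraction of a `2`-tensor with two vector fields. -/
theorem dir_contract₂ {K : Fin 4 → Fin 4 → Coord → ℝ} (hK : ∀ b f, DifferentiableAt ℝ (K b f) x)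
    (hY : ∀ a, DifferentiableAt ℝ (fun y => Y y a) x)
    (hW : ∀ a, DifferentiableAt ℝ (fun y => W y a) x) :
    dir X (fun y => ∑ b, ∑ f, K b f y * Y y b * W y f) x
      - ∑ b, ∑ f, K b f x * F.D X Y x b * W x f - ∑ b, ∑ f, K b f x * Y x b * F.D X W x f
    = ∑ a, ∑ b, ∑ f, (pd a (K b f) x - ∑ m, christoffel F.G x m a b * K m f x
        - ∑ m, christoffel F.G x m a f * K b m x) * X x a * Y x b * W x f := by
  have e0 : ∀ b, dir X (fun y => ∑ f, K b f y * Y y b * W y f) x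
      = ∑ f, (dir X (K b f) x * Y x b * W x f + K b f x * dir X (fun y => Y y b) x * W x f
        + K b f x * Y x b * dir X (fun y => W y f) x) := fun b => by
    rw [dir_sum fun f _ => ((hK b f).fun_mul (hY b)).fun_mul (hW f)]
    refine Finset.sum_congr rfl fun f _ => ?_
    rw [dir_mul ((hK b f).fun_mul (hY b)) (hW f), dir_mul (hK b f) (hY b)]; ring
  rw [dir_sum fun b _ => .fun_sum fun f _ => ((hK b f).fun_mul (hY b)).fun_mul (hW f)]
  simp only [e0]
  have s1 : ∑ b, ∑ f, dir X (K b f) x * Y x b * W x f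
      = ∑ a, ∑ b, ∑ f, pd a (K b f) x * X x a * Y x b * W x f := by
    simp only [dir, Finset.sum_mul]
    refine (Finset.sum_congr rfl fun b _ => Finset.sum_comm).trans ?_
    rw [Finset.sum_comm]
    exact Finset.sum_congr rfl fun a _ => Finset.sum_congr rfl fun b _ =>
      Finset.sum_congr rfl fun f _ => by ring
  have s2 : ∑ b, ∑ f, K b f x * (∑ a, ∑ c, christoffel F.G x b a c * X x a * Y x c) * W x f
      = ∑ a, ∑ b, ∑ f, (∑ m, christoffel F.G x m a b * K m f x) * X x a * Y x b * W x f := by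
    simp only [Finset.mul_sum, Finset.sum_mul]
    calc _ = ∑ f, ∑ m, ∑ a, ∑ b, K m f x * (christoffel F.G x m a b * X x a * Y x b) * W x f :=
          Finset.sum_comm
      _ = ∑ f, ∑ a, ∑ b, ∑ m, K m f x * (christoffel F.G x m a b * X x a * Y x b) * W x f :=
          Finset.sum_congr rfl fun f _ => by
            rw [Finset.sum_comm]
            exact Finset.sum_congr rfl fun a _ => Finset.sum_comm
      _ = ∑ a, ∑ b, ∑ f, ∑ m, K m f x * (christoffel F.G x m a b * X x a * Y x b) * W x f := by
          rw [Finset.sum_comm]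
          exact Finset.sum_congr rfl fun a _ => Finset.sum_comm
      _ = _ := Finset.sum_congr rfl fun a _ => Finset.sum_congr rfl fun b _ =>
          Finset.sum_congr rfl fun f _ => Finset.sum_congr rfl fun m _ => by ring
  have s3 : ∑ b, ∑ f, K b f x * Y x b * (∑ a, ∑ c, christoffel F.G x f a c * X x a * W x c)
      = ∑ a, ∑ b, ∑ f, (∑ m, christoffel F.G x m a f * K b m x) * X x a * Y x b * W x f := by
    simp only [Finset.mul_sum, Finset.sum_mul]
    calc _ = ∑ b, ∑ a, ∑ f, ∑ m, K b m x * Y x b * (christoffel F.G x m a f * X x a * W x f) :=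
          Finset.sum_congr rfl fun f _ => by
            rw [Finset.sum_comm]
            exact Finset.sum_congr rfl fun a _ => Finset.sum_comm
      _ = ∑ a, ∑ b, ∑ f, ∑ m, K b m x * Y x b * (christoffel F.G x m a f * X x a * W x f) :=
          Finset.sum_comm
      _ = _ := Finset.sum_congr rfl fun a _ => Finset.sum_congr rfl fun b _ =>
          Finset.sum_congr rfl fun f _ => Finset.sum_congr rfl fun m _ => by ring
  simp only [D, mul_add, add_mul, sub_mul, Finset.sum_add_distrib, Finset.sum_sub_distrib]
  rw [s1, s2, s3]; ring

/-- The term with Γ^m_{ab} is symmetric in a, b and is left out on both sides. The second partials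
of the lowered Z commute, the terms with ∂Z are symmetric in a, b and cancel, and what multiplies Z
is the curvature. -/
theorem covDown_ricci (hG : MetricAt F.G x) (hZ : ∀ a, ContDiffAt ℝ 2 (fun y => Z y a) x)
    (a b f : Fin 4) :
    (pd a (covDown F Z b f) x - ∑ m, christoffel F.G x m a f * covDown F Z b m x)
      - (pd b (covDown F Z a f) x - ∑ m, christoffel F.G x m b f * covDown F Z a m x)
      = ∑ d, riemannDown F.G x f d a b * Z x d := by
  have hZd : ∀ a, DifferentiableAt ℝ (fun y => Z y a) x := fun a =>
    (hZ a).differentiableAt (by norm_num)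
  have hlow : ContDiffAt ℝ 2 (fun z => ∑ a, F.G z f a * Z z a) x :=
    ContDiffAt.sum fun a _ => (hG.smooth f a).mul (hZ a)
  have hchl : ∀ e a b, DifferentiableAt ℝ (chl F.G e a b) x := fun e a b =>
    (hG.contDiffAt_chl e a b).differentiableAt (by norm_num)
  have h1 : ∀ a b, pd a (covDown F Z b f) x = pd a (pd b fun z => ∑ a, F.G z f a * Z z a) x
      - ∑ e, (pd a (chl F.G e b f) x * Z x e + chl F.G e b f x * pd a (fun y => Z y e) x) := by
    intro a b
    unfold covDown
    rw [pd_sub (differentiableAt_pd hlow) (.fun_sum fun e _ => (hchl e b f).fun_mul (hZd e)),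
      pd_sum fun e _ => (hchl e b f).fun_mul (hZd e)]
    congr 1
    exact Finset.sum_congr rfl fun e _ => pd_mul (hchl e b f) (hZd e)
  have h2 : ∀ a b, ∑ m, christoffel F.G x m a f * covDown F Z b m x
      = ∑ e, chl F.G e a f x * pd b (fun y => Z y e) x
        + ∑ e, (∑ m, chl F.G m b e x * christoffel F.G x m a f) * Z x e := by
    intro a b
    have : ∀ m, covDown F Z b m x = ∑ e, (F.G x m e * pd b (fun y => Z y e) x
        + chl F.G m b e x * Z x e) := fun m => by
      unfold covDown
      rw [pd_sum fun a _ => (hG.differentiableAt m a).fun_mul (hZd a), ← Finset.sum_sub_distrib]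
      refine Finset.sum_congr rfl fun a _ => ?_
      rw [pd_mul (hG.differentiableAt m a) (hZd a), hG.chl_add]; ring
    simp only [this, Finset.mul_sum, mul_add, Finset.sum_add_distrib]
    congr 1
    · rw [Finset.sum_comm]
      refine Finset.sum_congr rfl fun e _ => ?_
      rw [← hG.sum_mul_christoffel, Finset.sum_mul]
      exact Finset.sum_congr rfl fun m _ => by rw [hG.symm.self_of_nhds m e]; ring
    · rw [Finset.sum_comm]
      refine Finset.sum_congr rfl fun e _ => ?_
      rw [Finset.sum_mul]
      exact Finset.sum_congr rfl fun m _ => by ring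
  rw [h1, h1, h2, h2, pd_pd_comm (a := a) (b := b) hlow]
  have h3 : ∀ d, riemannDown F.G x f d a b * Z x d
      = -(pd a (chl F.G d b f) x * Z x d) + pd b (chl F.G d a f) x * Z x d
        + (∑ m, chl F.G m a d x * christoffel F.G x m b f) * Z x d
        - (∑ m, chl F.G m b d x * christoffel F.G x m a f) * Z x d := fun d => by
    rw [hG.riemannDown_antisymm_left, hG.riemannDown_eq]; ring
  simp only [h3, Finset.sum_add_distrib, Finset.sum_sub_distrib, Finset.sum_neg_distrib]
  ring

/-- The Ricci identity for a vector field of class `C²`. -/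
theorem ricci_identity (hG : MetricAt F.G x) (hZ : ∀ a, ContDiffAt ℝ 2 (fun y => Z y a) x)
    (hX : ∀ a, DifferentiableAt ℝ (fun y => X y a) x)
    (hY : ∀ a, DifferentiableAt ℝ (fun y => Y y a) x)
    (hW : ∀ a, DifferentiableAt ℝ (fun y => W y a) x) :
    F.Rm x (W x) (Z x) (X x) (Y x)
      = (dir X (fun y => F.inn y (F.D Y Z y) (W y)) x
          - F.inn x (F.D (F.D X Y) Z x) (W x) - F.inn x (F.D Y Z x) (F.D X W x))
        - (dir Y (fun y => F.inn y (F.D X Z y) (W y)) x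
          - F.inn x (F.D (F.D Y X) Z x) (W x) - F.inn x (F.D X Z x) (F.D Y W x)) := by
  have hev : ∀ᶠ y in 𝓝 x, ∀ a, DifferentiableAt ℝ (fun y => Z y a) y :=
    eventually_all.2 fun a => ((hZ a).eventually (by simp)).mono fun y hy =>
      hy.differentiableAt (by norm_num)
  have hc : ∀ Y : Coord → Fin 4 → ℝ, (fun y => F.inn y (F.D Y Z y) (W y)) =ᶠ[𝓝 x]
      fun y => ∑ b, ∑ f, covDown F Z b f y * Y y b * W y f := fun Y => by
    filter_upwards [hev, hG.eventually] with y h1 h2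
    exact inn_D_eq_covDown h2 h1 Y (W y)
  have hZx := hev.self_of_nhds
  have hK : ∀ b f, DifferentiableAt ℝ (covDown F Z b f) x := fun b f =>
    (contDiffAt_covDown hG hZ b f).differentiableAt (by norm_num)
  rw [dir_congr (hc Y), dir_congr (hc X)]
  simp only [inn_D_eq_covDown hG hZx]
  rw [dir_contract₂ hK hY hW, dir_contract₂ hK hX hW]
  -- Renaming a and b and using that the connection is torsion-free gives both second covariant
  -- derivatives the same Γ^m_{ab} term, which then cancels.
  have hswap : ∑ a, ∑ b, ∑ f, (pd a (covDown F Z b f) x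
        - ∑ m, christoffel F.G x m a b * covDown F Z m f x
        - ∑ m, christoffel F.G x m a f * covDown F Z b m x) * Y x a * X x b * W x f
      = ∑ a, ∑ b, ∑ f, (pd b (covDown F Z a f) x
        - ∑ m, christoffel F.G x m a b * covDown F Z m f x
        - ∑ m, christoffel F.G x m b f * covDown F Z a m x) * X x a * Y x b * W x f := by
    rw [Finset.sum_comm]
    refine Finset.sum_congr rfl fun a _ => Finset.sum_congr rfl fun b _ =>
      Finset.sum_congr rfl fun f _ => ?_
    simp only [hG.christoffel_symm _ b a]; ring
  rw [hswap, ← Finset.sum_sub_distrib]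
  simp only [← Finset.sum_sub_distrib]
  have hR : ∀ a b f, (pd a (covDown F Z b f) x
        - ∑ m, christoffel F.G x m a b * covDown F Z m f x
        - ∑ m, christoffel F.G x m a f * covDown F Z b m x) * X x a * Y x b * W x f
      - (pd b (covDown F Z a f) x
        - ∑ m, christoffel F.G x m a b * covDown F Z m f x
        - ∑ m, christoffel F.G x m b f * covDown F Z a m x) * X x a * Y x b * W x f
      = ∑ d, riemannDown F.G x f d a b * W x f * Z x d * X x a * Y x b := fun a b f => by
    have := covDown_ricci hG hZ a b f
    calc _ = ((pd a (covDown F Z b f) x - ∑ m, christoffel F.G x m a f * covDown F Z b m x)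
        - (pd b (covDown F Z a f) x - ∑ m, christoffel F.G x m b f * covDown F Z a m x))
          * X x a * Y x b * W x f := by ring
      _ = _ := by
        rw [this, Finset.sum_mul, Finset.sum_mul, Finset.sum_mul]
        exact Finset.sum_congr rfl fun d _ => by ring
  simp only [hR]
  unfold Rm
  calc _ = ∑ f, ∑ a, ∑ d, ∑ b, riemannDown F.G x f d a b * W x f * Z x d * X x a * Y x b :=
        Finset.sum_congr rfl fun f _ => Finset.sum_comm
    _ = ∑ a, ∑ f, ∑ b, ∑ d, riemannDown F.G x f d a b * W x f * Z x d * X x a * Y x b := by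
        rw [Finset.sum_comm]
        exact Finset.sum_congr rfl fun a _ => Finset.sum_congr rfl fun f _ => Finset.sum_comm
    _ = _ := Finset.sum_congr rfl fun a _ => Finset.sum_comm

end Connection

section Curvature

variable {F} {x : Coord}

theorem Rm_add₁ (A A' B C E : Fin 4 → ℝ) :
    F.Rm x (A + A') B C E = F.Rm x A B C E + F.Rm x A' B C E := by
  simp only [Rm, Pi.add_apply, mul_add, add_mul, Finset.sum_add_distrib]

theorem Rm_sub₁ (A A' B C E : Fin 4 → ℝ) :
    F.Rm x (A - A') B C E = F.Rm x A B C E - F.Rm x A' B C E := by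
  simp only [Rm, Pi.sub_apply, mul_sub, sub_mul, Finset.sum_sub_distrib]

theorem Rm_antisymm_left (hG : MetricAt F.G x) (A B C E : Fin 4 → ℝ) :
    F.Rm x A B C E = -F.Rm x B A C E := by
  unfold Rm
  rw [Finset.sum_comm]
  simp only [← Finset.sum_neg_distrib]
  exact Finset.sum_congr rfl fun a _ => Finset.sum_congr rfl fun b _ =>
    Finset.sum_congr rfl fun c _ => Finset.sum_congr rfl fun e _ => by
      rw [hG.riemannDown_antisymm_left]; ring

theorem Rm_antisymm_right (hG : MetricAt F.G x) (A B C E : Fin 4 → ℝ) :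
    F.Rm x A B C E = -F.Rm x A B E C := by
  unfold Rm
  simp only [← Finset.sum_neg_distrib]
  refine Finset.sum_congr rfl fun a _ => Finset.sum_congr rfl fun b _ => ?_
  rw [Finset.sum_comm]
  exact Finset.sum_congr rfl fun c _ => Finset.sum_congr rfl fun e _ => by
      rw [hG.riemannDown_antisymm_right]; ring

theorem Rm_pair (hG : MetricAt F.G x) (A B C E : Fin 4 → ℝ) :
    F.Rm x A B C E = F.Rm x C E A B := by
  unfold Rm
  calc _ = ∑ a, ∑ c, ∑ e, ∑ b, riemannDown F.G x a b c e * A a * B b * C c * E e :=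
        Finset.sum_congr rfl fun a _ => by
          rw [Finset.sum_comm]
          exact Finset.sum_congr rfl fun c _ => Finset.sum_comm
    _ = ∑ c, ∑ e, ∑ a, ∑ b, riemannDown F.G x a b c e * A a * B b * C c * E e := by
        rw [Finset.sum_comm]
        exact Finset.sum_congr rfl fun c _ => Finset.sum_comm
    _ = _ := Finset.sum_congr rfl fun a _ => Finset.sum_congr rfl fun b _ =>
          Finset.sum_congr rfl fun c _ => Finset.sum_congr rfl fun e _ => by
            rw [hG.riemannDown_pair]; ring

theorem Rm_add₂ (hG : MetricAt F.G x) (A B B' C E : Fin 4 → ℝ) :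
    F.Rm x A (B + B') C E = F.Rm x A B C E + F.Rm x A B' C E := by
  rw [Rm_antisymm_left hG, Rm_add₁, Rm_antisymm_left hG A B, Rm_antisymm_left hG A B']; ring

theorem Rm_sub₂ (hG : MetricAt F.G x) (A B B' C E : Fin 4 → ℝ) :
    F.Rm x A (B - B') C E = F.Rm x A B C E - F.Rm x A B' C E := by
  rw [Rm_antisymm_left hG, Rm_sub₁, Rm_antisymm_left hG A B, Rm_antisymm_left hG A B']; ring

theorem Rm_add₃ (hG : MetricAt F.G x) (A B C C' E : Fin 4 → ℝ) :
    F.Rm x A B (C + C') E = F.Rm x A B C E + F.Rm x A B C' E := by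
  rw [Rm_pair hG, Rm_add₁, Rm_pair hG A B C, Rm_pair hG A B C']

theorem Rm_sub₃ (hG : MetricAt F.G x) (A B C C' E : Fin 4 → ℝ) :
    F.Rm x A B (C - C') E = F.Rm x A B C E - F.Rm x A B C' E := by
  rw [Rm_pair hG, Rm_sub₁, Rm_pair hG A B C, Rm_pair hG A B C']

theorem Rm_add₄ (hG : MetricAt F.G x) (A B C E E' : Fin 4 → ℝ) :
    F.Rm x A B C (E + E') = F.Rm x A B C E + F.Rm x A B C E' := by
  rw [Rm_pair hG, Rm_add₂ hG, Rm_pair hG A B C E, Rm_pair hG A B C E']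

end Curvature

end LocalMetric

end

noncomputable section

namespace LocalMetric

open Filter Topology

variable {F : LocalMetric} {x : Coord}

/-! ### The components of the space-time metric -/

theorem G_succ_succ (i j : Fin 3) : F.G x i.succ j.succ = F.g x i j := by
  simp [G, coframe]

theorem G_zero_succ (j : Fin 3) : F.G x 0 j.succ = ∑ i, F.g x i j * F.Y x i := by
  simp [G, coframe]

theorem G_succ_zero (i : Fin 3) : F.G x i.succ 0 = ∑ j, F.g x i j * F.Y x j := by
  simp [G, coframe]

theorem G_zero_zero : F.G x 0 0 = -F.n x ^ 2 + ∑ i, ∑ j, F.g x i j * F.Y x i * F.Y x j := by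
  simp [G, coframe]

theorem G_symm (hg : ∀ i j, F.g x i j = F.g x j i) (a b : Fin 4) : F.G x a b = F.G x b a := by
  simp only [G, Matrix.of_apply]
  rw [Finset.sum_comm]
  congr 1
  · ring
  · exact Finset.sum_congr rfl fun i _ => Finset.sum_congr rfl fun j _ => by rw [hg j i]; ring

theorem T_zero : F.T x 0 = (F.n x)⁻¹ := rfl

theorem T_succ (i : Fin 3) : F.T x i.succ = -(F.n x)⁻¹ * F.Y x i := rfl

/-- The forms dx^i + Y^i dt annihilate T and dt(T) = n⁻¹, so T is metrically dual to −n dt. -/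
theorem sum_G_mul_T (hg : ∀ i j, F.g x i j = F.g x j i) (hn : F.n x ≠ 0) (a : Fin 4) :
    ∑ b, F.G x a b * F.T x b = -F.n x * (if a = 0 then 1 else 0) := by
  rw [Fin.sum_univ_succ]
  simp only [T_zero, T_succ]
  refine Fin.cases ?_ (fun i => ?_) a
  · simp only [G_zero_zero, G_zero_succ]
    have : ∑ i, (∑ j, F.g x j i * F.Y x j) * (-(F.n x)⁻¹ * F.Y x i)
        = -(F.n x)⁻¹ * ∑ i, ∑ j, F.g x i j * F.Y x i * F.Y x j := by
      rw [Finset.mul_sum]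
      refine Finset.sum_congr rfl fun i _ => ?_
      rw [Finset.mul_sum, Finset.sum_mul]
      exact Finset.sum_congr rfl fun j _ => by rw [hg j i]; ring
    rw [this]; simp; field_simp; ring
  · simp only [G_succ_zero, G_succ_succ, Fin.succ_ne_zero, if_false, mul_zero]
    rw [Finset.sum_mul, ← Finset.sum_add_distrib]
    exact Finset.sum_eq_zero fun j _ => by ring

/-- The inverse of the slice metric, as an array of space-time components. -/
def gInv (F : LocalMetric) (x : Coord) (a b : Fin 4) : ℝ :=
  Fin.cases 0 (fun i => Fin.cases 0 (fun j => (F.g x)⁻¹ i j) b) a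

/-- The splitting into T and the slice: the inverse metric is g⁻¹ − T ⊗ T. Its second term is the
source of k in `quad_split` and of T(u) in the eikonal equation. -/
theorem G_mul_inv (hg : ∀ i j, F.g x i j = F.g x j i) (hn : F.n x ≠ 0)
    (hd : IsUnit (F.g x).det) :
    F.G x * Matrix.of (fun a b => F.gInv x a b - F.T x a * F.T x b) = 1 := by
  ext a b
  have hT : ∑ c, F.G x a c * (F.T x c * F.T x b)
      = -F.n x * (if a = 0 then 1 else 0) * F.T x b := by
    rw [← sum_G_mul_T hg hn, Finset.sum_mul]
    exact Finset.sum_congr rfl fun c _ => by ring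
  have hi : ∀ k j, ∑ i, F.g x k i * (F.g x)⁻¹ i j = if k = j then 1 else 0 := fun k j => by
    rw [← Matrix.mul_apply, Matrix.mul_nonsing_inv _ hd, Matrix.one_apply]
  simp only [Matrix.mul_apply, Matrix.of_apply, mul_sub, Finset.sum_sub_distrib, hT]
  rw [Fin.sum_univ_succ]
  refine Fin.cases ?_ (fun j => ?_) b
  · simp only [gInv, Fin.cases_zero, Fin.cases_succ, T_zero]
    refine Fin.cases ?_ (fun k => ?_) a
    · simp [hn]
    · simp [Fin.succ_ne_zero]
  · simp only [gInv, Fin.cases_zero, Fin.cases_succ, T_succ]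
    refine Fin.cases ?_ (fun k => ?_) a
    · simp only [G_zero_succ, Finset.sum_mul]
      rw [Finset.sum_comm]
      have : ∀ k, ∑ i, F.g x k i * F.Y x k * (F.g x)⁻¹ i j = F.Y x k * if k = j then 1 else 0 :=
        fun k => by
          rw [← hi, Finset.mul_sum]; exact Finset.sum_congr rfl fun i _ => by ring
      simp only [this]
      simp [(Fin.succ_ne_zero j).symm]
      field_simp
      ring
    · simp only [G_succ_succ, hi]
      simp [Fin.succ_ne_zero, Matrix.one_apply]

theorem G_inv (hg : ∀ i j, F.g x i j = F.g x j i) (hn : F.n x ≠ 0) (hd : IsUnit (F.g x).det)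
    (a b : Fin 4) : (F.G x)⁻¹ a b = F.gInv x a b - F.T x a * F.T x b := by
  rw [Matrix.inv_eq_right_inv (G_mul_inv hg hn hd)]; rfl

theorem isUnit_det_G (hg : ∀ i j, F.g x i j = F.g x j i) (hn : F.n x ≠ 0)
    (hd : IsUnit (F.g x).det) : IsUnit (F.G x).det :=
  Matrix.isUnit_det_of_right_inverse (G_mul_inv hg hn hd)

/-- The antisymmetric part of the covariant derivative of a vector field dual to `-φ dψ`. -/
theorem inn_D_sub_swap (hG : MetricAt F.G x) {Z : Coord → Fin 4 → ℝ} {φ ψ : Coord → ℝ}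
    (hZ : ∀ a, DifferentiableAt ℝ (fun y => Z y a) x) (hφ : DifferentiableAt ℝ φ x)
    (hψ : ContDiffAt ℝ 2 ψ x)
    (hlow : ∀ᶠ y in 𝓝 x, ∀ f, ∑ a, F.G y f a * Z y a = -φ y * pd f ψ y)
    (X Y : Coord → Fin 4 → ℝ) :
    F.inn x (F.D X Z x) (Y x) - F.inn x (F.D Y Z x) (X x)
      = -(dir X φ x * dir Y ψ x) + dir Y φ x * dir X ψ x := by
  rw [inn_D_eq_covDown hG hZ, inn_D_eq_covDown hG hZ, Finset.sum_comm (γ := Fin 4)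
    (f := fun b f => covDown F Z b f x * Y x b * X x f)]
  have h1 : ∀ b f, pd b (fun z => ∑ a, F.G z f a * Z z a) x
      = -(pd b φ x * pd f ψ x) - φ x * pd b (pd f ψ) x := fun b f => by
    rw [pd_congr (hlow.mono fun y hy => hy f), pd_mul hφ.fun_neg (differentiableAt_pd hψ)]
    have : pd b (fun y => -φ y) x = -pd b φ x := by
      unfold pd; rw [fderiv_fun_neg]; rfl
    rw [this]; ring
  simp only [dir, Finset.sum_mul_sum, ← Finset.sum_neg_distrib, ← Finset.sum_sub_distrib,
    ← Finset.sum_add_distrib]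
  have h2 : ∀ b f, covDown F Z b f x * X x b * Y x f - covDown F Z f b x * Y x f * X x b
      = -(X x b * pd b φ x * (Y x f * pd f ψ x)) + Y x f * pd f φ x * (X x b * pd b ψ x) := by
    intro b f
    unfold covDown
    simp only [h1, pd_pd_comm (a := f) (b := b) hψ, hG.chl_symm _ f b]
    ring
  simp only [h2, Finset.sum_add_distrib]
  congr 1
  rw [Finset.sum_comm]

end LocalMetric

/-! ### Space-times with a canonical frame, near a point of a coordinate patch -/

namespace LocalFrame

open LocalMetric Filter Topology

variable {F : LocalFrame} {x : Coord}

/-- Near `x` the components are those of a vacuum space-time in CMCSH gauge with a canonical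
frame. -/
def Good (F : LocalFrame) (x : Coord) : Prop :=
  ∃ (I : Set ℝ) (V : Set (Fin 3 → ℝ)) (W : Set Coord), IsOpen V ∧ IsOpen W ∧ x ∈ W ∧
    W ⊆ patch I V ∧ F.IsSolution I V ∧ F.IsCanonical W

theorem contDiffAt_lift {X : Coord → Fin 3 → ℝ} {n : WithTop ℕ∞}
    (hX : ∀ i, ContDiffAt ℝ n (fun y => X y i) x) (a : Fin 4) :
    ContDiffAt ℝ n (fun y => lift X y a) x := by
  refine Fin.cases ?_ (fun i => ?_) a
  · exact contDiffAt_const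
  · exact hX i

theorem dir_lift {X : Coord → Fin 3 → ℝ} {f : Coord → ℝ} :
    dir (lift X) f x = ∑ i : Fin 3, X x i * pd i.succ f x := by
  simp [dir, Fin.sum_univ_succ (n := 3), lift]

theorem inn_lift (X Y : Coord → Fin 3 → ℝ) :
    F.inn x (lift X x) (lift Y x) = ∑ i, ∑ j, F.g x i j * X x i * Y x j := by
  simp [inn, Fin.sum_univ_succ (n := 3), lift, G_succ_succ]

namespace Good

/-- The conditions hold on a neighbourhood, so pointwise consequences of `Good` may be
differentiated at `x`. -/
theorem eventually (h : Good F x) : ∀ᶠ y in 𝓝 x, Good F y := by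
  obtain ⟨I, V, W, hV, hW, hx, hWV, hs, hc⟩ := h
  filter_upwards [hW.mem_nhds hx] with y hy
  exact ⟨I, V, W, hV, hW, hy, hWV, hs, hc⟩

theorem n_smooth (h : Good F x) : ContDiffAt ℝ 2 F.n x := by
  obtain ⟨I, V, W, hV, hW, hx, hWV, hs, hc⟩ := h
  exact hs.n_smooth.contDiffAt (mem_of_superset (hW.mem_nhds hx) hWV)

theorem Y_smooth (h : Good F x) (i : Fin 3) : ContDiffAt ℝ 2 (fun y => F.Y y i) x := by
  obtain ⟨I, V, W, hV, hW, hx, hWV, hs, hc⟩ := h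
  exact (hs.Y_smooth i).contDiffAt (mem_of_superset (hW.mem_nhds hx) hWV)

theorem g_smooth (h : Good F x) (i j : Fin 3) : ContDiffAt ℝ 2 (fun y => F.g y i j) x := by
  obtain ⟨I, V, W, hV, hW, hx, hWV, hs, hc⟩ := h
  exact (hs.g_smooth i j).contDiffAt (mem_of_superset (hW.mem_nhds hx) hWV)

theorem gh_metric (h : Good F x) : MetricAt F.gh (Fin.tail x) := by
  obtain ⟨I, V, W, hV, hW, hx, hWV, hs, hc⟩ := h
  have hm := (hWV hx).2
  refine ⟨fun i j => ((hs.gh_smooth i j).contDiffAt (hV.mem_nhds hm)).of_le 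
    ENat.LEInfty.out, ?_, ?_⟩
  · filter_upwards [hV.mem_nhds hm] with y hy a b
    simpa using (hs.gh_pos y hy).isHermitian.apply b a
  · exact (hs.gh_pos _ hm).det_pos.ne'.isUnit

theorem n_pos (h : Good F x) : 0 < F.n x := by
  obtain ⟨I, V, W, hV, hW, hx, hWV, hs, hc⟩ := h
  exact hs.n_pos x (hWV hx)

theorem n_ne (h : Good F x) : F.n x ≠ 0 := h.n_pos.ne'

theorem g_pos (h : Good F x) : (F.g x).PosDef := by
  obtain ⟨I, V, W, hV, hW, hx, hWV, hs, hc⟩ := h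
  exact hs.g_pos x (hWV hx)

theorem g_symm (h : Good F x) (i j : Fin 3) : F.g x i j = F.g x j i := by
  simpa using h.g_pos.isHermitian.apply j i

theorem g_det (h : Good F x) : IsUnit (F.g x).det := h.g_pos.det_pos.ne'.isUnit

theorem vacuum (h : Good F x) (a b : Fin 4) : ricci F.G x a b = 0 := by
  obtain ⟨I, V, W, hV, hW, hx, hWV, hs, hc⟩ := h
  exact hs.vacuum x (hWV hx) a b

theorem u_smooth (h : Good F x) : ContDiffAt ℝ 2 F.u x := by
  obtain ⟨I, V, W, hV, hW, hx, hWV, hs, hc⟩ := h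
  exact hc.u_smooth.contDiffAt (hW.mem_nhds hx)

theorem e_smooth (h : Good F x) (A : Fin 2) (i : Fin 3) :
    ContDiffAt ℝ 1 (fun y => F.e A y i) x := by
  obtain ⟨I, V, W, hV, hW, hx, hWV, hs, hc⟩ := h
  exact (hc.e_smooth A i).contDiffAt (hW.mem_nhds hx)

theorem eikonal (h : Good F x) : ∑ a, ∑ c, (F.G x)⁻¹ a c * pd a F.u x * pd c F.u x = 0 := by
  obtain ⟨I, V, W, hV, hW, hx, hWV, hs, hc⟩ := h
  exact hc.eikonal x hx

theorem T_u_pos (h : Good F x) : 0 < dir F.T F.u x := by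
  obtain ⟨I, V, W, hV, hW, hx, hWV, hs, hc⟩ := h
  exact hc.T_u_pos x hx

theorem tangent (h : Good F x) (A : Fin 2) : dir (F.eS A) F.u x = 0 := by
  obtain ⟨I, V, W, hV, hW, hx, hWV, hs, hc⟩ := h
  exact hc.tangent x hx A

theorem orthonormal (h : Good F x) (A B : Fin 2) :
    ∑ i, ∑ j, F.g x i j * F.e A x i * F.e B x j = if A = B then 1 else 0 := by
  obtain ⟨I, V, W, hV, hW, hx, hWV, hs, hc⟩ := h
  exact hc.orthonormal x hx A B

theorem T_smooth (h : Good F x) (a : Fin 4) : ContDiffAt ℝ 2 (fun y => F.T y a) x := by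
  refine Fin.cases ?_ (fun i => ?_) a
  · simp only [T_zero]; exact h.n_smooth.inv h.n_ne
  · simp only [T_succ]; exact (h.n_smooth.inv h.n_ne).neg.mul (h.Y_smooth i)

theorem coframe_smooth (h : Good F x) (i : Fin 3) (a : Fin 4) :
    ContDiffAt ℝ 2 (fun y => F.coframe y i a) x := by
  refine Fin.cases ?_ (fun i => ?_) a
  · exact h.Y_smooth i
  · exact contDiffAt_const

theorem metric (h : Good F x) : MetricAt F.G x := by
  refine ⟨fun a b => ?_, h.eventually.mono fun y hy => G_symm hy.g_symm,
    isUnit_det_G h.g_symm h.n_ne h.g_det⟩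
  simp only [G, Matrix.of_apply]
  exact (((h.n_smooth.pow 2).neg.mul contDiffAt_const).mul contDiffAt_const).add
    (ContDiffAt.sum fun i _ => ContDiffAt.sum fun j _ =>
      ((h.g_smooth i j).mul (h.coframe_smooth i a)).mul (h.coframe_smooth j b))

theorem T_low (h : Good F x) (a : Fin 4) :
    ∑ b, F.G x a b * F.T x b = -F.n x * (if a = 0 then 1 else 0) :=
  sum_G_mul_T h.g_symm h.n_ne a

theorem inn_T (h : Good F x) (V : Fin 4 → ℝ) : F.inn x V (F.T x) = -F.n x * V 0 := by
  unfold inn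
  have : ∀ a, ∑ b, F.G x a b * V a * F.T x b = V a * (-F.n x * (if a = 0 then 1 else 0)) :=
    fun a => by
      rw [← h.T_low, Finset.mul_sum]; exact Finset.sum_congr rfl fun b _ => by ring
  simp only [this]; simp; ring

theorem inn_T_T (h : Good F x) : F.inn x (F.T x) (F.T x) = -1 := by
  rw [h.inn_T, T_zero]; field_simp [h.n_ne]

theorem inn_lift_T (h : Good F x) (X : Coord → Fin 3 → ℝ) :
    F.inn x (lift X x) (F.T x) = 0 := by
  rw [h.inn_T]; simp [lift]

/-- With the inverse metric g⁻¹ − T ⊗ T the eikonal equation reads |∇u|² = T(u)². Since T(u) > 0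
this identifies |∇u| with b⁻¹, and the C¹ regularity of N follows from that of b. -/
theorem sum_gradNorm (h : Good F x) :
    ∑ i : Fin 3, ∑ j : Fin 3, (F.g x)⁻¹ i j * pd i.succ F.u x * pd j.succ F.u x
      = (dir F.T F.u x) ^ 2 := by
  have he := h.eikonal
  simp only [G_inv h.g_symm h.n_ne h.g_det, sub_mul, Finset.sum_sub_distrib] at he
  have h1 : ∑ a, ∑ c, F.T x a * F.T x c * pd a F.u x * pd c F.u x = (dir F.T F.u x) ^ 2 := by
    unfold dir
    rw [sq, Finset.sum_mul_sum]
    exact Finset.sum_congr rfl fun a _ => Finset.sum_congr rfl fun c _ => by ring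
  have h2 : ∑ a, ∑ c, F.gInv x a c * pd a F.u x * pd c F.u x
      = ∑ i : Fin 3, ∑ j : Fin 3, (F.g x)⁻¹ i j * pd i.succ F.u x * pd j.succ F.u x := by
    simp [Fin.sum_univ_succ (n := 3), gInv]
  rw [h1, h2] at he
  linarith

theorem gradNorm_eq (h : Good F x) : F.gradNorm x = dir F.T F.u x := by
  unfold gradNorm
  rw [h.sum_gradNorm, Real.sqrt_sq h.T_u_pos.le]

theorem b_eq (h : Good F x) : F.b x = (F.gradNorm x)⁻¹ := by
  rw [h.gradNorm_eq, b]

theorem b_pos (h : Good F x) : 0 < F.b x := inv_pos.2 h.T_u_pos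

theorem contDiffAt_Tu (h : Good F x) : ContDiffAt ℝ 1 (fun y => dir F.T F.u y) x := by
  unfold dir
  exact ContDiffAt.sum fun a _ =>
    ((h.T_smooth a).of_le (by norm_num)).mul (contDiffAt_one_pd h.u_smooth)

theorem b_smooth (h : Good F x) : ContDiffAt ℝ 1 F.b x :=
  h.contDiffAt_Tu.inv h.T_u_pos.ne'

theorem b_differentiableAt (h : Good F x) : DifferentiableAt ℝ F.b x :=
  h.b_smooth.differentiableAt (by norm_num)

theorem N_eq (h : Good F x) (i : Fin 3) :
    F.N x i = -F.b x * ∑ j : Fin 3, (F.g x)⁻¹ i j * pd j.succ F.u x := by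
  rw [N, h.b_eq]

theorem N_smooth (h : Good F x) (i : Fin 3) : ContDiffAt ℝ 1 (fun y => F.N y i) x := by
  have h1 : (fun y => F.N y i) =ᶠ[𝓝 x]
      fun y => -F.b y * ∑ j : Fin 3, (F.g y)⁻¹ i j * pd j.succ F.u y :=
    h.eventually.mono fun y hy => hy.N_eq i
  refine ContDiffAt.congr_of_eventuallyEq ?_ h1
  exact h.b_smooth.neg.mul (ContDiffAt.sum fun j _ =>
    ((contDiffAt_inv_apply h.g_smooth h.g_det i j).of_le (by norm_num)).mul
      (contDiffAt_one_pd h.u_smooth))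

theorem g_mul_N (h : Good F x) (i : Fin 3) :
    ∑ j, F.g x i j * F.N x j = -F.b x * pd i.succ F.u x := by
  have hi : ∀ k j, ∑ i, F.g x k i * (F.g x)⁻¹ i j = if k = j then 1 else 0 := fun k j => by
    rw [← Matrix.mul_apply, Matrix.mul_nonsing_inv _ h.g_det, Matrix.one_apply]
  calc _ = ∑ m : Fin 3, -F.b x * ((∑ j, F.g x i j * (F.g x)⁻¹ j m) * pd m.succ F.u x) := by
        simp only [h.N_eq, Finset.mul_sum, Finset.sum_mul]
        rw [Finset.sum_comm]
        exact Finset.sum_congr rfl fun m _ => Finset.sum_congr rfl fun j _ => by ring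
    _ = _ := by simp [hi]

theorem inn_N (h : Good F x) (X : Coord → Fin 3 → ℝ) :
    F.inn x (lift X x) (F.NS x) = -F.b x * dir (lift X) F.u x := by
  rw [NS, inn_lift, dir_lift, Finset.mul_sum]
  refine Finset.sum_congr rfl fun i _ => ?_
  have : ∑ j, F.g x i j * X x i * F.N x j = X x i * ∑ j, F.g x i j * F.N x j := by
    rw [Finset.mul_sum]; exact Finset.sum_congr rfl fun j _ => by ring
  rw [this, h.g_mul_N]; ring

theorem dir_N_u (h : Good F x) : dir F.NS F.u x = -(F.b x)⁻¹ := by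
  rw [NS, dir_lift]
  have h1 : ∑ i, F.N x i * pd i.succ F.u x
      = -F.b x * ∑ i : Fin 3, ∑ j : Fin 3, (F.g x)⁻¹ i j * pd i.succ F.u x * pd j.succ F.u x := by
    rw [Finset.mul_sum]
    refine Finset.sum_congr rfl fun i _ => ?_
    rw [h.N_eq, mul_assoc, Finset.sum_mul]
    congr 1
    exact Finset.sum_congr rfl fun j _ => by ring
  rw [h1, h.sum_gradNorm, b]
  field_simp [h.T_u_pos.ne']

end Good

/-- The frame `N, e₁, e₂` as space-time vector fields. -/
def fS (F : LocalFrame) (a : Fin 3) : Coord → Fin 4 → ℝ := lift (F.f a)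

theorem fS_zero : F.fS 0 = F.NS := rfl

theorem fS_succ (A : Fin 2) : F.fS A.succ = F.eS A := rfl

namespace Good

theorem f_smooth (h : Good F x) (a i : Fin 3) : ContDiffAt ℝ 1 (fun y => F.f a y i) x := by
  refine Fin.cases ?_ (fun A => ?_) a
  · exact h.N_smooth i
  · exact h.e_smooth A i

theorem fS_smooth (h : Good F x) (a : Fin 3) (c : Fin 4) :
    ContDiffAt ℝ 1 (fun y => F.fS a y c) x := contDiffAt_lift (h.f_smooth a) c

theorem fS_diff (h : Good F x) (a : Fin 3) (c : Fin 4) :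
    DifferentiableAt ℝ (fun y => F.fS a y c) x := (h.fS_smooth a c).differentiableAt (by norm_num)

theorem T_diff (h : Good F x) (c : Fin 4) : DifferentiableAt ℝ (fun y => F.T y c) x :=
  (h.T_smooth c).differentiableAt (by norm_num)

theorem inn_fS (h : Good F x) (a c : Fin 3) :
    F.inn x (F.fS a x) (F.fS c x) = if a = c then 1 else 0 := by
  have hN : ∀ A, F.inn x (F.eS A x) (F.NS x) = 0 := fun A => by
    rw [eS, h.inn_N, ← eS, h.tangent, mul_zero]
  refine Fin.cases ?_ (fun A => ?_) a <;> refine Fin.cases ?_ (fun B => ?_) c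
  · have := h.inn_N F.N
    rw [← NS, h.dir_N_u] at this
    rw [fS_zero, this]; simp [h.b_pos.ne']
  · rw [fS_zero, fS_succ, inn_comm h.metric, hN]; simp [(Fin.succ_ne_zero B).symm]
  · rw [fS_zero, fS_succ, hN]; simp [Fin.succ_ne_zero A]
  · rw [fS_succ, fS_succ, eS, eS, inn_lift, h.orthonormal]; simp

theorem inn_fS_T (h : Good F x) (a : Fin 3) : F.inn x (F.fS a x) (F.T x) = 0 := h.inn_lift_T _

theorem inn_T_fS (h : Good F x) (a : Fin 3) : F.inn x (F.T x) (F.fS a x) = 0 := by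
  rw [inn_comm h.metric, h.inn_fS_T]

theorem f_orthonormal (h : Good F x) (a c : Fin 3) :
    ∑ i, ∑ j, F.g x i j * F.f a x i * F.f c x j = if a = c then 1 else 0 := by
  rw [← inn_lift]; exact h.inn_fS a c

/-- The inverse of the slice metric in the orthonormal frame. -/
theorem g_inv (h : Good F x) (i j : Fin 3) :
    (F.g x)⁻¹ i j = ∑ a, F.f a x i * F.f a x j := by
  set M : Matrix (Fin 3) (Fin 3) ℝ := Matrix.of fun a i => F.f a x i with hM
  have h1 : M * (F.g x * M.transpose) = 1 := by
    ext a c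
    rw [Matrix.one_apply, ← h.f_orthonormal a c]
    simp only [Matrix.mul_apply, Matrix.transpose_apply, hM, Matrix.of_apply, Finset.mul_sum]
    exact Finset.sum_congr rfl fun i _ => Finset.sum_congr rfl fun j _ => by ring
  -- A one-sided inverse of a square matrix is two-sided, so orthonormality of the rows yields
  -- completeness of the frame.
  have h2 : F.g x * (M.transpose * M) = 1 := by
    rw [← Matrix.mul_assoc]; exact mul_eq_one_comm.1 h1
  rw [Matrix.inv_eq_right_inv h2]
  simp [Matrix.mul_apply, hM]

/-- The inverse of the space-time metric in the orthonormal frame. -/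
theorem G_inv (h : Good F x) (a b : Fin 4) :
    (F.G x)⁻¹ a b = (∑ c, F.fS c x a * F.fS c x b) - F.T x a * F.T x b := by
  rw [LocalMetric.G_inv h.g_symm h.n_ne h.g_det]
  congr 1
  refine Fin.cases ?_ (fun i => ?_) a
  · simp [gInv, fS, lift]
  · refine Fin.cases ?_ (fun j => ?_) b
    · simp [gInv, fS, lift]
    · simpa [gInv, fS, lift] using h.g_inv i j

/-- Expansion of a vector in the orthonormal frame. -/
theorem expand (h : Good F x) (V : Fin 4 → ℝ) :
    V = ∑ a, F.inn x V (F.fS a x) • F.fS a x - F.inn x V (F.T x) • F.T x := by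
  funext c
  have h1 : (F.G x)⁻¹ * F.G x = 1 := Matrix.nonsing_inv_mul _ h.metric.det
  have h2 : V c = ∑ a, ∑ b, (F.G x)⁻¹ c b * F.G x b a * V a := by
    have : ∀ a, ∑ b, (F.G x)⁻¹ c b * F.G x b a * V a = (1 : Matrix (Fin 4) (Fin 4) ℝ) c a * V a :=
      fun a => by rw [← h1, Matrix.mul_apply, Finset.sum_mul]
    simp [this, Matrix.one_apply]
  rw [h2]
  simp only [h.G_inv, sub_mul, Finset.sum_sub_distrib, Finset.sum_mul, Pi.sub_apply,
    Finset.sum_apply, Pi.smul_apply, smul_eq_mul, inn]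
  congr 1
  · calc _ = ∑ a, ∑ e, ∑ b, F.fS e x c * F.fS e x b * F.G x b a * V a :=
          Finset.sum_congr rfl fun a _ => Finset.sum_comm
      _ = ∑ e, ∑ a, ∑ b, F.fS e x c * F.fS e x b * F.G x b a * V a := Finset.sum_comm
      _ = _ := Finset.sum_congr rfl fun e _ => Finset.sum_congr rfl fun a _ =>
          Finset.sum_congr rfl fun b _ => by rw [h.metric.symm.self_of_nhds b a]; ring
  · exact Finset.sum_congr rfl fun a _ => Finset.sum_congr rfl fun b _ => by
      rw [h.metric.symm.self_of_nhds b a]; ring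

theorem inn_expand (h : Good F x) (V W : Fin 4 → ℝ) :
    F.inn x V W = ∑ a, F.inn x V (F.fS a x) * F.inn x W (F.fS a x)
      - F.inn x V (F.T x) * F.inn x W (F.T x) := by
  conv_lhs => rw [h.expand V, inn_sub_left, inn_sum_left, inn_smul_left,
    inn_comm h.metric (F.T x)]
  simp only [inn_comm h.metric W]

/-- The Ricci curvature in the orthonormal frame vanishes. -/
theorem ricci_frame (h : Good F x) (V W : Fin 4 → ℝ) :
    ∑ a, F.Rm x (F.fS a x) V (F.fS a x) W = F.Rm x (F.T x) V (F.T x) W := by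
  have h1 : ∀ b e, ∑ a, ∑ c, (F.G x)⁻¹ a c * riemannDown F.G x a b c e = 0 := fun b e => by
    rw [← h.vacuum b e]
    unfold ricci riemannDown
    simp only [Finset.mul_sum]
    have h2 : (F.G x)⁻¹ * F.G x = 1 := Matrix.nonsing_inv_mul _ h.metric.det
    have hs : ∀ a c, (F.G x)⁻¹ a c = (F.G x)⁻¹ c a := fun a c => by
      simp only [h.G_inv]
      congr 1
      · exact Finset.sum_congr rfl fun _ _ => mul_comm _ _
      · ring
    calc _ = ∑ c, ∑ p, ∑ a, (F.G x)⁻¹ a c * (F.G x a p * riemannUp F.G x p b c e) := by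
          rw [Finset.sum_comm]
          exact Finset.sum_congr rfl fun c _ => Finset.sum_comm
      _ = ∑ c, ∑ p, (1 : Matrix (Fin 4) (Fin 4) ℝ) c p * riemannUp F.G x p b c e :=
          Finset.sum_congr rfl fun c _ => Finset.sum_congr rfl fun p _ => by
            rw [← h2, Matrix.mul_apply, Finset.sum_mul]
            exact Finset.sum_congr rfl fun a _ => by rw [hs a c]; ring
      _ = _ := by simp [Matrix.one_apply]
  have h3 : ∀ Z : Fin 4 → ℝ, F.Rm x Z V Z W
      = ∑ b, ∑ e, (∑ a, ∑ c, Z a * Z c * riemannDown F.G x a b c e) * V b * W e := fun Z => by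
    unfold Rm
    simp only [Finset.sum_mul]
    calc _ = ∑ b, ∑ a, ∑ e, ∑ c, riemannDown F.G x a b c e * Z a * V b * Z c * W e := by
          rw [Finset.sum_comm]
          exact Finset.sum_congr rfl fun c _ => Finset.sum_congr rfl fun a _ => Finset.sum_comm
      _ = ∑ b, ∑ e, ∑ a, ∑ c, riemannDown F.G x a b c e * Z a * V b * Z c * W e :=
          Finset.sum_congr rfl fun c _ => Finset.sum_comm
      _ = _ := Finset.sum_congr rfl fun _ _ => Finset.sum_congr rfl fun _ _ =>
          Finset.sum_congr rfl fun _ _ => Finset.sum_congr rfl fun _ _ => by ring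
  have h4 : ∀ b e, (∑ f, ∑ a, ∑ c, F.fS f x a * F.fS f x c * riemannDown F.G x a b c e)
      = ∑ a, ∑ c, F.T x a * F.T x c * riemannDown F.G x a b c e := fun b e => by
    have h5 := h1 b e
    simp only [h.G_inv, sub_mul, Finset.sum_sub_distrib, Finset.sum_mul] at h5
    rw [← sub_eq_zero, ← h5]
    congr 1
    rw [Finset.sum_comm]
    exact Finset.sum_congr rfl fun a _ => Finset.sum_comm
  simp only [h3]
  rw [Finset.sum_comm]
  refine Finset.sum_congr rfl fun b _ => ?_
  rw [Finset.sum_comm]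
  refine Finset.sum_congr rfl fun e _ => ?_
  rw [← h4, Finset.sum_mul, Finset.sum_mul]

end Good

end LocalFrame

end

/-! ### Comparison of the curvature with that of the background metric -/

noncomputable section

/-- The Gauss-type comparison of the curvatures of two connections, in matrix form. -/
theorem curvature_comparison {R : Type*} [Ring R] {g gi Γc Γc' Γd Γd' Hc Hd Pcd Pdc Bcd Bdc : R}
    (h1 : g * gi = 1) (h2 : gi * g = 1) :
    (Bcd + (Γc + Γc') * Hd + g * Pcd) - (Bdc + (Γd + Γd') * Hc + g * Pdc)
        - Γc' * (gi * Γd) + Γd' * (gi * Γc)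
      = g * (Pcd - Pdc + Hc * Hd - Hd * Hc)
        + (Bcd - Γc' * (gi * (Γd - g * Hd)) - (Γd - g * Hd) * (gi * Γc))
        - (Bdc - Γd' * (gi * (Γc - g * Hc)) - (Γc - g * Hc) * (gi * Γd))
        - ((Γc - g * Hc) * (gi * (Γd - g * Hd)) - (Γd - g * Hd) * (gi * (Γc - g * Hc))) := by
  have e1 : ∀ X, g * (gi * X) = X := fun X => by rw [← mul_assoc, h1, one_mul]
  have e2 : ∀ X, gi * (g * X) = X := fun X => by rw [← mul_assoc, h2, one_mul]
  simp only [mul_sub, sub_mul, mul_add, add_mul, mul_assoc, e2]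
  abel

namespace LocalFrame

open LocalMetric Filter Topology

variable {F : LocalFrame} {x : Coord}

/-- The difference of the Levi-Civita connections of `g` and of the background metric, as a
covariant tensor of the slice. -/
def diffTensor (F : LocalFrame) (l i j : Fin 3) (x : Coord) : ℝ :=
  2⁻¹ * (F.Dg x i j l + F.Dg x j i l - F.Dg x l i j)

/-- The Christoffel symbols of the slice metric. -/
def slChr (F : LocalFrame) (x : Coord) (m i j : Fin 3) : ℝ :=
  ∑ l, (F.g x)⁻¹ m l * chl F.G l.succ i.succ j.succ x

/-- The covariant derivative of the difference tensor with respect to the slice metric. -/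
def covDiff (F : LocalFrame) (x : Coord) (c a d b : Fin 3) : ℝ :=
  pd c.succ (F.diffTensor a d b) x - ∑ m, slChr F x m c a * F.diffTensor m d b x
    - ∑ m, slChr F x m c d * F.diffTensor a m b x - ∑ m, slChr F x m c b * F.diffTensor a d m x

theorem pd_tail {f : (Fin 3 → ℝ) → ℝ} (hf : DifferentiableAt ℝ f (Fin.tail x)) (i : Fin 3) :
    pd i.succ (fun y : Coord => f (Fin.tail y)) x = pd i f (Fin.tail x) := by
  let t : Coord →L[ℝ] (Fin 3 → ℝ) := ContinuousLinearMap.pi fun j => ContinuousLinearMap.proj j.succ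
  have ht : ∀ y : Coord, Fin.tail y = t y := fun y => rfl
  have h1 : HasFDerivAt (fun y : Coord => f (t y)) ((fderiv ℝ f (t x)).comp t) x :=
    HasFDerivAt.comp x (by rw [← ht]; exact hf.hasFDerivAt) t.hasFDerivAt
  unfold pd
  simp only [ht]
  rw [h1.fderiv]
  have : t (Pi.single i.succ 1) = Pi.single i 1 := by
    funext j
    simp [t, Pi.single_apply]
  simp [this]

theorem contDiffAt_comp_tail {f : (Fin 3 → ℝ) → ℝ} {n : WithTop ℕ∞}
    (hf : ContDiffAt ℝ n f (Fin.tail x)) : ContDiffAt ℝ n (fun y : Coord => f (Fin.tail y)) x := by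
  let t : Coord →L[ℝ] (Fin 3 → ℝ) := ContinuousLinearMap.pi fun j => ContinuousLinearMap.proj j.succ
  exact ContDiffAt.comp (f := fun y : Coord => Fin.tail y) x hf t.contDiff.contDiffAt

namespace Good

theorem hatChr_smooth (h : Good F x) (p i j : Fin 3) :
    ContDiffAt ℝ 1 (fun y : Coord => christoffel F.gh (Fin.tail y) p i j) x :=
  contDiffAt_comp_tail (f := fun z => christoffel F.gh z p i j)
    (h.gh_metric.contDiffAt_christoffel p i j)

theorem g_diff (h : Good F x) (i j : Fin 3) : DifferentiableAt ℝ (fun y => F.g y i j) x :=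
  (h.g_smooth i j).differentiableAt (by norm_num)

theorem Y_diff (h : Good F x) (i : Fin 3) : DifferentiableAt ℝ (fun y => F.Y y i) x :=
  (h.Y_smooth i).differentiableAt (by norm_num)

theorem Dg_smooth (h : Good F x) (m i j : Fin 3) : ContDiffAt ℝ 1 (fun y => F.Dg y m i j) x := by
  unfold Dg
  have hg := fun i j => (h.g_smooth i j).of_le (m := 1) (by norm_num)
  exact ((contDiffAt_one_pd (h.g_smooth i j)).sub
    (ContDiffAt.sum fun p _ => (h.hatChr_smooth p m i).mul (hg p j))).sub
    (ContDiffAt.sum fun p _ => (h.hatChr_smooth p m j).mul (hg i p))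

theorem diffTensor_smooth (h : Good F x) (l i j : Fin 3) :
    ContDiffAt ℝ 1 (F.diffTensor l i j) x := by
  unfold diffTensor
  exact contDiffAt_const.mul (((h.Dg_smooth _ _ _).add (h.Dg_smooth _ _ _)).sub
    (h.Dg_smooth _ _ _))

theorem diffTensor_diff (h : Good F x) (l i j : Fin 3) :
    DifferentiableAt ℝ (F.diffTensor l i j) x :=
  (h.diffTensor_smooth l i j).differentiableAt (by norm_num)

/-- The Koszul formula: in the combination of ∇̂g that defines `diffTensor` the symmetry of Γ̂
cancels all background symbols except those contracted with g on the upper index. -/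
theorem chl_eq (h : Good F x) (l i j : Fin 3) :
    chl F.G l.succ i.succ j.succ x
      = F.diffTensor l i j x + ∑ p, F.g x l p * christoffel F.gh (Fin.tail x) p i j := by
  have hs := h.gh_metric.christoffel_symm
  have hp : ∀ c a b : Fin 3, pd c.succ (fun y => F.g y a b) x = pd c.succ (fun y => F.g y b a) x :=
    fun c a b => pd_congr (h.eventually.mono fun y hy => hy.g_symm a b)
  unfold diffTensor Dg chl
  simp only [G_succ_succ]
  have e1 : ∑ p, christoffel F.gh (Fin.tail x) p j l * F.g x i p
      = ∑ p, christoffel F.gh (Fin.tail x) p l j * F.g x i p :=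
    Finset.sum_congr rfl fun p _ => by rw [hs p j l]
  have e2 : ∑ p, christoffel F.gh (Fin.tail x) p i l * F.g x j p
      = ∑ p, christoffel F.gh (Fin.tail x) p l i * F.g x p j :=
    Finset.sum_congr rfl fun p _ => by rw [hs p i l, h.g_symm j p]
  have e3 : ∑ p, christoffel F.gh (Fin.tail x) p j i * F.g x p l
      = ∑ p, christoffel F.gh (Fin.tail x) p i j * F.g x p l :=
    Finset.sum_congr rfl fun p _ => by rw [hs p j i]
  have e4 : ∑ p, F.g x l p * christoffel F.gh (Fin.tail x) p i j
      = ∑ p, christoffel F.gh (Fin.tail x) p i j * F.g x p l :=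
    Finset.sum_congr rfl fun p _ => by rw [h.g_symm l p]; ring
  rw [e1, e2, e3, e4]
  ring

/-- The second fundamental form in terms of Christoffel symbols. -/
theorem sum_chl_mul_T (h : Good F x) (i j : Fin 3) :
    ∑ c, chl F.G c i.succ j.succ x * F.T x c = F.k x i j := by
  have h0 : ∀ i j : Fin 3, pd i.succ (fun y => F.G y j.succ 0) x
      = ∑ m, (pd i.succ (fun y => F.g y j m) x * F.Y x m
        + F.g x j m * pd i.succ (fun y => F.Y y m) x) := fun i j => by
    simp only [G_succ_zero]
    rw [pd_sum fun m _ => (h.g_diff j m).fun_mul (h.Y_diff m)]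
    exact Finset.sum_congr rfl fun m _ => pd_mul (h.g_diff j m) (h.Y_diff m)
  rw [Fin.sum_univ_succ]
  unfold chl k
  simp only [G_succ_succ, h0, T_zero, T_succ, Fin.sum_univ_three, mul_inv]
  rw [h.g_symm j 0, h.g_symm j 1, h.g_symm j 2]
  ring

theorem k_symm (h : Good F x) (i j : Fin 3) : F.k x i j = F.k x j i := by
  rw [← h.sum_chl_mul_T, ← h.sum_chl_mul_T]
  exact Finset.sum_congr rfl fun c _ => by rw [h.metric.chl_symm c]

theorem k_smooth (h : Good F x) (i j : Fin 3) : ContDiffAt ℝ 1 (fun y => F.k y i j) x := by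
  have : (fun y => F.k y i j) =ᶠ[𝓝 x] fun y => ∑ c, chl F.G c i.succ j.succ y * F.T y c :=
    h.eventually.mono fun y hy => (hy.sum_chl_mul_T i j).symm
  refine ContDiffAt.congr_of_eventuallyEq (ContDiffAt.sum fun c _ => ?_) this
  exact (h.metric.contDiffAt_chl _ _ _).mul ((h.T_smooth c).of_le (by norm_num))

/-- Raising the index with g⁻¹ − T ⊗ T separates the intrinsic symbols of the slice from a product
of two contractions with T, each equal to k by `sum_chl_mul_T`. This is the extrinsic part of the
Gauss equation. -/
theorem quad_split (h : Good F x) (a b c e : Fin 3) :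
    ∑ m, chl F.G m a.succ b.succ x * christoffel F.G x m c.succ e.succ
      = ∑ m : Fin 3, chl F.G m.succ a.succ b.succ x * F.slChr x m c e
        - F.k x a b * F.k x c e := by
  simp only [MetricAt.christoffel_eq, LocalMetric.G_inv h.g_symm h.n_ne h.g_det, sub_mul,
    Finset.sum_sub_distrib, mul_sub]
  congr 1
  · rw [Fin.sum_univ_succ]
    simp [gInv, Fin.sum_univ_succ (n := 3), slChr]
  · rw [← h.sum_chl_mul_T, ← h.sum_chl_mul_T, Finset.sum_mul]
    refine Finset.sum_congr rfl fun m _ => ?_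
    rw [mul_assoc]
    congr 1
    rw [Finset.mul_sum]
    exact Finset.sum_congr rfl fun n _ => by ring

/-- The spatial components of the space-time curvature in terms of the curvature of the
background metric. -/
theorem riemannDown_succ (h : Good F x) (a b c d : Fin 3) :
    riemannDown F.G x a.succ b.succ c.succ d.succ
      = ∑ p, F.g x a p * riemannUp F.gh (Fin.tail x) p b c d
        + F.covDiff x c a d b - F.covDiff x d a c b
        - (∑ m, ∑ n, F.diffTensor a c m x * ((F.g x)⁻¹ m n * F.diffTensor n d b x)
          - ∑ m, ∑ n, F.diffTensor a d m x * ((F.g x)⁻¹ m n * F.diffTensor n c b x))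
        + F.k x c a * F.k x d b - F.k x d a * F.k x c b := by
  set g : Matrix (Fin 3) (Fin 3) ℝ := F.g x
  -- The direction of differentiation is fixed and the two other indices are read as a matrix, so
  -- that the comparison becomes an identity in a noncommutative ring.
  let Γ : Fin 3 → Matrix (Fin 3) (Fin 3) ℝ := fun c => Matrix.of fun a b =>
    chl F.G a.succ c.succ b.succ x
  let H : Fin 3 → Matrix (Fin 3) (Fin 3) ℝ := fun c => Matrix.of fun a b =>
    christoffel F.gh (Fin.tail x) a c b
  let P : Fin 3 → Fin 3 → Matrix (Fin 3) (Fin 3) ℝ := fun c d => Matrix.of fun a b =>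
    pd c (fun y => christoffel F.gh y a d b) (Fin.tail x)
  let B : Fin 3 → Fin 3 → Matrix (Fin 3) (Fin 3) ℝ := fun c d => Matrix.of fun a b =>
    pd c.succ (F.diffTensor a d b) x
  have key := congrFun (congrFun (curvature_comparison (g := g) (gi := g⁻¹) (Γc := Γ c)
    (Γc' := (Γ c).transpose) (Γd := Γ d) (Γd' := (Γ d).transpose) (Hc := H c) (Hd := H d)
    (Pcd := P c d) (Pdc := P d c) (Bcd := B c d) (Bdc := B d c)
    (Matrix.mul_nonsing_inv _ h.g_det) (Matrix.nonsing_inv_mul _ h.g_det)) a) b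
  have hdiff : ∀ e, Γ e - g * H e = Matrix.of fun a b => F.diffTensor a e b x := fun e => by
    ext a b
    simp only [Matrix.sub_apply, Matrix.mul_apply, Γ, H, Matrix.of_apply, h.chl_eq]
    ring
  have hchr : ∀ e, g⁻¹ * Γ e = Matrix.of fun a b => F.slChr x a e b := fun e => by
    ext a b
    simp only [Matrix.mul_apply, Γ, Matrix.of_apply, slChr, g]
  have hchr' : ∀ (e : Fin 3) (X : Matrix (Fin 3) (Fin 3) ℝ), (Γ e).transpose * (g⁻¹ * X)
      = (Matrix.of fun a b => F.slChr x a e b).transpose * X := fun e X => by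
    have hs : g.IsSymm := Matrix.IsSymm.ext fun i j => h.g_symm j i
    rw [← hchr e, Matrix.transpose_mul, Matrix.transpose_nonsing_inv, hs.eq, Matrix.mul_assoc]
  -- Second derivatives of g enter only as first derivatives of the difference tensor; the factor
  -- Γ_c + Γ_cᵀ is ∂_c g by metric compatibility.
  have hpd : ∀ c d, pd c.succ (chl F.G a.succ d.succ b.succ) x
      = (B c d + (Γ c + (Γ c).transpose) * H d + g * P c d) a b := fun c d => by
    have hc : chl F.G a.succ d.succ b.succ =ᶠ[𝓝 x] fun y => F.diffTensor a d b y
        + ∑ p, F.g y a p * christoffel F.gh (Fin.tail y) p d b :=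
      h.eventually.mono fun y hy => hy.chl_eq a d b
    have hH : ∀ p, DifferentiableAt ℝ (fun y : Coord => christoffel F.gh (Fin.tail y) p d b) x :=
      fun p => (h.hatChr_smooth p d b).differentiableAt (by norm_num)
    have hH' : ∀ p, pd c.succ (fun y : Coord => christoffel F.gh (Fin.tail y) p d b) x
        = pd c (fun y => christoffel F.gh y p d b) (Fin.tail x) := fun p =>
      pd_tail (f := fun y => christoffel F.gh y p d b)
        ((h.gh_metric.contDiffAt_christoffel p d b).differentiableAt (by norm_num)) c
    have hg : ∀ p, pd c.succ (fun y => F.g y a p) x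
        = chl F.G a.succ c.succ p.succ x + chl F.G p.succ c.succ a.succ x := fun p => by
      rw [← h.metric.chl_add]; simp only [G_succ_succ]
    rw [pd_congr hc, pd_add (h.diffTensor_diff a d b)
      (.fun_sum fun p _ => (h.g_diff a p).fun_mul (hH p)),
      pd_sum fun p _ => (h.g_diff a p).fun_mul (hH p)]
    simp only [pd_mul (h.g_diff a _) (hH _), hH', hg, Matrix.add_apply, Matrix.mul_apply, Γ, H, P,
      B, Matrix.of_apply, Matrix.transpose_apply, Finset.sum_add_distrib]
    ring
  rw [hdiff, hdiff, hchr', hchr', hchr', hchr', hchr, hchr] at key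
  have hR : (g * (P c d - P d c + H c * H d - H d * H c)) a b
      = ∑ p, g a p * riemannUp F.gh (Fin.tail x) p b c d := by
    rw [Matrix.mul_apply]
    refine Finset.sum_congr rfl fun p _ => ?_
    simp only [riemannUp, Matrix.sub_apply, Matrix.add_apply, Matrix.mul_apply, P, H,
      Matrix.of_apply]
  rw [h.metric.riemannDown_eq, h.quad_split, h.quad_split, hpd, hpd, ← hR]
  simp only [Matrix.add_apply, Matrix.sub_apply] at key ⊢
  have hq : ∀ c d : Fin 3, ∑ m : Fin 3, chl F.G m.succ c.succ a.succ x * F.slChr x m d b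
      = ((Matrix.of fun a b => F.slChr x a c b).transpose * Γ d) a b := fun c d => by
    rw [← hchr', hchr, Matrix.mul_apply]; rfl
  have hCC : ∀ c d : Fin 3, ((Matrix.of fun a b => F.diffTensor a c b x)
        * (g⁻¹ * Matrix.of fun a b => F.diffTensor a d b x)) a b
      = ∑ m, ∑ n, F.diffTensor a c m x * ((F.g x)⁻¹ m n * F.diffTensor n d b x) := fun c d => by
    simp only [Matrix.mul_apply, Matrix.of_apply, Finset.mul_sum, g]
  have hcov : ∀ c d : Fin 3, F.covDiff x c a d b = B c d a b
        - ((Matrix.of fun a b => F.slChr x a c b).transpose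
            * Matrix.of fun a b => F.diffTensor a d b x) a b
        - ((Matrix.of fun a b => F.diffTensor a d b x) * Matrix.of fun a b => F.slChr x a c b) a b
        - ∑ m, F.slChr x m c d * F.diffTensor a m b x := fun c d => by
    simp only [covDiff, B, Matrix.mul_apply, Matrix.of_apply, Matrix.transpose_apply]
    rw [Finset.sum_congr rfl fun m _ => mul_comm (F.slChr x m c b) (F.diffTensor a d m x)]
    ring
  -- The matrix identity has no counterpart of the Γ^m_{cd} terms of the two covariant derivatives;
  -- by torsion-freeness these cancel in the difference.
  have hsym : ∑ m, F.slChr x m c d * F.diffTensor a m b x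
      = ∑ m, F.slChr x m d c * F.diffTensor a m b x := by
    refine Finset.sum_congr rfl fun m _ => ?_
    unfold slChr
    simp only [h.metric.chl_symm _ c.succ d.succ]
  rw [hq, hq, hcov, hcov, hsym, ← hCC, ← hCC]
  linarith

end Good

end LocalFrame

end

/-! ### Structure equations in the frame: Codazzi and second variation -/

noncomputable section

theorem Finset.sum_mul_sum_transpose {ι : Type*} [Fintype ι] (p U : ι → ℝ) (M : ι → ι → ℝ) :
    ∑ a, p a * ∑ m, M a m * U m = ∑ a, (∑ m, M m a * p m) * U a := by
  simp only [Finset.mul_sum, Finset.sum_mul]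
  rw [Finset.sum_comm]
  exact Finset.sum_congr rfl fun a _ => Finset.sum_congr rfl fun b _ => by ring

namespace LocalFrame

open LocalMetric Filter Topology

variable {F : LocalFrame} {x : Coord}

/-- The coefficients `⟨𝐃_{f_a} f_c, f_d⟩`. -/
def w (F : LocalFrame) (x : Coord) (a c d : Fin 3) : ℝ :=
  F.inn x (F.D (F.fS a) (F.fS c) x) (F.fS d x)

/-- The coefficients `⟨𝐃_T f_c, f_d⟩`. -/
def wT (F : LocalFrame) (x : Coord) (c d : Fin 3) : ℝ :=
  F.inn x (F.D F.T (F.fS c) x) (F.fS d x)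

/-- The frame components of the gradient of the logarithm of the lapse. -/
def acc (F : LocalFrame) (x : Coord) (c : Fin 3) : ℝ := dir (F.fS c) (fun y => Real.log (F.n y)) x

/-- The covariant derivative, along the slice, of a `2`-tensor given by its frame components. -/
def sCov2 (F : LocalFrame) (t : Coord → Fin 3 → Fin 3 → ℝ) (x : Coord) (c a d : Fin 3) : ℝ :=
  dir (F.fS c) (fun y => t y a d) x - ∑ m, F.w x c a m * t x m d - ∑ m, F.w x c d m * t x a m

/-- The covariant derivative, along the slice, of a `3`-tensor given by its frame components. -/
def sCov3 (F : LocalFrame) (t : Coord → Fin 3 → Fin 3 → Fin 3 → ℝ) (x : Coord)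
    (c a d b : Fin 3) : ℝ :=
  dir (F.fS c) (fun y => t y a d b) x - ∑ m, F.w x c a m * t x m d b
    - ∑ m, F.w x c d m * t x a m b - ∑ m, F.w x c b m * t x a d m

/-- The frame components of the difference tensor. -/
def CF (F : LocalFrame) (x : Coord) (a d b : Fin 3) : ℝ :=
  2⁻¹ * (F.DgF x d b a + F.DgF x b d a - F.DgF x a d b)

theorem CF_eq (a d b : Fin 3) :
    F.CF x a d b = ∑ l, ∑ i, ∑ j, F.diffTensor l i j x * F.f a x l * F.f d x i * F.f b x j := by
  unfold CF DgF diffTensor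
  have e1 : ∑ m, ∑ i, ∑ j, F.Dg x m i j * F.f d x m * F.f b x i * F.f a x j
      = ∑ l, ∑ i, ∑ j, F.Dg x i j l * F.f a x l * F.f d x i * F.f b x j := by
    calc _ = ∑ m, ∑ l, ∑ j, F.Dg x m j l * F.f d x m * F.f b x j * F.f a x l :=
          Finset.sum_congr rfl fun m _ => Finset.sum_comm
      _ = ∑ l, ∑ m, ∑ j, F.Dg x m j l * F.f d x m * F.f b x j * F.f a x l := Finset.sum_comm
      _ = _ := Finset.sum_congr rfl fun _ _ => Finset.sum_congr rfl fun _ _ =>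
          Finset.sum_congr rfl fun _ _ => by ring
  have e2 : ∑ m, ∑ i, ∑ j, F.Dg x m i j * F.f b x m * F.f d x i * F.f a x j
      = ∑ l, ∑ i, ∑ j, F.Dg x j i l * F.f a x l * F.f d x i * F.f b x j := by
    calc _ = ∑ m, ∑ l, ∑ j, F.Dg x m j l * F.f b x m * F.f d x j * F.f a x l :=
          Finset.sum_congr rfl fun m _ => Finset.sum_comm
      _ = ∑ l, ∑ m, ∑ j, F.Dg x m j l * F.f b x m * F.f d x j * F.f a x l := Finset.sum_comm
      _ = ∑ l, ∑ j, ∑ m, F.Dg x m j l * F.f b x m * F.f d x j * F.f a x l :=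
          Finset.sum_congr rfl fun _ _ => Finset.sum_comm
      _ = _ := Finset.sum_congr rfl fun _ _ => Finset.sum_congr rfl fun _ _ =>
          Finset.sum_congr rfl fun _ _ => by ring
  rw [e1, e2]
  simp only [← Finset.sum_add_distrib, ← Finset.sum_sub_distrib, Finset.mul_sum]
  exact Finset.sum_congr rfl fun _ _ => Finset.sum_congr rfl fun _ _ =>
          Finset.sum_congr rfl fun _ _ => by ring

namespace Good

theorem f_diff (h : Good F x) (a i : Fin 3) : DifferentiableAt ℝ (fun y => F.f a y i) x :=
  (h.f_smooth a i).differentiableAt (by norm_num)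

theorem kF_diff (h : Good F x) (a c : Fin 3) : DifferentiableAt ℝ (fun y => F.kF y a c) x := by
  unfold kF
  exact .fun_sum fun i _ => .fun_sum fun j _ =>
    (((h.k_smooth i j).differentiableAt (by norm_num)).fun_mul (h.f_diff a i)).fun_mul (h.f_diff c j)

theorem DgF_diff (h : Good F x) (a c d : Fin 3) :
    DifferentiableAt ℝ (fun y => F.DgF y a c d) x := by
  unfold DgF
  exact .fun_sum fun m _ => .fun_sum fun i _ => .fun_sum fun j _ =>
    ((((h.Dg_smooth m i j).differentiableAt (by norm_num)).fun_mul (h.f_diff a m)).fun_mul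
      (h.f_diff c i)).fun_mul (h.f_diff d j)

theorem CF_diff (h : Good F x) (a d b : Fin 3) : DifferentiableAt ℝ (fun y => F.CF y a d b) x := by
  unfold CF
  exact (((h.DgF_diff _ _ _).fun_add (h.DgF_diff _ _ _)).fun_sub (h.DgF_diff _ _ _)).const_mul _

theorem kF_symm (h : Good F x) (a c : Fin 3) : F.kF x a c = F.kF x c a := by
  unfold kF
  rw [Finset.sum_comm]
  exact Finset.sum_congr rfl fun i _ => Finset.sum_congr rfl fun j _ => by
    rw [h.k_symm j i]; ring

theorem D_expand (h : Good F x) (V Z : Coord → Fin 4 → ℝ) :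
    F.D V Z x = ∑ a, F.inn x (V x) (F.fS a x) • F.D (F.fS a) Z x
      - F.inn x (V x) (F.T x) • F.D F.T Z x := by
  -- The four frame vectors are indexed with `none` standing for T, whose coefficient has a minus
  -- sign because T is timelike.
  let c : Option (Fin 3) → ℝ := fun o =>
    o.elim (-F.inn x (V x) (F.T x)) fun a => F.inn x (V x) (F.fS a x)
  let Y : Option (Fin 3) → Coord → Fin 4 → ℝ := fun o => o.elim F.T fun a => F.fS a
  have hV : V x = ∑ o, c o • Y o x := by
    rw [Fintype.sum_option]
    conv_lhs => rw [h.expand (V x)]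
    simp only [c, Y, Option.elim, neg_smul]
    abel
  rw [D_sum_left c Y hV, Fintype.sum_option]
  simp only [c, Y, Option.elim, neg_smul]
  abel

theorem w_antisymm (h : Good F x) (a c d : Fin 3) : F.w x a c d = -F.w x a d c := by
  have h1 := dir_inn (X := F.fS a) h.metric (h.fS_diff c) (h.fS_diff d)
  have h2 : (fun y => F.inn y (F.fS c y) (F.fS d y)) =ᶠ[𝓝 x] fun _ => if c = d then 1 else 0 :=
    h.eventually.mono fun y hy => hy.inn_fS c d
  rw [dir_congr h2, dir_const, inn_comm h.metric (F.fS c x)] at h1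
  unfold w; linarith

theorem wT_antisymm (h : Good F x) (c d : Fin 3) : F.wT x c d = -F.wT x d c := by
  have h1 := dir_inn (X := F.T) h.metric (h.fS_diff c) (h.fS_diff d)
  have h2 : (fun y => F.inn y (F.fS c y) (F.fS d y)) =ᶠ[𝓝 x] fun _ => if c = d then 1 else 0 :=
    h.eventually.mono fun y hy => hy.inn_fS c d
  rw [dir_congr h2, dir_const, inn_comm h.metric (F.fS c x)] at h1
  unfold wT; linarith

theorem inn_D_fS_T (h : Good F x) (X : Coord → Fin 4 → ℝ) (c : Fin 3) :
    F.inn x (F.D X (F.fS c) x) (F.T x) = -F.inn x (F.D X F.T x) (F.fS c x) := by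
  have h1 := dir_inn (X := X) h.metric (h.fS_diff c) h.T_diff
  have h2 : (fun y => F.inn y (F.fS c y) (F.T y)) =ᶠ[𝓝 x] fun _ => 0 :=
    h.eventually.mono fun y hy => hy.inn_fS_T c
  rw [dir_congr h2, dir_const, inn_comm h.metric (F.fS c x)] at h1
  linarith

theorem inn_D_T_T (h : Good F x) (X : Coord → Fin 4 → ℝ) :
    F.inn x (F.D X F.T x) (F.T x) = 0 := by
  have h1 := dir_inn (X := X) h.metric h.T_diff h.T_diff
  have h2 : (fun y => F.inn y (F.T y) (F.T y)) =ᶠ[𝓝 x] fun _ => -1 :=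
    h.eventually.mono fun y hy => hy.inn_T_T
  rw [dir_congr h2, dir_const, inn_comm h.metric (F.T x)] at h1
  linarith

/-- The spatial components of T♭ = −n dt vanish identically, so its spatial covariant derivative is
purely the Christoffel term, which is −k. -/
theorem inn_D_fS_T_fS (h : Good F x) (a c : Fin 3) :
    F.inn x (F.D (F.fS a) F.T x) (F.fS c x) = -F.kF x a c := by
  rw [inn_D_eq_covDown h.metric h.T_diff]
  have hlow : ∀ i j : Fin 3, covDown F.toLocalMetric F.T i.succ j.succ x = -F.k x i j :=
    fun i j => by
      unfold covDown
      have : (fun z => ∑ a, F.G z j.succ a * F.T z a) =ᶠ[𝓝 x] fun _ => 0 :=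
        h.eventually.mono fun y hy => by
          change ∑ a, F.G y j.succ a * F.T y a = 0
          rw [hy.T_low]; simp [Fin.succ_ne_zero]
      rw [pd_congr this, pd_const, h.sum_chl_mul_T]; ring
  unfold kF fS lift
  simp only [Fin.sum_univ_succ (n := 3), Fin.cons_zero, Fin.cons_succ, hlow, mul_zero, zero_mul,
    Finset.sum_const_zero, zero_add, ← Finset.sum_neg_distrib, neg_mul]

theorem dir_log_n (h : Good F x) (X : Coord → Fin 4 → ℝ) :
    dir X (fun y => Real.log (F.n y)) x = (F.n x)⁻¹ * dir X F.n x := by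
  have hd : HasFDerivAt (fun y => Real.log (F.n y)) ((F.n x)⁻¹ • fderiv ℝ F.n x) x :=
    (h.n_smooth.differentiableAt (by norm_num)).hasFDerivAt.log h.n_ne
  rw [dir_eq_fderiv, dir_eq_fderiv, hd.fderiv]; simp

theorem dir_log_b (h : Good F x) (X : Coord → Fin 4 → ℝ) :
    dir X (fun y => Real.log (F.b y)) x = (F.b x)⁻¹ * dir X F.b x := by
  have hd : HasFDerivAt (fun y => Real.log (F.b y)) ((F.b x)⁻¹ • fderiv ℝ F.b x) x :=
    h.b_differentiableAt.hasFDerivAt.log h.b_pos.ne'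
  rw [dir_eq_fderiv, dir_eq_fderiv, hd.fderiv]; simp

/-- Since T♭ = −n dt and ⟨𝐃T, T⟩ = 0, evaluating d(T♭) on T and f_c leaves n⁻¹ f_c(n). No derivative
of the shift survives. -/
theorem inn_D_T_T_fS (h : Good F x) (c : Fin 3) :
    F.inn x (F.D F.T F.T x) (F.fS c x) = F.acc x c := by
  let t : Coord →L[ℝ] ℝ := ContinuousLinearMap.proj 0
  have ht : ∀ (f : Fin 4) y, pd f t y = if f = 0 then 1 else 0 := fun f y => by
    unfold pd; rw [t.fderiv]; simp [t, Pi.single_apply, eq_comm]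
  have hlow : ∀ᶠ y in 𝓝 x, ∀ f, ∑ a, F.G y f a * F.T y a = -F.n y * pd f t y :=
    h.eventually.mono fun y hy f => by rw [hy.T_low, ht]
  have h1 := inn_D_sub_swap h.metric h.T_diff (h.n_smooth.differentiableAt (by norm_num))
    t.contDiff.contDiffAt hlow F.T (F.fS c)
  rw [h.inn_D_T_T] at h1
  have h2 : ∀ X : Coord → Fin 4 → ℝ, dir X t x = X x 0 := fun X => by
    simp [dir, ht]
  rw [h2, h2, T_zero] at h1
  unfold acc
  rw [h.dir_log_n]
  simp only [fS, lift, Fin.cons_zero] at h1 ⊢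
  linarith

/-- The Codazzi equation. -/
theorem codazzi (h : Good F x) (a c d : Fin 3) :
    F.Rm x (F.fS a x) (F.T x) (F.fS c x) (F.fS d x)
      = -F.sCov2 F.kF x c d a + F.sCov2 F.kF x d c a := by
  rw [ricci_identity h.metric h.T_smooth (h.fS_diff c) (h.fS_diff d) (h.fS_diff a)]
  -- One half of the commutator. The vector 𝐃_{f_c} f_d has T-part k_{cd} T, and the acceleration of
  -- T turns it into the extra term k_{cd} ∇_a log n, symmetric in c, d and hence absent from the
  -- difference.
  have key : ∀ c d, dir (F.fS c) (fun y => F.inn y (F.D (F.fS d) F.T y) (F.fS a y)) x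
      - F.inn x (F.D (F.D (F.fS c) (F.fS d)) F.T x) (F.fS a x)
      - F.inn x (F.D (F.fS d) F.T x) (F.D (F.fS c) (F.fS a) x)
      = -F.sCov2 F.kF x c d a + F.kF x c d * F.acc x a := fun c d => by
    have h1 : (fun y => F.inn y (F.D (F.fS d) F.T y) (F.fS a y)) =ᶠ[𝓝 x] fun y => -F.kF y d a :=
      h.eventually.mono fun y hy => hy.inn_D_fS_T_fS d a
    rw [dir_congr h1, dir_neg, h.D_expand (F.D (F.fS c) (F.fS d)), inn_sub_left, inn_sum_left,
      inn_smul_left, h.inn_expand (F.D (F.fS d) F.T x), h.inn_D_T_T, h.inn_D_T_T_fS,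
      h.inn_D_fS_T, h.inn_D_fS_T_fS]
    simp only [h.inn_D_fS_T_fS]
    unfold sCov2 w
    simp only [mul_neg, neg_mul, Finset.sum_neg_distrib]
    rw [Finset.sum_congr rfl fun m _ => mul_comm (F.kF x d m) _]
    ring
  rw [key, key, h.kF_symm d c]
  ring

/-- The second variation equation. -/
theorem second_variation (h : Good F x) (a c : Fin 3) :
    F.Rm x (F.T x) (F.fS a x) (F.T x) (F.fS c x)
      = (dir F.T (fun y => F.kF y c a) x - ∑ m, F.wT x c m * F.kF x m a
          - ∑ m, F.wT x a m * F.kF x c m)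
        + (dir (F.fS c) (fun y => F.acc y a) x - ∑ m, F.w x c a m * F.acc x m)
        + F.acc x a * F.acc x c - ∑ m, F.kF x c m * F.kF x m a := by
  rw [Rm_antisymm_left h.metric,
    ricci_identity h.metric h.T_smooth h.T_diff (h.fS_diff c) (h.fS_diff a)]
  have h1 : (fun y => F.inn y (F.D (F.fS c) F.T y) (F.fS a y)) =ᶠ[𝓝 x] fun y => -F.kF y c a :=
    h.eventually.mono fun y hy => hy.inn_D_fS_T_fS c a
  have h2 : (fun y => F.inn y (F.D F.T F.T y) (F.fS a y)) =ᶠ[𝓝 x] fun y => F.acc y a :=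
    h.eventually.mono fun y hy => hy.inn_D_T_T_fS a
  -- Expanding 𝐃_T f_c and 𝐃_{f_c} T in the frame produces the quadratic terms: the T-part of the
  -- first gives the product of accelerations, the spatial part of the second gives k·k.
  rw [dir_congr h1, dir_congr h2, dir_neg, h.D_expand (F.D F.T (F.fS c)),
    h.D_expand (F.D (F.fS c) F.T), inn_sub_left, inn_sum_left, inn_smul_left, inn_sub_left,
    inn_sum_left, inn_smul_left, h.inn_expand (F.D (F.fS c) F.T x) (F.D F.T (F.fS a) x),
    h.inn_expand (F.D F.T F.T x) (F.D (F.fS c) (F.fS a) x), h.inn_D_T_T, h.inn_D_T_T, h.inn_D_T_T_fS, h.inn_D_fS_T,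
    h.inn_D_T_T_fS]
  simp only [h.inn_D_fS_T_fS, h.inn_D_T_T_fS]
  unfold wT w
  simp only [mul_neg, neg_mul, Finset.sum_neg_distrib, neg_neg]
  rw [Finset.sum_congr rfl fun m _ => mul_comm (F.kF x c m) (F.inn x (F.D F.T (F.fS a) x) _),
    Finset.sum_congr rfl fun m _ => mul_comm (F.acc x m) _]
  ring

end Good

/-! ### Contraction of tensors with the frame -/

/-- The contraction of a `3`-tensor of the slice with three vectors. -/
def contract₃ (C : Fin 3 → Fin 3 → Fin 3 → ℝ) (U V W : Fin 3 → ℝ) : ℝ :=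
  ∑ l, ∑ i, ∑ j, C l i j * U l * V i * W j

theorem contract₃_rotate (C : Fin 3 → Fin 3 → Fin 3 → ℝ) (U V W : Fin 3 → ℝ) :
    contract₃ C U V W = contract₃ (fun i j l => C l i j) V W U := by
  unfold contract₃
  rw [Finset.sum_comm]
  refine Finset.sum_congr rfl fun i _ => ?_
  rw [Finset.sum_comm]
  exact Finset.sum_congr rfl fun j _ => Finset.sum_congr rfl fun l _ => by ring

theorem contract₃_eq (C : Fin 3 → Fin 3 → Fin 3 → ℝ) (U V W : Fin 3 → ℝ) :
    contract₃ C U V W = ∑ l, (∑ i, ∑ j, C l i j * V i * W j) * U l := by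
  unfold contract₃
  simp only [Finset.sum_mul]
  exact Finset.sum_congr rfl fun _ _ => Finset.sum_congr rfl fun _ _ =>
    Finset.sum_congr rfl fun _ _ => by ring

theorem contract₃_sub₁ (C : Fin 3 → Fin 3 → Fin 3 → ℝ) (U U' V W : Fin 3 → ℝ) :
    contract₃ C (fun l => U l - U' l) V W = contract₃ C U V W - contract₃ C U' V W := by
  simp only [contract₃_eq, mul_sub, Finset.sum_sub_distrib]

theorem contract₃_sum₁ (C : Fin 3 → Fin 3 → Fin 3 → ℝ) (c : Fin 3 → ℝ) (U : Fin 3 → Fin 3 → ℝ)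
    (V W : Fin 3 → ℝ) :
    contract₃ C (fun l => ∑ m, c m * U m l) V W = ∑ m, c m * contract₃ C (U m) V W := by
  simp only [contract₃_eq, Finset.mul_sum]
  rw [Finset.sum_comm]
  exact Finset.sum_congr rfl fun _ _ => Finset.sum_congr rfl fun _ _ => by ring

theorem contract₃_transpose₁ (C : Fin 3 → Fin 3 → Fin 3 → ℝ) (M : Fin 3 → Fin 3 → ℝ)
    (U V W : Fin 3 → ℝ) :
    contract₃ C (fun l => ∑ m, M l m * U m) V W
      = contract₃ (fun l i j => ∑ m, M m l * C m i j) U V W := by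
  rw [contract₃_eq, contract₃_eq, Finset.sum_mul_sum_transpose]
  refine Finset.sum_congr rfl fun l _ => ?_
  congr 1
  simp only [Finset.mul_sum, Finset.sum_mul]
  rw [Finset.sum_comm]
  refine Finset.sum_congr rfl fun i _ => ?_
  rw [Finset.sum_comm]
  exact Finset.sum_congr rfl fun _ _ => Finset.sum_congr rfl fun _ _ => by ring

/-! ### The Gauss equation in the frame -/

namespace Good

theorem w_eq (h : Good F x) (c a m : Fin 3) :
    F.w x c a m = ∑ p, F.f m x p * (∑ q, F.g x q p * dir (F.fS c) (fun y => F.f a y q) x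
      + ∑ i, ∑ j, chl F.G p.succ i.succ j.succ x * F.f c x i * F.f a x j) := by
  unfold w
  rw [inn_D h.metric]
  have h0 : dir (F.fS c) (fun y => F.fS a y 0) x = 0 := by
    simp only [fS, lift, Fin.cons_zero]; exact dir_const 0
  have hs : ∀ q : Fin 3, dir (F.fS c) (fun y => F.fS a y q.succ) x
      = dir (F.fS c) (fun y => F.f a y q) x := fun q => rfl
  simp only [Fin.sum_univ_succ (n := 3), h0, hs, G_succ_succ, mul_zero, zero_add]
  simp [fS, lift]

/-- The definition of the coefficients ⟨𝐃f, f⟩ solved for the derivatives of the components of the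
frame. Completeness of the frame, in the form g⁻¹ = ∑ f ⊗ f, makes this possible. -/
theorem dir_f (h : Good F x) (c a l : Fin 3) :
    dir (F.fS c) (fun y => F.f a y l) x
      = ∑ m, F.w x c a m * F.f m x l - ∑ j, (∑ i, F.slChr x l i j * F.f c x i) * F.f a x j := by
  have hi : ∀ k j, ∑ i, (F.g x)⁻¹ k i * F.g x i j = if k = j then 1 else 0 := fun k j => by
    rw [← Matrix.mul_apply, Matrix.nonsing_inv_mul _ h.g_det, Matrix.one_apply]
  have h1 : ∑ m, F.w x c a m * F.f m x l
      = ∑ p, (F.g x)⁻¹ l p * (∑ q, F.g x q p * dir (F.fS c) (fun y => F.f a y q) x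
      + ∑ i, ∑ j, chl F.G p.succ i.succ j.succ x * F.f c x i * F.f a x j) := by
    simp only [h.w_eq, h.g_inv]
    rw [Finset.sum_congr rfl fun m _ => Finset.sum_mul _ _ _,
      Finset.sum_congr rfl fun m _ => Finset.sum_mul _ _ _, Finset.sum_comm]
    exact Finset.sum_congr rfl fun p _ => Finset.sum_congr rfl fun m _ => by ring
  have h2 : ∑ p, (F.g x)⁻¹ l p * ∑ q, F.g x q p * dir (F.fS c) (fun y => F.f a y q) x
      = dir (F.fS c) (fun y => F.f a y l) x := by
    simp only [Finset.mul_sum]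
    rw [Finset.sum_comm]
    have : ∀ q, ∑ p, (F.g x)⁻¹ l p * (F.g x q p * dir (F.fS c) (fun y => F.f a y q) x)
        = (if l = q then 1 else 0) * dir (F.fS c) (fun y => F.f a y q) x := fun q => by
      rw [← hi, Finset.sum_mul]
      exact Finset.sum_congr rfl fun p _ => by rw [h.g_symm q p]; ring
    simp [this]
  have h3 : ∑ p, (F.g x)⁻¹ l p
        * ∑ i, ∑ j, chl F.G p.succ i.succ j.succ x * F.f c x i * F.f a x j
      = ∑ j, (∑ i, F.slChr x l i j * F.f c x i) * F.f a x j := by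
    unfold slChr
    simp only [Finset.mul_sum, Finset.sum_mul]
    calc _ = ∑ i, ∑ p, ∑ j, (F.g x)⁻¹ l p *
            (chl F.G p.succ i.succ j.succ x * F.f c x i * F.f a x j) := Finset.sum_comm
      _ = ∑ i, ∑ j, ∑ p, (F.g x)⁻¹ l p *
            (chl F.G p.succ i.succ j.succ x * F.f c x i * F.f a x j) :=
          Finset.sum_congr rfl fun _ _ => Finset.sum_comm
      _ = ∑ j, ∑ i, ∑ p, (F.g x)⁻¹ l p *
            (chl F.G p.succ i.succ j.succ x * F.f c x i * F.f a x j) := Finset.sum_comm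
      _ = _ := Finset.sum_congr rfl fun _ _ => Finset.sum_congr rfl fun _ _ =>
          Finset.sum_congr rfl fun _ _ => by ring
  rw [h1]
  simp only [mul_add, Finset.sum_add_distrib]
  rw [h2, h3]
  ring

/-- Tensoriality: by `dir_f` the derivative of each frame vector splits into a frame part, cancelled
by the coefficients `w`, and a coordinate part, which supplies the Christoffel symbols. The second
and third slots are treated by rotating them to the front. -/
theorem sCov3_CF (h : Good F x) (c a d b : Fin 3) :
    F.sCov3 F.CF x c a d b = ∑ k, ∑ l, ∑ i, ∑ j,
      F.covDiff x k l i j * F.f c x k * F.f a x l * F.f d x i * F.f b x j := by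
  let C : Fin 3 → Fin 3 → Fin 3 → ℝ := fun l i j => F.diffTensor l i j x
  let M : Fin 3 → Fin 3 → ℝ := fun l j => ∑ i, F.slChr x l i j * F.f c x i
  have hCF : ∀ a d b, F.CF x a d b = contract₃ C (F.f a x) (F.f d x) (F.f b x) := CF_eq
  have hd : ∀ a, (fun l => dir (F.fS c) (fun y => F.f a y l) x)
      = fun l => ∑ m, F.w x c a m * F.f m x l - ∑ j, M l j * F.f a x j :=
    fun a => funext fun l => h.dir_f c a l
  have hdir : dir (F.fS c) (fun y => F.CF y a d b) x
      = contract₃ (fun l i j => dir (F.fS c) (F.diffTensor l i j) x)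
          (F.f a x) (F.f d x) (F.f b x)
        + contract₃ C (fun l => dir (F.fS c) (fun y => F.f a y l) x) (F.f d x) (F.f b x)
        + contract₃ C (F.f a x) (fun l => dir (F.fS c) (fun y => F.f d y l) x) (F.f b x)
        + contract₃ C (F.f a x) (F.f d x) (fun l => dir (F.fS c) (fun y => F.f b y l) x) := by
    have h1 : ∀ l i j, DifferentiableAt ℝ (fun y => F.diffTensor l i j y * F.f a y l) x :=
      fun l i j => (h.diffTensor_diff l i j).fun_mul (h.f_diff a l)
    have h2 : ∀ l i j, DifferentiableAt ℝ
        (fun y => F.diffTensor l i j y * F.f a y l * F.f d y i) x :=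
      fun l i j => (h1 l i j).fun_mul (h.f_diff d i)
    have h3 : ∀ l i j, DifferentiableAt ℝ
        (fun y => F.diffTensor l i j y * F.f a y l * F.f d y i * F.f b y j) x :=
      fun l i j => (h2 l i j).fun_mul (h.f_diff b j)
    simp only [CF_eq]
    rw [dir_sum fun l _ => .fun_sum fun i _ => .fun_sum fun j _ => h3 l i j]
    unfold contract₃
    simp only [← Finset.sum_add_distrib]
    refine Finset.sum_congr rfl fun l _ => ?_
    rw [dir_sum fun i _ => .fun_sum fun j _ => h3 l i j]
    refine Finset.sum_congr rfl fun i _ => ?_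
    rw [dir_sum fun j _ => h3 l i j]
    refine Finset.sum_congr rfl fun j _ => ?_
    rw [dir_mul (h2 l i j) (h.f_diff b j), dir_mul (h1 l i j) (h.f_diff d i),
      dir_mul (h.diffTensor_diff l i j) (h.f_diff a l)]
    simp only [C]
    ring
  have hcov : ∑ k, ∑ l, ∑ i, ∑ j,
        F.covDiff x k l i j * F.f c x k * F.f a x l * F.f d x i * F.f b x j
      = contract₃ (fun l i j => ∑ k, F.covDiff x k l i j * F.f c x k)
          (F.f a x) (F.f d x) (F.f b x) := by
    unfold contract₃
    simp only [Finset.sum_mul]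
    rw [Finset.sum_comm]
    refine Finset.sum_congr rfl fun l _ => ?_
    rw [Finset.sum_comm]
    exact Finset.sum_congr rfl fun i _ => Finset.sum_comm
  have hK : ∀ l i j, ∑ k, F.covDiff x k l i j * F.f c x k
      = dir (F.fS c) (F.diffTensor l i j) x - (∑ m, M m l * C m i j)
        - (∑ m, M m i * C l m j) - ∑ m, M m j * C l i m := fun l i j => by
    have e1 : ∀ (s : Fin 3 → Fin 3 → ℝ) (p : Fin 3 → ℝ),
        ∑ k, (∑ m, s m k * p m) * F.f c x k = ∑ m, (∑ k, s m k * F.f c x k) * p m := by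
      intro s p
      simp only [Finset.sum_mul]
      rw [Finset.sum_comm]
      exact Finset.sum_congr rfl fun _ _ => Finset.sum_congr rfl fun _ _ => by ring
    simp only [covDiff, sub_mul, Finset.sum_sub_distrib]
    rw [e1 (fun m k => F.slChr x m k l) fun m => F.diffTensor m i j x,
      e1 (fun m k => F.slChr x m k i) fun m => F.diffTensor l m j x,
      e1 (fun m k => F.slChr x m k j) fun m => F.diffTensor l i m x, fS, dir_lift]
    congr 3
    exact Finset.sum_congr rfl fun _ _ => mul_comm _ _
  have hsplit : ∀ A B C' D' : Fin 3 → Fin 3 → Fin 3 → ℝ, ∀ U V W,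
      contract₃ (fun l i j => A l i j - B l i j - C' l i j - D' l i j) U V W
        = contract₃ A U V W - contract₃ B U V W - contract₃ C' U V W - contract₃ D' U V W := by
    intro A B C' D' U V W
    unfold contract₃
    simp only [sub_mul, Finset.sum_sub_distrib]
  rw [hcov]
  simp only [hK]
  rw [hsplit]
  unfold sCov3
  rw [hdir]
  simp only [hCF]
  have t1 : contract₃ C (fun l => dir (F.fS c) (fun y => F.f a y l) x) (F.f d x) (F.f b x)
      = ∑ m, F.w x c a m * contract₃ C (F.f m x) (F.f d x) (F.f b x)
        - contract₃ (fun l i j => ∑ m, M m l * C m i j) (F.f a x) (F.f d x) (F.f b x) := by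
    rw [hd, contract₃_sub₁, contract₃_sum₁, contract₃_transpose₁]
  have t2 : contract₃ C (F.f a x) (fun l => dir (F.fS c) (fun y => F.f d y l) x) (F.f b x)
      = ∑ m, F.w x c d m * contract₃ C (F.f a x) (F.f m x) (F.f b x)
        - contract₃ (fun l i j => ∑ m, M m i * C l m j) (F.f a x) (F.f d x) (F.f b x) := by
    rw [contract₃_rotate, hd, contract₃_sub₁, contract₃_sum₁, contract₃_transpose₁]
    simp only [contract₃_rotate C (F.f a x), contract₃_rotate (fun l i j => ∑ m, M m i * C l m j)]
  have t3 : contract₃ C (F.f a x) (F.f d x) (fun l => dir (F.fS c) (fun y => F.f b y l) x)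
      = ∑ m, F.w x c b m * contract₃ C (F.f a x) (F.f d x) (F.f m x)
        - contract₃ (fun l i j => ∑ m, M m j * C l i m) (F.f a x) (F.f d x) (F.f b x) := by
    rw [← contract₃_rotate fun j l i => C l i j, hd, contract₃_sub₁, contract₃_sum₁,
      contract₃_transpose₁]
    simp only [← contract₃_rotate fun j l i => C l i j,
      ← contract₃_rotate fun j l i => ∑ m, M m j * C l i m]
  rw [t1, t2, t3]
  ring

theorem contract_quad (h : Good F x) (p q : Fin 3 → ℝ) :
    ∑ m, ∑ n, p m * ((F.g x)⁻¹ m n * q n)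
      = ∑ e, (∑ m, p m * F.f e x m) * ∑ n, q n * F.f e x n := by
  simp only [h.g_inv, Finset.sum_mul_sum]
  simp only [Finset.mul_sum, Finset.sum_mul]
  calc _ = ∑ m, ∑ e, ∑ n, p m * (F.f e x m * F.f e x n * q n) :=
        Finset.sum_congr rfl fun _ _ => Finset.sum_comm
    _ = ∑ e, ∑ m, ∑ n, p m * (F.f e x m * F.f e x n * q n) := Finset.sum_comm
    _ = _ := Finset.sum_congr rfl fun _ _ => Finset.sum_congr rfl fun _ _ =>
        Finset.sum_congr rfl fun _ _ => by ring

/-- The Gauss equation, with the curvature of the slice expressed by that of the background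
metric. -/
theorem gauss (h : Good F x) (a b c d : Fin 3) :
    F.Rm x (F.fS a x) (F.fS b x) (F.fS c x) (F.fS d x)
      = F.hatR x a b c d + F.sCov3 F.CF x c a d b - F.sCov3 F.CF x d a c b
        - (∑ m, F.CF x a c m * F.CF x m d b - ∑ m, F.CF x a d m * F.CF x m c b)
        + F.kF x c a * F.kF x d b - F.kF x d a * F.kF x c b := by
  have h0 : F.Rm x (F.fS a x) (F.fS b x) (F.fS c x) (F.fS d x)
      = ∑ i, ∑ j, ∑ k, ∑ l, riemannDown F.G x i.succ j.succ k.succ l.succ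
        * F.f a x i * F.f b x j * F.f c x k * F.f d x l := by
    simp [Rm, Fin.sum_univ_succ (n := 3), fS, lift]
  have hh : F.hatR x a b c d = ∑ i, ∑ j, ∑ k, ∑ l,
      (∑ p, F.g x i p * riemannUp F.gh (Fin.tail x) p j k l)
        * F.f a x i * F.f b x j * F.f c x k * F.f d x l := by
    unfold hatR
    simp only [Finset.sum_mul]
    refine Finset.sum_congr rfl fun i _ => ?_
    rw [Finset.sum_comm]
    refine Finset.sum_congr rfl fun j _ => ?_
    rw [Finset.sum_comm]
    exact Finset.sum_congr rfl fun k _ => Finset.sum_comm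
  have hk : ∀ a b c d : Fin 3, F.kF x c a * F.kF x d b = ∑ i, ∑ j, ∑ k, ∑ l,
      F.k x k i * F.k x l j * F.f a x i * F.f b x j * F.f c x k * F.f d x l := by
    intro a b c d
    have e1 : F.kF x c a = ∑ i, ∑ k, F.k x k i * F.f c x k * F.f a x i := Finset.sum_comm
    have e2 : F.kF x d b = ∑ j, ∑ l, F.k x l j * F.f d x l * F.f b x j := Finset.sum_comm
    rw [e1, e2, Finset.sum_mul_sum]
    refine Finset.sum_congr rfl fun i _ => Finset.sum_congr rfl fun j _ => ?_
    rw [Finset.sum_mul_sum]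
    exact Finset.sum_congr rfl fun k _ => Finset.sum_congr rfl fun l _ => by ring
  have hswap : ∀ t : Fin 3 → Fin 3 → Fin 3 → Fin 3 → ℝ, ∀ p q r s : Fin 3 → ℝ,
      ∑ i, ∑ j, ∑ k, ∑ l, t i j k l * p i * q j * r k * s l
        = ∑ i, ∑ j, ∑ l, ∑ k, t i j k l * p i * q j * s l * r k := by
    intro t p q r s
    refine Finset.sum_congr rfl fun i _ => Finset.sum_congr rfl fun j _ => ?_
    rw [Finset.sum_comm]
    exact Finset.sum_congr rfl fun k _ => Finset.sum_congr rfl fun l _ => by ring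
  have hcov : ∀ c d : Fin 3, F.sCov3 F.CF x c a d b = ∑ i, ∑ j, ∑ k, ∑ l,
      F.covDiff x k i l j * F.f a x i * F.f b x j * F.f c x k * F.f d x l := by
    intro c d
    rw [h.sCov3_CF]
    calc _ = ∑ i, ∑ k, ∑ l, ∑ j,
          F.covDiff x k i l j * F.f c x k * F.f a x i * F.f d x l * F.f b x j := Finset.sum_comm
      _ = ∑ i, ∑ k, ∑ j, ∑ l,
          F.covDiff x k i l j * F.f c x k * F.f a x i * F.f d x l * F.f b x j :=
          Finset.sum_congr rfl fun _ _ => Finset.sum_congr rfl fun _ _ => Finset.sum_comm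
      _ = ∑ i, ∑ j, ∑ k, ∑ l,
          F.covDiff x k i l j * F.f c x k * F.f a x i * F.f d x l * F.f b x j :=
          Finset.sum_congr rfl fun _ _ => Finset.sum_comm
      _ = _ := Finset.sum_congr rfl fun _ _ => Finset.sum_congr rfl fun _ _ =>
          Finset.sum_congr rfl fun _ _ => Finset.sum_congr rfl fun _ _ => by ring
  have hquad : ∀ c d : Fin 3, ∑ m, F.CF x a c m * F.CF x m d b = ∑ i, ∑ j, ∑ k, ∑ l,
      (∑ m, ∑ n, F.diffTensor i k m x * ((F.g x)⁻¹ m n * F.diffTensor n l j x))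
        * F.f a x i * F.f b x j * F.f c x k * F.f d x l := by
    intro c d
    have e1 : ∀ m, F.CF x a c m
        = ∑ n, (∑ i, ∑ k, F.diffTensor i k n x * F.f a x i * F.f c x k) * F.f m x n := fun m => by
      rw [CF_eq]
      simp only [Finset.sum_mul]
      calc _ = ∑ l, ∑ j, ∑ i, F.diffTensor l i j x * F.f a x l * F.f c x i * F.f m x j :=
            Finset.sum_congr rfl fun _ _ => Finset.sum_comm
        _ = _ := Finset.sum_comm
    have e2 : ∀ m, F.CF x m d b
        = ∑ n, (∑ l, ∑ j, F.diffTensor n l j x * F.f d x l * F.f b x j) * F.f m x n := fun m => by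
      rw [CF_eq]
      simp only [Finset.sum_mul]
      exact Finset.sum_congr rfl fun _ _ => Finset.sum_congr rfl fun _ _ =>
        Finset.sum_congr rfl fun _ _ => by ring
    simp only [e1, e2]
    -- The sum over the frame index is the contraction with g⁻¹ that occurs in the coordinate
    -- formula.
    rw [← h.contract_quad]
    have e3 : ∀ m n, (∑ i, ∑ k, F.diffTensor i k m x * F.f a x i * F.f c x k)
          * ((F.g x)⁻¹ m n * ∑ l, ∑ j, F.diffTensor n l j x * F.f d x l * F.f b x j)
        = ∑ i, ∑ j, ∑ k, ∑ l, F.diffTensor i k m x * ((F.g x)⁻¹ m n * F.diffTensor n l j x)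
          * F.f a x i * F.f b x j * F.f c x k * F.f d x l := fun m n => by
      rw [Finset.sum_comm (f := fun l j => F.diffTensor n l j x * F.f d x l * F.f b x j),
        Finset.mul_sum, Finset.sum_mul_sum]
      refine Finset.sum_congr rfl fun i _ => Finset.sum_congr rfl fun j _ => ?_
      rw [Finset.mul_sum, Finset.sum_mul_sum]
      exact Finset.sum_congr rfl fun k _ => Finset.sum_congr rfl fun l _ => by ring
    have e4 : ∀ f : Fin 3 → Fin 3 → Fin 3 → Fin 3 → Fin 3 → ℝ,
        ∑ m, ∑ i, ∑ j, ∑ k, ∑ l, f m i j k l = ∑ i, ∑ j, ∑ k, ∑ l, ∑ m, f m i j k l := by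
      intro f
      rw [Finset.sum_comm]
      refine Finset.sum_congr rfl fun i _ => ?_
      rw [Finset.sum_comm]
      refine Finset.sum_congr rfl fun j _ => ?_
      rw [Finset.sum_comm]
      exact Finset.sum_congr rfl fun k _ => Finset.sum_comm
    simp only [e3, Finset.sum_mul]
    rw [Finset.sum_congr rfl fun m _ => e4 _, e4]
  rw [h0]
  simp only [h.riemannDown_succ]
  rw [hh, hcov c d, (hcov d c).trans (hswap (fun i j k l => F.covDiff x k i l j) _ _ _ _),
    hquad c d, (hquad d c).trans (hswap (fun i j k l => ∑ m, ∑ n, F.diffTensor i k m x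
      * ((F.g x)⁻¹ m n * F.diffTensor n l j x)) _ _ _ _), hk a b c d,
    (hk a b d c).trans (hswap (fun i j k l => F.k x k i * F.k x l j) _ _ _ _)]
  simp only [← Finset.sum_add_distrib, ← Finset.sum_sub_distrib]
  exact Finset.sum_congr rfl fun i _ => Finset.sum_congr rfl fun j _ =>
    Finset.sum_congr rfl fun k _ => Finset.sum_congr rfl fun l _ => by
      simp only [Finset.sum_sub_distrib]; ring

end Good

end LocalFrame

end

noncomputable section

/-! ### The space-time volume form -/

theorem eps4_row (a b c d : Fin 4) : eps4 a b c d = Matrix.det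
   !![(if a = 0 then (1:ℝ) else 0), if a = 1 then 1 else 0, if a = 2 then 1 else 0, if a = 3 then 1 else 0;
    if b = 0 then 1 else 0, if b = 1 then 1 else 0, if b = 2 then 1 else 0, if b = 3 then 1 else 0;
    if c = 0 then 1 else 0, if c = 1 then 1 else 0, if c = 2 then 1 else 0, if c = 3 then 1 else 0;
    if d = 0 then 1 else 0, if d = 1 then 1 else 0, if d = 2 then 1 else 0, if d = 3 then 1 else 0] := by
  unfold eps4
  congr 1
  ext i j
  fin_cases i <;> fin_cases j <;> rfl

theorem eps4_zero_one (c d : Fin 4) : eps4 0 1 c d =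
    (if c = 2 then 1 else 0) * (if d = 3 then 1 else 0)
      - (if c = 3 then 1 else 0) * (if d = 2 then 1 else 0) := by
  rw [eps4_row, Matrix.det_succ_row_zero, Fin.sum_univ_four]
  simp [Matrix.det_fin_three, Fin.succAbove]

theorem eps4_one_zero (c d : Fin 4) : eps4 1 0 c d =
    (if c = 3 then 1 else 0) * (if d = 2 then 1 else 0) - (if c = 2 then 1 else 0) * (if d = 3 then 1 else 0) := by
  rw [eps4_row, Matrix.det_succ_row_zero, Fin.sum_univ_four]
  simp [Matrix.det_fin_three, Fin.succAbove]

theorem eps4_self (a c d : Fin 4) : eps4 a a c d = 0 := by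
  unfold eps4
  exact Matrix.det_zero_of_row_eq (i := 0) (j := 1) (by decide) (by funext j; rfl)

namespace LocalFrame

open LocalMetric Filter Topology

variable {F : LocalFrame} {x : Coord}

/-! ### Optical relations -/

theorem L_eq : F.L = F.T + F.NS := rfl

namespace Good

/-- L is metrically dual to −b du. The spatial components come from the definition of N, and the
time component from b⁻¹ = T(u). -/
theorem L_low (h : Good F x) (f : Fin 4) :
    ∑ a, F.G x f a * F.L x a = -F.b x * pd f F.u x := by
  have hs : ∀ i : Fin 3, ∑ a, F.G x i.succ a * F.NS x a = -F.b x * pd i.succ F.u x := fun i => by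
    rw [← h.g_mul_N, Fin.sum_univ_succ]
    simp [NS, lift, G_succ_succ]
  have hL : ∀ f, ∑ a, F.G x f a * F.L x a
      = -F.n x * (if f = 0 then 1 else 0) + ∑ a, F.G x f a * F.NS x a := fun f => by
    rw [← h.T_low, ← Finset.sum_add_distrib]
    exact Finset.sum_congr rfl fun a _ => by simp [L]; ring
  rw [hL]
  refine Fin.cases ?_ (fun i => ?_) f
  · have h1 : ∑ a, F.G x 0 a * F.NS x a = -F.b x * ∑ i : Fin 3, F.Y x i * pd i.succ F.u x := by
      rw [Fin.sum_univ_succ]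
      simp only [NS, lift, Fin.cons_zero, Fin.cons_succ, mul_zero, zero_add, G_zero_succ,
        Finset.mul_sum, Finset.sum_mul]
      rw [Finset.sum_comm]
      refine Finset.sum_congr rfl fun i _ => ?_
      have : ∑ j, F.g x i j * F.Y x i * F.N x j = F.Y x i * ∑ j, F.g x i j * F.N x j := by
        rw [Finset.mul_sum]; exact Finset.sum_congr rfl fun j _ => by ring
      rw [this, h.g_mul_N]; ring
    have h2 : (F.b x)⁻¹ = (F.n x)⁻¹ * pd 0 F.u x
        - (F.n x)⁻¹ * ∑ i : Fin 3, F.Y x i * pd i.succ F.u x := by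
      rw [b, inv_inv, dir, Fin.sum_univ_succ, T_zero, Finset.mul_sum, sub_eq_add_neg,
        ← Finset.sum_neg_distrib]
      congr 1
      exact Finset.sum_congr rfl fun i _ => by rw [T_succ]; ring
    have hb := h.b_pos.ne'
    have hn := h.n_ne
    rw [h1]
    field_simp at h2
    simp only [if_true]
    linear_combination -h2
  · rw [hs]; simp [Fin.succ_ne_zero]

theorem D_L (h : Good F x) (X : Coord → Fin 4 → ℝ) :
    F.D X F.L x = F.D X F.T x + F.D X F.NS x :=
  D_add_right h.T_diff (h.fS_diff 0)

/-- The exterior derivative of L♭ = −b du is −db ∧ du. It determines the connection coefficients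
that mix N with the tangent vectors of S. -/
theorem inn_D_L_sub_swap (h : Good F x) (X Y : Coord → Fin 4 → ℝ) :
    F.inn x (F.D X F.L x) (Y x) - F.inn x (F.D Y F.L x) (X x)
      = -(dir X F.b x * dir Y F.u x) + dir Y F.b x * dir X F.u x :=
  inn_D_sub_swap h.metric (fun a => (h.T_diff a).add (h.fS_diff 0 a)) h.b_differentiableAt
    h.u_smooth (h.eventually.mono fun _ hy => hy.L_low) X Y

theorem w_self (h : Good F x) (a c : Fin 3) : F.w x a c c = 0 := by
  have := h.w_antisymm a c c; linarith

theorem sLogb_eq (h : Good F x) (A : Fin 2) :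
    F.sLogb x A = (F.b x)⁻¹ * dir (F.eS A) F.b x := h.dir_log_b _

/-- Take X = N and Y = e_A in d(L♭): the two contributions of k cancel by symmetry, e_A(u) = 0 and
N(u) = −b⁻¹. -/
theorem w_zero_zero_succ (h : Good F x) (A : Fin 2) : F.w x 0 0 A.succ = -F.sLogb x A := by
  have h1 := h.inn_D_L_sub_swap F.NS (F.eS A)
  rw [h.D_L, h.D_L, inn_add_left, inn_add_left, h.tangent, h.dir_N_u] at h1
  have e1 := h.inn_D_fS_T_fS 0 A.succ
  have e2 := h.inn_D_fS_T_fS A.succ 0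
  have e3 := h.w_self A.succ 0
  have e4 := h.kF_symm 0 A.succ
  rw [h.sLogb_eq]
  simp only [w, fS_zero, fS_succ] at *
  linarith

/-- Take X = T and Y = e_A in d(L♭). Differentiating a frame vector along T could have brought in
the time derivative of the shift; the optical function expresses the mixed coefficient by admissible
quantities instead. -/
theorem wT_zero_succ (h : Good F x) (A : Fin 2) :
    F.wT x 0 A.succ = F.sLogb x A - F.acc x A.succ + F.kF x A.succ 0 := by
  have h1 := h.inn_D_L_sub_swap F.T (F.eS A)
  rw [h.D_L, h.D_L, inn_add_left, inn_add_left, h.tangent, h.inn_D_T_T] at h1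
  have hu : dir F.T F.u x = (F.b x)⁻¹ := by rw [b, inv_inv]
  have e1 := h.inn_D_T_T_fS A.succ
  have e2 := h.inn_D_fS_T (F.fS A.succ) 0
  have e3 := h.inn_D_fS_T_fS A.succ 0
  rw [h.sLogb_eq]
  rw [hu] at h1
  simp only [wT, fS_zero, fS_succ] at *
  linarith

theorem chi_eq (h : Good F x) (A B : Fin 2) :
    F.chi x A B = F.theta x A B - F.kF x A.succ B.succ := by
  unfold chi theta
  rw [h.D_L, inn_add_left]
  have e1 := h.inn_D_fS_T_fS A.succ B.succ
  simp only [fS_succ] at e1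
  linarith

theorem conn_antisymm (h : Good F x) (X : Coord → Fin 4 → ℝ) (A B : Fin 2) :
    F.conn X x A B = -F.conn X x B A := by
  have h1 := dir_inn (X := X) h.metric (h.fS_diff A.succ) (h.fS_diff B.succ)
  have h2 : (fun y => F.inn y (F.fS A.succ y) (F.fS B.succ y)) =ᶠ[𝓝 x]
      fun _ => if A.succ = B.succ then 1 else 0 := h.eventually.mono fun y hy => hy.inn_fS _ _
  rw [dir_congr h2, dir_const, inn_comm h.metric (F.fS A.succ x)] at h1
  simp only [conn, fS_succ] at *
  linarith

theorem conn_L (A B : Fin 2) :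
    F.conn F.L x A B = F.wT x A.succ B.succ + F.w x 0 A.succ B.succ := by
  unfold conn wT w
  rw [L_eq, D_add_left, inn_add_left]
  rfl

/-! ### The components of the second fundamental form -/

theorem trk_eq (h : Good F x) : F.trk x = ∑ a, F.kF x a a := by
  unfold trk kF
  simp only [h.g_inv, Finset.sum_mul]
  calc _ = ∑ i, ∑ a, ∑ j, F.f a x i * F.f a x j * F.k x i j :=
        Finset.sum_congr rfl fun _ _ => Finset.sum_comm
    _ = ∑ a, ∑ i, ∑ j, F.f a x i * F.f a x j * F.k x i j := Finset.sum_comm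
    _ = _ := Finset.sum_congr rfl fun _ _ => Finset.sum_congr rfl fun _ _ =>
        Finset.sum_congr rfl fun _ _ => by ring

theorem khF_eq (h : Good F x) (a c : Fin 3) :
    F.khF x a c = F.kF x a c - (if a = c then 3⁻¹ * F.trk x else 0) := by
  have h1 : F.khF x a c = F.kF x a c
      - 3⁻¹ * F.trk x * ∑ i, ∑ j, F.g x i j * F.f a x i * F.f c x j := by
    unfold khF kF khat
    simp only [Finset.mul_sum, ← Finset.sum_sub_distrib]
    exact Finset.sum_congr rfl fun _ _ => Finset.sum_congr rfl fun _ _ => by ring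
  rw [h1, h.f_orthonormal]
  split_ifs <;> simp

theorem delta_eq (h : Good F x) : F.delta x = F.kF x 0 0 - 3⁻¹ * F.trk x := by
  unfold delta; rw [h.khF_eq]; simp

theorem ep_eq (h : Good F x) (A : Fin 2) : F.ep x A = F.kF x A.succ 0 := by
  unfold ep; rw [h.khF_eq]; simp [Fin.succ_ne_zero]

/-- As the trace of the slice tensor k̂ vanishes, k̂_{AB} has S-trace −δ, so the added δ/2 is
exactly what removes it. The multiple of g subtracted from k does not affect the trace-free part. -/
theorem eh_eq (h : Good F x) (A B : Fin 2) :
    F.eh x A B = hatS (fun A B => F.kF x A.succ B.succ) A B := by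
  unfold eh hatS trS
  rw [h.khF_eq, h.delta_eq]
  have ht := h.trk_eq
  rw [Fin.sum_univ_succ] at ht
  by_cases hAB : A = B
  · subst hAB
    simp only [if_true]
    linarith
  · simp [hAB]

/-! ### The null components of the curvature -/

theorem Rm_self_left (h : Good F x) (V W Z : Fin 4 → ℝ) : F.Rm x V V W Z = 0 := by
  have := Rm_antisymm_left h.metric V V W Z; linarith

theorem Rm_self_right (h : Good F x) (V W Z : Fin 4 → ℝ) : F.Rm x V W Z Z = 0 := by
  have := Rm_antisymm_right h.metric V W Z Z; linarith

theorem Rm_Lb_L (h : Good F x) (V W : Fin 4 → ℝ) :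
    F.Rm x V W (F.Lb x) (F.L x) = 2 * F.Rm x V W (F.T x) (F.NS x) := by
  unfold Lb L
  rw [Rm_add₄ h.metric, Rm_sub₃ h.metric, Rm_sub₃ h.metric, h.Rm_self_right, h.Rm_self_right,
    Rm_antisymm_right h.metric V W (F.NS x)]
  ring

theorem ricci_split (h : Good F x) (V W : Fin 4 → ℝ) :
    F.Rm x (F.NS x) V (F.NS x) W + ∑ B, F.Rm x (F.eS B x) V (F.eS B x) W
      = F.Rm x (F.T x) V (F.T x) W := by
  rw [← h.ricci_frame, Fin.sum_univ_succ]; rfl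

/-- Ric(N, e_A) = 0, where the term R(N, N, ·, ·) drops out. The new last pair of arguments is
tangent to S. -/
theorem Rm_eTTN (h : Good F x) (A : Fin 2) :
    F.Rm x (F.eS A x) (F.T x) (F.T x) (F.NS x)
      = -∑ B, F.Rm x (F.eS B x) (F.NS x) (F.eS B x) (F.eS A x) := by
  have h1 := h.ricci_split (F.NS x) (F.eS A x)
  rw [h.Rm_self_left] at h1
  rw [Rm_pair h.metric, Rm_antisymm_right h.metric]
  linarith

/-- The same trade with Ric(T, e_A) = 0. -/
theorem Rm_eNTN (h : Good F x) (A : Fin 2) :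
    F.Rm x (F.eS A x) (F.NS x) (F.T x) (F.NS x)
      = -∑ B, F.Rm x (F.eS B x) (F.T x) (F.eS B x) (F.eS A x) := by
  have h1 := h.ricci_split (F.T x) (F.eS A x)
  rw [h.Rm_self_left] at h1
  rw [Rm_pair h.metric, Rm_antisymm_right h.metric, Rm_antisymm_left h.metric]
  linarith

theorem beta_eq (h : Good F x) (A : Fin 2) :
    F.beta x A = -∑ B, F.Rm x (F.eS B x) (F.NS x) (F.eS B x) (F.eS A x)
      - ∑ B, F.Rm x (F.eS B x) (F.T x) (F.eS B x) (F.eS A x) := by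
  unfold beta
  rw [h.Rm_Lb_L, L, Rm_add₂ h.metric, h.Rm_eTTN, h.Rm_eNTN]
  ring

theorem betab_eq (h : Good F x) (A : Fin 2) :
    F.betab x A = -∑ B, F.Rm x (F.eS B x) (F.NS x) (F.eS B x) (F.eS A x)
      + ∑ B, F.Rm x (F.eS B x) (F.T x) (F.eS B x) (F.eS A x) := by
  unfold betab
  rw [h.Rm_Lb_L, Lb, Rm_sub₂ h.metric, h.Rm_eTTN, h.Rm_eNTN]
  ring

/-- Summing Ric(e_C, e_C) = 0 over C and eliminating the sums of mixed sectional terms by Ric(N, N)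
= 0 and Ric(T, T) = 0 leaves R(T, N, T, N) and the sectional term of S. -/
theorem Rm_TNTN (h : Good F x) :
    F.Rm x (F.T x) (F.NS x) (F.T x) (F.NS x)
      = -2⁻¹ * ∑ A, ∑ B, F.Rm x (F.eS A x) (F.eS B x) (F.eS A x) (F.eS B x) := by
  have h1 := h.ricci_split (F.NS x) (F.NS x)
  have h2 := h.ricci_split (F.T x) (F.T x)
  have h3 := fun C => h.ricci_split (F.eS C x) (F.eS C x)
  have e1 : ∀ V W : Fin 4 → ℝ, F.Rm x V W V W = F.Rm x W V W V := fun V W => by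
    rw [Rm_antisymm_left h.metric, Rm_antisymm_right h.metric]; ring
  have h4 := h3 0
  have h5 := h3 1
  simp only [h.Rm_self_left, Fin.sum_univ_two] at *
  rw [e1 (F.NS x) (F.T x), e1 (F.eS 0 x) (F.T x), e1 (F.eS 1 x) (F.T x)] at h2
  rw [e1 (F.eS 0 x) (F.NS x), e1 (F.eS 1 x) (F.NS x)] at h1
  linarith

theorem sum_Rm_TeTe (h : Good F x) :
    ∑ A, F.Rm x (F.T x) (F.eS A x) (F.T x) (F.eS A x)
      = -F.Rm x (F.T x) (F.NS x) (F.T x) (F.NS x) := by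
  have h2 := h.ricci_split (F.T x) (F.T x)
  have e1 : ∀ V W : Fin 4 → ℝ, F.Rm x V W V W = F.Rm x W V W V := fun V W => by
    rw [Rm_antisymm_left h.metric, Rm_antisymm_right h.metric]; ring
  simp only [h.Rm_self_left] at h2
  rw [e1 (F.NS x) (F.T x)] at h2
  simp only [e1 (F.T x) (F.eS _ x)]
  linarith

theorem rho_eq (h : Good F x) :
    F.rho x = -2⁻¹ * ∑ A, ∑ B, F.Rm x (F.eS A x) (F.eS B x) (F.eS A x) (F.eS B x) := by
  unfold rho
  rw [← h.Rm_TNTN, h.Rm_Lb_L, Rm_pair h.metric, h.Rm_Lb_L]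
  ring

/-- In two dimensions the antisymmetries leave a single component, so this contraction is pure
trace. -/
theorem Rm_ee (h : Good F x) (A B : Fin 2) :
    ∑ C, F.Rm x (F.eS C x) (F.eS A x) (F.eS C x) (F.eS B x)
      = if A = B then -F.Rm x (F.T x) (F.NS x) (F.T x) (F.NS x) else 0 := by
  have e1 : F.Rm x (F.eS 1 x) (F.eS 0 x) (F.eS 1 x) (F.eS 0 x)
      = F.Rm x (F.eS 0 x) (F.eS 1 x) (F.eS 0 x) (F.eS 1 x) := by
    rw [Rm_antisymm_left h.metric, Rm_antisymm_right h.metric]; ring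
  have h1 := h.Rm_TNTN
  simp only [Fin.sum_univ_two, h.Rm_self_left] at *
  fin_cases A <;> fin_cases B <;> simp [h.Rm_self_left, h.Rm_self_right] <;> linarith

/-- Ric(e_A, e_B) = 0 replaces R(N, e_A, N, e_B) by R(T, e_A, T, e_B) up to a multiple of δ_{AB}. By
Ric(T, T) = 0 this multiple is the one that makes the sum trace-free, while the mixed terms have no
trace by Ric(T, N) = 0. -/
theorem alpha_eq (h : Good F x) (A B : Fin 2) :
    F.alpha x A B = hatS (fun A B => 2 * F.Rm x (F.T x) (F.eS A x) (F.T x) (F.eS B x)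
      - F.Rm x (F.eS B x) (F.T x) (F.NS x) (F.eS A x)
      - F.Rm x (F.eS A x) (F.T x) (F.NS x) (F.eS B x)) A B := by
  have h1 := h.ricci_split (F.eS A x) (F.eS B x)
  rw [h.Rm_ee] at h1
  have h2 := h.ricci_split (F.T x) (F.NS x)
  rw [h.Rm_self_right, h.Rm_self_left, zero_add] at h2
  have h3 : ∑ C, F.Rm x (F.eS C x) (F.T x) (F.NS x) (F.eS C x) = 0 := by
    rw [← neg_eq_zero, ← h2, ← Finset.sum_neg_distrib]
    exact Finset.sum_congr rfl fun C _ => by rw [Rm_antisymm_right h.metric]; ring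
  have h4 := h.sum_Rm_TeTe
  have e1 : F.Rm x (F.NS x) (F.eS A x) (F.T x) (F.eS B x)
      = -F.Rm x (F.eS B x) (F.T x) (F.NS x) (F.eS A x) := by
    rw [Rm_pair h.metric, Rm_antisymm_left h.metric]
  have e2 : F.Rm x (F.T x) (F.eS A x) (F.NS x) (F.eS B x)
      = -F.Rm x (F.eS A x) (F.T x) (F.NS x) (F.eS B x) := Rm_antisymm_left h.metric _ _ _ _
  unfold alpha L hatS trS
  rw [Rm_add₁, Rm_add₃ h.metric, Rm_add₃ h.metric, e1, e2]
  simp only [Finset.sum_sub_distrib, ← Finset.mul_sum, h3, h4]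
  split_ifs at h1 ⊢ with hAB
  · linarith
  · linarith

theorem compE_L (h : Good F x) : F.compE x (F.L x) = ![1, 1, 0, 0] := by
  funext a
  have h0 := h.inn_T_T
  have h1 := h.inn_T_fS
  have h2 := h.inn_fS_T
  have h3 := h.inn_fS
  have hN := h2 0
  have hN0 := h1 0
  have hNN := h3 0 0
  have hA := fun A : Fin 2 => h1 A.succ
  have hNA := fun A : Fin 2 => h3 0 A.succ
  simp only [fS_zero, fS_succ] at hN hN0 hNN hA hNA
  unfold compE L
  rw [inn_add_left]
  fin_cases a
  · simp [eta, E, h0, hN]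
  · simp [eta, E, hN0, hNN]
  · simp [eta, E, hA, hNA, Fin.ext_iff]
  · simp [eta, E, hA, hNA, Fin.ext_iff]

theorem compE_Lb (h : Good F x) : F.compE x (F.Lb x) = ![1, -1, 0, 0] := by
  funext a
  have h0 := h.inn_T_T
  have h1 := h.inn_T_fS
  have h2 := h.inn_fS_T
  have h3 := h.inn_fS
  have hN := h2 0
  have hN0 := h1 0
  have hNN := h3 0 0
  have hA := fun A : Fin 2 => h1 A.succ
  have hNA := fun A : Fin 2 => h3 0 A.succ
  simp only [fS_zero, fS_succ] at hN hN0 hNN hA hNA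
  unfold compE Lb
  rw [inn_sub_left]
  fin_cases a
  · simp [eta, E, h0, hN]
  · simp [eta, E, hN0, hNN]
  · simp [eta, E, hA, hNA, Fin.ext_iff]
  · simp [eta, E, hA, hNA, Fin.ext_iff]

theorem sigma_eq (h : Good F x) :
    F.sigma x = -F.Rm x (F.NS x) (F.T x) (F.eS 0 x) (F.eS 1 x) := by
  unfold sigma dualRm
  rw [h.compE_L, h.compE_Lb]
  have e1 : F.Rm x (F.eS 1 x) (F.eS 0 x) (F.Lb x) (F.L x)
      = -F.Rm x (F.eS 0 x) (F.eS 1 x) (F.Lb x) (F.L x) := Rm_antisymm_left h.metric _ _ _ _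
  have e2 : F.Rm x (F.T x) (F.NS x) (F.eS 0 x) (F.eS 1 x)
      = -F.Rm x (F.NS x) (F.T x) (F.eS 0 x) (F.eS 1 x) := Rm_antisymm_left h.metric _ _ _ _
  have e3 : F.Rm x (F.eS 0 x) (F.eS 1 x) (F.T x) (F.NS x)
      = F.Rm x (F.T x) (F.NS x) (F.eS 0 x) (F.eS 1 x) := Rm_pair h.metric _ _ _ _
  set Q : Fin 4 → Fin 4 → ℝ := fun d e => F.Rm x (F.E d x) (F.E e x) (F.Lb x) (F.L x) with hQ
  -- L and L̲ have components only along T and N, so only `S 0 1` and `S 1 0` matter, and there the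
  -- volume form leaves the pair e₁, e₂.
  let S : Fin 4 → Fin 4 → ℝ := fun a c => ∑ d, ∑ e, eps4 a c d e * (eta d * eta e * Q d e)
  have hS : ∀ (v w : Fin 4 → ℝ), ∑ a, ∑ c, ∑ d, ∑ e, eps4 a c d e * v a * w c * eta d * eta e
      * F.Rm x (F.E d x) (F.E e x) (F.Lb x) (F.L x) = ∑ a, ∑ c, v a * w c * S a c := by
    intro v w
    refine Finset.sum_congr rfl fun a _ => Finset.sum_congr rfl fun c _ => ?_
    simp only [S, Finset.mul_sum, hQ]
    exact Finset.sum_congr rfl fun d _ => Finset.sum_congr rfl fun e _ => by ring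
  have s0 : ∀ a, S a a = 0 := fun a => by simp [S, eps4_self]
  have t2 : eta 2 = 1 := if_neg (by decide)
  have t3 : eta 3 = 1 := if_neg (by decide)
  have s1 : S 0 1 = Q 2 3 - Q 3 2 := by
    simp [S, eps4_zero_one, sub_mul, t2, t3]
  have s2 : S 1 0 = Q 3 2 - Q 2 3 := by
    simp [S, eps4_one_zero, sub_mul, t2, t3]
  have q1 : Q 2 3 = -2 * F.Rm x (F.NS x) (F.T x) (F.eS 0 x) (F.eS 1 x) := by
    change F.Rm x (F.eS 0 x) (F.eS 1 x) (F.Lb x) (F.L x) = _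
    rw [h.Rm_Lb_L, e3, e2]; ring
  have q2 : Q 3 2 = -Q 2 3 := e1
  rw [hS]
  simp only [Fin.sum_univ_four]
  simp [s0, s1, s2, q2, q1]
  ring

end Good

end LocalFrame

end

noncomputable section

/-! ### The contraction patterns -/

section Patterns

/-- The frame components of the difference tensor in terms of those of `\hat ∇ g`. -/
def koszul (v : Sigma3) (a d b : Fin 3) : ℝ := 2⁻¹ * (v d b a + v b d a - v a d b)

theorem koszul_add (v v' : Sigma3) (a d b : Fin 3) :
    koszul (v + v') a d b = koszul v a d b + koszul v' a d b := by
  simp only [koszul, Pi.add_apply]; ring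

theorem koszul_smul (c : ℝ) (v : Sigma3) (a d b : Fin 3) :
    koszul (c • v) a d b = c * koszul v a d b := by
  simp only [koszul, Pi.smul_apply, smul_eq_mul]; ring

/-- The potential `∑_B C_{BBN} - s ∑_B k_{BB}`. -/
def scalarPattern (s : ℝ) : GKData →ₗ[ℝ] ℝ where
  toFun v := ∑ B : Fin 2, (koszul v.1 B.succ B.succ 0 - s * v.2 B.succ B.succ)
  map_add' v v' := by
    simp only [Fin.sum_univ_two, Prod.fst_add, Prod.snd_add, koszul_add, Pi.add_apply]; ring
  map_smul' c v := by
    simp only [Fin.sum_univ_two, Prod.smul_fst, Prod.smul_snd, koszul_smul, Pi.smul_apply,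
      smul_eq_mul, RingHom.id_apply]; ring

/-- The tensor potential `s k_{AB} - C_{BAN}`. -/
def tensorPattern (s : ℝ) : GKData →ₗ[ℝ] S2 where
  toFun v A B := s * v.2 A.succ B.succ - koszul v.1 B.succ A.succ 0
  map_add' v v' := by
    funext A B
    simp only [Prod.fst_add, Prod.snd_add, koszul_add, Pi.add_apply]; ring
  map_smul' c v := by
    funext A B
    simp only [Prod.smul_fst, Prod.smul_snd, koszul_smul, Pi.smul_apply,
      smul_eq_mul, RingHom.id_apply]; ring

/-- The vector potential `- (1/2) ∑_B (C_{ABB} - C_{BBA})`. -/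
def divPattern : GKData →ₗ[ℝ] S1 where
  toFun v A := -2⁻¹ * ∑ B : Fin 2,
    (koszul v.1 A.succ B.succ B.succ - koszul v.1 B.succ B.succ A.succ)
  map_add' v v' := by
    funext A
    simp only [Fin.sum_univ_two, Prod.fst_add, koszul_add, Pi.add_apply]; ring
  map_smul' c v := by
    funext A
    simp only [Fin.sum_univ_two, Prod.smul_fst, koszul_smul, Pi.smul_apply,
      smul_eq_mul, RingHom.id_apply]; ring

/-- The vector potential `k_{AN}`. -/
def curlPattern : GKData →ₗ[ℝ] S1 where
  toFun v A := v.2 A.succ 0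
  map_add' _ _ := rfl
  map_smul' _ _ := rfl

/-- The trace-free part of `2 ∇̸_B ∇̸_A log n - ∇̸_A ε_B - ∇̸_B ε_A`. -/
def hessPattern : (Fin 2 → SlpData) →ₗ[ℝ] S2 where
  toFun v := LocalFrame.hatS fun A B => 2 * (v B).2.2.2.2.1 A - (v A).2.1 B - (v B).2.1 A
  map_add' v v' := by
    funext A B
    simp only [LocalFrame.hatS, LocalFrame.trS, Fin.sum_univ_two, Prod.fst_add, Prod.snd_add,
      Pi.add_apply]
    split_ifs <;> ring
  map_smul' c v := by
    funext A B
    simp only [LocalFrame.hatS, LocalFrame.trS, Fin.sum_univ_two, Prod.smul_fst, Prod.smul_snd,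
      Pi.smul_apply, smul_eq_mul, RingHom.id_apply]
    split_ifs <;> ring

theorem rot_real (φ v : ℝ) : FrameRotation.rot φ v = v := rfl

theorem rot_fst {V W : Type} [FrameRotation V] [FrameRotation W] (φ : ℝ) (v : V × W) :
    (FrameRotation.rot φ v).1 = FrameRotation.rot φ v.1 := rfl

theorem rot_snd {V W : Type} [FrameRotation V] [FrameRotation W] (φ : ℝ) (v : V × W) :
    (FrameRotation.rot φ v).2 = FrameRotation.rot φ v.2 := rfl

section

variable {V : Type} [AddCommGroup V] [Module ℝ V] [FrameRotation V] (φ : ℝ)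

theorem rot_two_zero (v : Fin 2 → V) : FrameRotation.rot φ v 0
    = Real.cos φ • FrameRotation.rot φ (v 0) + Real.sin φ • FrameRotation.rot φ (v 1) := by
  change ∑ B, rot2 φ 0 B • FrameRotation.rot φ (v B) = _
  simp [rot2, Fin.sum_univ_two]

theorem rot_two_one (v : Fin 2 → V) : FrameRotation.rot φ v 1
    = -Real.sin φ • FrameRotation.rot φ (v 0) + Real.cos φ • FrameRotation.rot φ (v 1) := by
  change ∑ B, rot2 φ 1 B • FrameRotation.rot φ (v B) = _
  simp [rot2, Fin.sum_univ_two]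

theorem rot_three_zero (v : Fin 3 → V) : FrameRotation.rot φ v 0 = FrameRotation.rot φ (v 0) := by
  change ∑ B, rot3 φ 0 B • FrameRotation.rot φ (v B) = _
  simp [rot3, Fin.sum_univ_three]

theorem rot_three_one (v : Fin 3 → V) : FrameRotation.rot φ v 1
    = Real.cos φ • FrameRotation.rot φ (v 1) + Real.sin φ • FrameRotation.rot φ (v 2) := by
  change ∑ B, rot3 φ 1 B • FrameRotation.rot φ (v B) = _
  simp [rot3, Fin.sum_univ_three]

theorem rot_three_two (v : Fin 3 → V) : FrameRotation.rot φ v 2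
    = -Real.sin φ • FrameRotation.rot φ (v 1) + Real.cos φ • FrameRotation.rot φ (v 2) := by
  change ∑ B, rot3 φ 2 B • FrameRotation.rot φ (v B) = _
  simp [rot3, Fin.sum_univ_three]

end

theorem scalarPattern_invariant (s : ℝ) : IsFrameInvariant (scalarPattern s) := by
  intro φ v
  have h := Real.sin_sq_add_cos_sq φ
  simp only [scalarPattern, koszul, LinearMap.coe_mk, AddHom.coe_mk, Fin.sum_univ_two,
    Fin.succ_zero_eq_one, Fin.succ_one_eq_two, rot_fst, rot_snd, rot_three_zero, rot_three_one,
    rot_three_two, rot_real, Pi.add_apply, Pi.smul_apply, smul_eq_mul]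
  -- Both terms are traces over e₁, e₂; the factor in front of sin² + cos² = 1 is the unrotated
  -- potential.
  linear_combination (2⁻¹ * (v.1 1 0 1 + v.1 0 1 1 - v.1 1 1 0) - s * v.2 1 1
    + (2⁻¹ * (v.1 2 0 2 + v.1 0 2 2 - v.1 2 2 0) - s * v.2 2 2)) * h

theorem tensorPattern_invariant (s : ℝ) : IsFrameInvariant (tensorPattern s) := by
  intro φ v
  funext A B
  fin_cases A <;> fin_cases B <;>
  simp only [tensorPattern, koszul, LinearMap.coe_mk, AddHom.coe_mk, Fin.zero_eta, Fin.mk_one,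
    Fin.succ_zero_eq_one, Fin.succ_one_eq_two, rot_fst, rot_snd, rot_three_zero, rot_three_one,
    rot_three_two, rot_two_zero, rot_two_one, rot_real, Pi.add_apply, Pi.smul_apply,
    smul_eq_mul] <;> ring

theorem divPattern_invariant : IsFrameInvariant divPattern := by
  intro φ v
  have h := Real.sin_sq_add_cos_sq φ
  funext A
  -- The summand B = A vanishes identically, so each component has a single surviving index pair.
  have e0 : divPattern v 0 = -2⁻¹ * (koszul v.1 1 2 2 - koszul v.1 2 2 1) := by
    simp [divPattern, Fin.sum_univ_two]
  have e1 : divPattern v 1 = -2⁻¹ * (koszul v.1 2 1 1 - koszul v.1 1 1 2) := by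
    simp [divPattern, Fin.sum_univ_two]
  fin_cases A
  · simp only [Fin.zero_eta, rot_two_zero, rot_real, e0, e1]
    simp only [divPattern, koszul, LinearMap.coe_mk, AddHom.coe_mk, Fin.sum_univ_two,
      Fin.succ_zero_eq_one, Fin.succ_one_eq_two, rot_fst, rot_three_one, rot_three_two,
      rot_real, Pi.add_apply, Pi.smul_apply, smul_eq_mul]
    linear_combination (norm := (simp only [koszul]; ring)) (Real.cos φ * (-2⁻¹ * (koszul v.1 1 2 2 - koszul v.1 2 2 1))
      + Real.sin φ * (-2⁻¹ * (koszul v.1 2 1 1 - koszul v.1 1 1 2))) * h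
  · simp only [Fin.mk_one, rot_two_one, rot_real, e0, e1]
    simp only [divPattern, koszul, LinearMap.coe_mk, AddHom.coe_mk, Fin.sum_univ_two,
      Fin.succ_zero_eq_one, Fin.succ_one_eq_two, rot_fst, rot_three_one, rot_three_two,
      rot_real, Pi.add_apply, Pi.smul_apply, smul_eq_mul]
    linear_combination (norm := (simp only [koszul]; ring)) (-Real.sin φ * (-2⁻¹ * (koszul v.1 1 2 2 - koszul v.1 2 2 1))
      + Real.cos φ * (-2⁻¹ * (koszul v.1 2 1 1 - koszul v.1 1 1 2))) * h

theorem curlPattern_invariant : IsFrameInvariant curlPattern := by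
  intro φ v
  funext A
  fin_cases A <;>
  simp only [curlPattern, LinearMap.coe_mk, AddHom.coe_mk, Fin.zero_eta, Fin.mk_one,
    Fin.succ_zero_eq_one, Fin.succ_one_eq_two, rot_snd, rot_three_zero, rot_three_one,
    rot_three_two, rot_two_zero, rot_two_one, rot_real, Pi.add_apply, Pi.smul_apply]

theorem hessPattern_invariant : IsFrameInvariant hessPattern := by
  intro φ v
  funext A B
  fin_cases A <;> fin_cases B <;>
  simp only [hessPattern, LinearMap.coe_mk, AddHom.coe_mk, LocalFrame.hatS, LocalFrame.trS,
    Fin.sum_univ_two, Fin.zero_eta, Fin.mk_one, rot_fst, rot_snd, rot_two_zero, rot_two_one,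
    rot_real, Prod.fst_add, Prod.snd_add, Prod.smul_fst, Prod.smul_snd, Pi.add_apply,
    Pi.smul_apply, smul_eq_mul, reduceIte, zero_ne_one, one_ne_zero] <;> ring

theorem zero_invariant : IsFrameInvariant (0 : GKData →ₗ[ℝ] S2) := by
  intro φ v
  funext A B
  fin_cases A <;> fin_cases B <;> simp [rot_two_zero, rot_two_one, rot_real]

end Patterns

end

noncomputable section

namespace LocalFrame

open LocalMetric Filter Topology
open scoped TensorProduct

/-! ### Universal linear and bilinear expressions -/

section Universal

variable {V : Type*} [AddCommGroup V] [Module ℝ V] {d : LocalFrame → Coord → V}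
  {e e' : LocalFrame → Coord → ℝ}

/-- The scalar `e` is a universal linear expression, with constant coefficients, in the data `d`. -/
def LinIn (d : LocalFrame → Coord → V) (e : LocalFrame → Coord → ℝ) : Prop :=
  ∃ ℓ : V →ₗ[ℝ] ℝ, ∀ F x, Good F x → e F x = ℓ (d F x)

namespace LinIn

theorem congr (he : LinIn d e') (h : ∀ F x, Good F x → e F x = e' F x) : LinIn d e := by
  obtain ⟨ℓ, hℓ⟩ := he
  exact ⟨ℓ, fun F x hF => by rw [h F x hF, hℓ F x hF]⟩

theorem zero : LinIn d fun _ _ => 0 := ⟨0, fun _ _ _ => rfl⟩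

theorem add (he : LinIn d e) (he' : LinIn d e') : LinIn d fun F x => e F x + e' F x := by
  obtain ⟨ℓ, hℓ⟩ := he
  obtain ⟨ℓ', hℓ'⟩ := he'
  exact ⟨ℓ + ℓ', fun F x hF => by beta_reduce; rw [hℓ F x hF, hℓ' F x hF]; rfl⟩

theorem neg (he : LinIn d e) : LinIn d fun F x => -e F x := by
  obtain ⟨ℓ, hℓ⟩ := he
  exact ⟨-ℓ, fun F x hF => by beta_reduce; rw [hℓ F x hF]; rfl⟩

theorem sub (he : LinIn d e) (he' : LinIn d e') : LinIn d fun F x => e F x - e' F x := by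
  simpa only [sub_eq_add_neg] using he.add he'.neg

theorem const_mul (c : ℝ) (he : LinIn d e) : LinIn d fun F x => c * e F x := by
  obtain ⟨ℓ, hℓ⟩ := he
  exact ⟨c • ℓ, fun F x hF => by beta_reduce; rw [hℓ F x hF]; rfl⟩

theorem ite (p : Prop) [Decidable p] (he : LinIn d e) :
    LinIn d fun F x => if p then e F x else 0 := by
  split_ifs
  · exact he
  · exact zero

theorem sum {ι : Type*} {s : Finset ι} {e : ι → LocalFrame → Coord → ℝ}
    (he : ∀ i, LinIn d (e i)) : LinIn d fun F x => ∑ i ∈ s, e i F x := by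
  classical
  induction s using Finset.induction_on with
  | empty => simpa using zero
  | insert i s hi ih => simpa only [Finset.sum_insert hi] using (he i).add ih

theorem comp {W : Type*} [AddCommGroup W] [Module ℝ W] {d' : LocalFrame → Coord → W}
    (he : LinIn d e) (T : W →ₗ[ℝ] V) (h : ∀ F x, d F x = T (d' F x)) : LinIn d' e := by
  obtain ⟨ℓ, hℓ⟩ := he
  exact ⟨ℓ ∘ₗ T, fun F x hF => by rw [hℓ F x hF, h]; rfl⟩

end LinIn

/-- The data of an error term. -/
def errData (F : LocalFrame) (x : Coord) : FactorData ⊗[ℝ] PiData := F.factor x ⊗ₜ F.ckpi x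

/-- The data of an error term together with the background curvature. -/
def errHatData (F : LocalFrame) (x : Coord) : (FactorData ⊗[ℝ] PiData) × HatData :=
  (errData F x, F.hatR x)

theorem LinIn.factor_of_ckpi (he : LinIn ckpi e) : LinIn factor e :=
  he.comp (LinearMap.fst ℝ _ _) fun _ _ => rfl

/-- A bilinear expression is a linear functional on the tensor product; products of linear
expressions thus stay inside the calculus of `LinIn`. -/
theorem LinIn.mul (he : LinIn factor e) (he' : LinIn ckpi e') :
    LinIn errData fun F x => e F x * e' F x := by
  obtain ⟨ℓ, hℓ⟩ := he
  obtain ⟨ℓ', hℓ'⟩ := he'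
  exact ⟨LinearMap.mul' ℝ ℝ ∘ₗ TensorProduct.map ℓ ℓ', fun F x hF => by
    beta_reduce; rw [hℓ F x hF, hℓ' F x hF]; simp [errData]⟩

theorem LinIn.mul_ckpi (he : LinIn ckpi e) (he' : LinIn ckpi e') :
    LinIn errData fun F x => e F x * e' F x := he.factor_of_ckpi.mul he'

theorem LinIn.errHat (he : LinIn errData e) : LinIn errHatData e :=
  he.comp (LinearMap.fst ℝ _ _) fun _ _ => rfl

end Universal

/-! #### The basic quantities -/

theorem linIn_eh (A B : Fin 2) : LinIn ckpi fun F x => F.eh x A B :=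
  ⟨LinearMap.proj B ∘ₗ LinearMap.proj A ∘ₗ LinearMap.fst ℝ S2 _ ∘ₗ LinearMap.fst ℝ _ _,
    fun _ _ _ => rfl⟩

theorem linIn_ep (A : Fin 2) : LinIn ckpi fun F x => F.ep x A :=
  ⟨LinearMap.proj A ∘ₗ LinearMap.fst ℝ S1 _ ∘ₗ LinearMap.snd ℝ S2 _ ∘ₗ LinearMap.fst ℝ _ _,
    fun _ _ _ => rfl⟩

theorem linIn_delta : LinIn ckpi fun F x => F.delta x :=
  ⟨LinearMap.fst ℝ ℝ _ ∘ₗ LinearMap.snd ℝ S1 _ ∘ₗ LinearMap.snd ℝ S2 _ ∘ₗ LinearMap.fst ℝ _ _,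
    fun _ _ _ => rfl⟩

theorem linIn_trk : LinIn ckpi fun F x => F.trk x :=
  ⟨LinearMap.snd ℝ S1 ℝ ∘ₗ LinearMap.snd ℝ ℝ _ ∘ₗ LinearMap.snd ℝ ℝ _ ∘ₗ LinearMap.snd ℝ S1 _
    ∘ₗ LinearMap.snd ℝ S2 _ ∘ₗ LinearMap.fst ℝ _ _, fun _ _ _ => rfl⟩

theorem linIn_acc (a : Fin 3) : LinIn ckpi fun F x => F.acc x a := by
  refine Fin.cases ?_ (fun A => ?_) a
  · exact ⟨LinearMap.fst ℝ ℝ _ ∘ₗ LinearMap.snd ℝ ℝ _ ∘ₗ LinearMap.snd ℝ S1 _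
      ∘ₗ LinearMap.snd ℝ S2 _ ∘ₗ LinearMap.fst ℝ _ _, fun _ _ _ => rfl⟩
  · exact ⟨LinearMap.proj A ∘ₗ LinearMap.fst ℝ S1 ℝ ∘ₗ LinearMap.snd ℝ ℝ _ ∘ₗ LinearMap.snd ℝ ℝ _
      ∘ₗ LinearMap.snd ℝ S1 _ ∘ₗ LinearMap.snd ℝ S2 _ ∘ₗ LinearMap.fst ℝ _ _, fun _ _ _ => rfl⟩

theorem linIn_CF (a d b : Fin 3) : LinIn ckpi fun F x => F.CF x a d b := by
  have h : ∀ a c d, LinIn ckpi fun F x => F.DgF x a c d := fun a c d =>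
    ⟨LinearMap.proj d ∘ₗ LinearMap.proj c ∘ₗ LinearMap.proj a ∘ₗ LinearMap.snd ℝ _ Sigma3,
      fun _ _ _ => rfl⟩
  exact (((h d b a).add (h b d a)).sub (h a d b)).const_mul _

/-- All of k is recovered from the listed collection: k_{NN} = δ + ⅓ Tr k, k_{AN} = ε_A, and k_{AB}
= ε̂_{AB} + (⅓ Tr k − ½ δ) δ_{AB}. -/
theorem linIn_kF (a c : Fin 3) : LinIn ckpi fun F x => F.kF x a c := by
  have h0 : ∀ A : Fin 2, LinIn ckpi fun F x => F.kF x A.succ 0 := fun A =>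
    (linIn_ep A).congr fun F x h => (h.ep_eq A).symm
  refine Fin.cases (Fin.cases ?_ (fun B => ?_) c) (fun A => Fin.cases ?_ (fun B => ?_) c) a
  · exact (linIn_delta.add (linIn_trk.const_mul 3⁻¹)).congr fun F x h => by
      rw [h.delta_eq]; ring
  · exact (h0 B).congr fun F x h => h.kF_symm _ _
  · exact h0 A
  · refine ((linIn_eh A B).add (.ite (A = B) ((linIn_trk.const_mul 3⁻¹).sub
      (linIn_delta.const_mul 2⁻¹)))).congr fun F x h => ?_
    unfold eh
    rw [h.khF_eq]
    by_cases hAB : A = B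
    · simp [hAB]
    · simp [hAB]

theorem linIn_hatR (a b c d : Fin 3) : LinIn errHatData fun F x => F.hatR x a b c d :=
  ⟨LinearMap.proj d ∘ₗ LinearMap.proj c ∘ₗ LinearMap.proj b ∘ₗ LinearMap.proj a
    ∘ₗ LinearMap.snd ℝ _ HatData, fun _ _ _ => rfl⟩

theorem linIn_sLogb (A : Fin 2) : LinIn factor fun F x => F.sLogb x A :=
  ⟨LinearMap.proj A ∘ₗ LinearMap.fst ℝ S1 _ ∘ₗ LinearMap.snd ℝ S2 _ ∘ₗ LinearMap.snd ℝ PiData _,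
    fun _ _ _ => rfl⟩

/-- Only θ̂ is among the allowed factors, so the trace comes from θ = χ + k on S: tr θ = tr χ + ∑
k_{CC}. This is where tr χ enters the error terms. -/
theorem linIn_theta (A B : Fin 2) : LinIn factor fun F x => F.theta x A B := by
  have h1 : LinIn factor fun F x => hatS (F.theta x) A B :=
    ⟨LinearMap.proj B ∘ₗ LinearMap.proj A ∘ₗ LinearMap.fst ℝ S2 ℝ ∘ₗ LinearMap.snd ℝ S1 _
      ∘ₗ LinearMap.snd ℝ S2 _ ∘ₗ LinearMap.snd ℝ PiData _, fun _ _ _ => rfl⟩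
  have h2 : LinIn factor fun F x => trS (F.chi x) :=
    ⟨LinearMap.snd ℝ S2 ℝ ∘ₗ LinearMap.snd ℝ S1 _ ∘ₗ LinearMap.snd ℝ S2 _
      ∘ₗ LinearMap.snd ℝ PiData _, fun _ _ _ => rfl⟩
  have h3 : LinIn factor fun F x => ∑ C : Fin 2, F.kF x C.succ C.succ :=
    (LinIn.sum fun C => linIn_kF _ _).factor_of_ckpi
  refine (h1.add (.ite (A = B) ((h2.add h3).const_mul 2⁻¹))).congr fun F x h => ?_
  have h4 : trS (F.theta x) = trS (F.chi x) + ∑ C : Fin 2, F.kF x C.succ C.succ := by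
    unfold trS
    rw [← Finset.sum_add_distrib]
    exact Finset.sum_congr rfl fun C _ => by rw [h.chi_eq]; ring
  rw [← h4, hatS]; ring

theorem linIn_w_zero (c : Fin 3) (A : Fin 2) : LinIn factor fun F x => F.w x c 0 A.succ := by
  refine Fin.cases ?_ (fun C => ?_) c
  · exact (linIn_sLogb A).neg.congr fun _ _ h => h.w_zero_zero_succ A
  · exact linIn_theta C A

theorem linIn_w_succ_zero (c : Fin 3) (A : Fin 2) : LinIn factor fun F x => F.w x c A.succ 0 :=
  (linIn_w_zero c A).neg.congr fun _ _ h => h.w_antisymm _ _ _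

theorem linIn_wT_succ_zero (A : Fin 2) : LinIn factor fun F x => F.wT x A.succ 0 :=
  (((linIn_sLogb A).sub (linIn_acc A.succ).factor_of_ckpi).add
    (linIn_kF A.succ 0).factor_of_ckpi).neg.congr fun F x h => by
      rw [h.wT_antisymm, h.wT_zero_succ]

/-! #### From the connection of the slice to that of the surfaces -/

/-- The tangential coefficients of the slice connection are those of S. The difference consists of
the terms in which N replaces a tangential index, each a mixed coefficient times a component of t.
-/
theorem linIn_sCov2_tan {t : LocalFrame → Coord → Fin 3 → Fin 3 → ℝ}
    (ht : ∀ a b, LinIn ckpi fun F x => t F x a b) (c : Fin 3) (A B : Fin 2) :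
    LinIn errData fun F x => F.sCov2 (t F) x c A.succ B.succ
      - F.cov2 (F.fS c) (fun y A B => t F y A.succ B.succ) x A B := by
  refine (((linIn_w_succ_zero c A).mul (ht 0 B.succ)).add
    ((linIn_w_succ_zero c B).mul (ht A.succ 0))).neg.congr fun F x h => ?_
  have hc : ∀ A B, F.conn (F.fS c) x A B = F.w x c A.succ B.succ := fun _ _ => rfl
  simp only [sCov2, cov2, hc, Fin.sum_univ_succ (n := 2)]
  ring

theorem linIn_sCov2_tan_zero {t : LocalFrame → Coord → Fin 3 → Fin 3 → ℝ}
    (ht : ∀ a b, LinIn ckpi fun F x => t F x a b) (c : Fin 3) (A : Fin 2) :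
    LinIn errData fun F x => F.sCov2 (t F) x c A.succ 0
      - F.cov1 (F.fS c) (fun y A => t F y A.succ 0) x A := by
  refine (((linIn_w_succ_zero c A).mul (ht 0 0)).add
    (LinIn.sum (s := Finset.univ) fun C : Fin 2 =>
      (linIn_w_zero c C).mul (ht A.succ C.succ))).neg.congr fun F x h => ?_
  have hc : ∀ A B, F.conn (F.fS c) x A B = F.w x c A.succ B.succ := fun _ _ => rfl
  simp only [sCov2, cov1, hc, Fin.sum_univ_succ (n := 2), h.w_self]
  ring

theorem linIn_sCov2_zero_tan {t : LocalFrame → Coord → Fin 3 → Fin 3 → ℝ}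
    (ht : ∀ a b, LinIn ckpi fun F x => t F x a b) (c : Fin 3) (A : Fin 2) :
    LinIn errData fun F x => F.sCov2 (t F) x c 0 A.succ
      - F.cov1 (F.fS c) (fun y A => t F y 0 A.succ) x A := by
  refine (((linIn_w_succ_zero c A).mul (ht 0 0)).add
    (LinIn.sum (s := Finset.univ) fun C : Fin 2 =>
      (linIn_w_zero c C).mul (ht C.succ A.succ))).neg.congr fun F x h => ?_
  have hc : ∀ A B, F.conn (F.fS c) x A B = F.w x c A.succ B.succ := fun _ _ => rfl
  simp only [sCov2, cov1, hc, Fin.sum_univ_succ (n := 2), h.w_self]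
  ring

theorem linIn_sCov3_tan_tan_zero {t : LocalFrame → Coord → Fin 3 → Fin 3 → Fin 3 → ℝ}
    (ht : ∀ a b d, LinIn ckpi fun F x => t F x a b d) (c : Fin 3) (A B : Fin 2) :
    LinIn errData fun F x => F.sCov3 (t F) x c A.succ B.succ 0
      - F.cov2 (F.fS c) (fun y A B => t F y A.succ B.succ 0) x A B := by
  refine ((((linIn_w_succ_zero c A).mul (ht 0 B.succ 0)).add
    ((linIn_w_succ_zero c B).mul (ht A.succ 0 0))).add
    (LinIn.sum (s := Finset.univ) fun C : Fin 2 =>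
      (linIn_w_zero c C).mul (ht A.succ B.succ C.succ))).neg.congr fun F x h => ?_
  have hc : ∀ A B, F.conn (F.fS c) x A B = F.w x c A.succ B.succ := fun _ _ => rfl
  simp only [sCov3, cov2, hc, Fin.sum_univ_succ (n := 2), h.w_self]
  ring

/-- Traced over B, the tangential coefficients acting on the two B slots cancel by antisymmetry, so
the trace is differentiated as an S-tangent `1`-tensor up to mixed coefficients. -/
theorem linIn_sCov3_trace_right {t : LocalFrame → Coord → Fin 3 → Fin 3 → Fin 3 → ℝ}
    (ht : ∀ a b d, LinIn ckpi fun F x => t F x a b d)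
    (hd : ∀ F x, Good F x → ∀ a b d, DifferentiableAt ℝ (fun y => t F y a b d) x)
    (c : Fin 3) (A : Fin 2) :
    LinIn errData fun F x => ∑ B : Fin 2, F.sCov3 (t F) x c A.succ B.succ B.succ
      - F.cov1 (F.fS c) (fun y A => ∑ B : Fin 2, t F y A.succ B.succ B.succ) x A := by
  refine (LinIn.sum (s := Finset.univ) fun B : Fin 2 =>
    ((linIn_w_succ_zero c A).mul (ht 0 B.succ B.succ)).add ((linIn_w_succ_zero c B).mul
      ((ht A.succ 0 B.succ).add (ht A.succ B.succ 0)))).neg.congr fun F x h => ?_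
  have hc : ∀ A B, F.conn (F.fS c) x A B = F.w x c A.succ B.succ := fun _ _ => rfl
  have hw := h.w_antisymm c (Fin.succ 0) (Fin.succ 1)
  simp only [sCov3, cov1, hc, Fin.sum_univ_succ (n := 2), Fin.sum_univ_two,
    dir_add (hd F x h _ _ _) (hd F x h _ _ _), h.w_self]
  linear_combination (-(t F x A.succ (Fin.succ 1) (Fin.succ 0))
    - t F x A.succ (Fin.succ 0) (Fin.succ 1)) * hw

theorem linIn_sCov3_trace_left {t : LocalFrame → Coord → Fin 3 → Fin 3 → Fin 3 → ℝ}
    (ht : ∀ a b d, LinIn ckpi fun F x => t F x a b d)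
    (hd : ∀ F x, Good F x → ∀ a b d, DifferentiableAt ℝ (fun y => t F y a b d) x)
    (c : Fin 3) (A : Fin 2) :
    LinIn errData fun F x => ∑ B : Fin 2, F.sCov3 (t F) x c B.succ B.succ A.succ
      - F.cov1 (F.fS c) (fun y A => ∑ B : Fin 2, t F y B.succ B.succ A.succ) x A := by
  refine (LinIn.sum (s := Finset.univ) fun B : Fin 2 =>
    ((linIn_w_succ_zero c A).mul (ht B.succ B.succ 0)).add ((linIn_w_succ_zero c B).mul
      ((ht 0 B.succ A.succ).add (ht B.succ 0 A.succ)))).neg.congr fun F x h => ?_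
  have hc : ∀ A B, F.conn (F.fS c) x A B = F.w x c A.succ B.succ := fun _ _ => rfl
  have hw := h.w_antisymm c (Fin.succ 0) (Fin.succ 1)
  simp only [sCov3, cov1, hc, Fin.sum_univ_succ (n := 2), Fin.sum_univ_two,
    dir_add (hd F x h _ _ _) (hd F x h _ _ _), h.w_self]
  linear_combination (-(t F x (Fin.succ 1) (Fin.succ 0) A.succ)
    - t F x (Fin.succ 0) (Fin.succ 1) A.succ) * hw

/-! ### Linearity of the covariant derivatives of the surfaces -/

section Surface

variable {F : LocalFrame} {x : Coord} {X : Coord → Fin 4 → ℝ}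

theorem cov2_congr {T T' : Coord → S2} (hT : ∀ A B, ∀ᶠ y in 𝓝 x, T y A B = T' y A B)
    (A B : Fin 2) : F.cov2 X T x A B = F.cov2 X T' x A B := by
  unfold cov2
  rw [dir_congr (hT A B)]
  simp only [(hT _ _).self_of_nhds]

theorem cov1_congr {ξ ξ' : Coord → S1} (hξ : ∀ A, ∀ᶠ y in 𝓝 x, ξ y A = ξ' y A)
    (A : Fin 2) : F.cov1 X ξ x A = F.cov1 X ξ' x A := by
  unfold cov1
  rw [dir_congr (hξ A)]
  simp only [(hξ _).self_of_nhds]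

theorem Good.sum_cov2_diag (h : Good F x) (T : Coord → S2) :
    ∑ B, F.cov2 X T x B B = ∑ B, dir X (fun y => T y B B) x := by
  have h0 := h.conn_antisymm X 0 0
  have h1 := h.conn_antisymm X 1 1
  have h2 := h.conn_antisymm X 0 1
  simp only [cov2, Fin.sum_univ_two]
  linear_combination -T x 0 0 * h0 - T x 1 1 * h1 - (T x 1 0 + T x 0 1) * h2

/-- The connection of S is metric: its coefficients are antisymmetric, so taking traces commutes
with ∇̸_X. -/
theorem Good.cov2_hatS (h : Good F x) {T : Coord → S2}
    (hT : ∀ A B, DifferentiableAt ℝ (fun y => T y A B) x) (A B : Fin 2) :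
    F.cov2 X (fun y => hatS (T y)) x A B = hatS (F.cov2 X T x) A B := by
  have h0 : F.conn X x 0 0 = 0 := by have := h.conn_antisymm X 0 0; linarith
  have h1 : F.conn X x 1 1 = 0 := by have := h.conn_antisymm X 1 1; linarith
  have h2 := h.conn_antisymm X 0 1
  have hd : ∀ A B, dir X (fun y => hatS (T y) A B) x
      = hatS (fun A B => dir X (fun y => T y A B) x) A B := fun A B => by
    unfold hatS trS
    by_cases hAB : A = B
    · simp only [hAB, if_true, Fin.sum_univ_two]
      rw [dir_sub (hT _ _) (((hT 0 0).fun_add (hT 1 1)).const_mul _),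
        dir_const_mul _ ((hT 0 0).fun_add (hT 1 1)), dir_add (hT 0 0) (hT 1 1)]
    · simp [hAB]
  simp only [cov2, hd]
  simp only [hatS, trS, Fin.sum_univ_two, cov2]
  fin_cases A <;> fin_cases B <;>
  simp only [Fin.zero_eta, Fin.mk_one, reduceIte, zero_ne_one, one_ne_zero, h0, h1, h2] <;> ring

theorem Good.grad_scalarPattern (h : Good F x) (s : ℝ) (A : Fin 2) :
    F.grad (fun y => scalarPattern s (F.gk y)) x A
      = ∑ B, F.cov2 (F.eS A) (fun y A B => F.CF y A.succ B.succ 0) x B B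
        - s * ∑ B, F.cov2 (F.eS A) (fun y A B => F.kF y A.succ B.succ) x B B := by
  rw [h.sum_cov2_diag, h.sum_cov2_diag]
  change dir (F.eS A) (fun y => ∑ B : Fin 2,
    (F.CF y B.succ B.succ 0 - s * F.kF y B.succ B.succ)) x = _
  rw [dir_sum fun B _ => (h.CF_diff _ _ _).fun_sub ((h.kF_diff _ _).const_mul s), Finset.mul_sum,
    ← Finset.sum_sub_distrib]
  refine Finset.sum_congr rfl fun B _ => ?_
  rw [dir_sub (h.CF_diff _ _ _) ((h.kF_diff _ _).const_mul s), dir_const_mul _ (h.kF_diff _ _)]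

theorem Good.div2_tensorPattern (h : Good F x) (s : ℝ) (A : Fin 2) :
    F.div2 (fun y => tensorPattern s (F.gk y)) x A
      = s * ∑ B, F.cov2 (F.eS B) (fun y A B => F.kF y A.succ B.succ) x A B
        - ∑ B, F.cov2 (F.eS B) (fun y A B => F.CF y A.succ B.succ 0) x B A := by
  have hp : ∀ y A B, tensorPattern s (F.gk y) A B
      = s * F.kF y A.succ B.succ - F.CF y B.succ A.succ 0 := fun _ _ _ => rfl
  unfold div2
  rw [Finset.mul_sum, ← Finset.sum_sub_distrib]
  refine Finset.sum_congr rfl fun B _ => ?_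
  simp only [cov2, hp, dir_sub ((h.kF_diff _ _).const_mul s) (h.CF_diff _ _ _),
    dir_const_mul _ (h.kF_diff _ _), Fin.sum_univ_two]
  ring

theorem Good.div1_divPattern (h : Good F x) :
    F.div1 (fun y => divPattern (F.gk y)) x
      = -2⁻¹ * (∑ A, F.cov1 (F.eS A) (fun y A => ∑ B : Fin 2, F.CF y A.succ B.succ B.succ) x A
        - ∑ A, F.cov1 (F.eS A) (fun y A => ∑ B : Fin 2, F.CF y B.succ B.succ A.succ) x A) := by
  have hp : ∀ y A, divPattern (F.gk y) A = -2⁻¹ * ((∑ B : Fin 2, F.CF y A.succ B.succ B.succ)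
      - ∑ B : Fin 2, F.CF y B.succ B.succ A.succ) := fun y A => by
    rw [← Finset.sum_sub_distrib]; rfl
  have h1 : ∀ A : Fin 2, DifferentiableAt ℝ
      (fun y => ∑ B : Fin 2, F.CF y A.succ B.succ B.succ) x := fun A =>
    .fun_sum fun B _ => h.CF_diff _ _ _
  have h2 : ∀ A : Fin 2, DifferentiableAt ℝ
      (fun y => ∑ B : Fin 2, F.CF y B.succ B.succ A.succ) x := fun A =>
    .fun_sum fun B _ => h.CF_diff _ _ _
  unfold div1
  rw [← Finset.sum_sub_distrib, Finset.mul_sum]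
  refine Finset.sum_congr rfl fun A _ => ?_
  simp only [cov1, hp, dir_const_mul _ ((h1 _).fun_sub (h2 _)), dir_sub (h1 _) (h2 _)]
  rw [Fin.sum_univ_two, Fin.sum_univ_two (fun B => F.conn (F.eS A) x A B * _),
    Fin.sum_univ_two (fun B => F.conn (F.eS A) x A B * _)]
  ring

theorem curl1_curlPattern :
    F.curl1 (fun y => curlPattern (F.gk y)) x
      = F.cov1 (F.fS (Fin.succ 0)) (fun y A => F.kF y A.succ 0) x 1
        - F.cov1 (F.fS (Fin.succ 1)) (fun y A => F.kF y A.succ 0) x 0 := by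
  have hp : (fun y => curlPattern (F.gk y)) = fun y (A : Fin 2) => F.kF y A.succ 0 := rfl
  rw [hp]
  simp only [curl1, Fin.sum_univ_two, eps2, fS_succ]
  simp
  ring

end Surface

/-! ### The null components as derivatives up to error terms -/

/-- The quadratic terms of the Gauss equation. -/
def gaussQuad (F : LocalFrame) (x : Coord) (a b c d : Fin 3) : ℝ :=
  F.kF x c a * F.kF x d b - F.kF x d a * F.kF x c b
    - (∑ m, F.CF x a c m * F.CF x m d b - ∑ m, F.CF x a d m * F.CF x m c b)

theorem linIn_gaussQuad (a b c d : Fin 3) : LinIn errData fun F x => F.gaussQuad x a b c d :=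
  (((linIn_kF c a).mul_ckpi (linIn_kF d b)).sub ((linIn_kF d a).mul_ckpi (linIn_kF c b))).sub
    ((LinIn.sum fun m => (linIn_CF a c m).mul_ckpi (linIn_CF m d b)).sub
      (LinIn.sum fun m => (linIn_CF a d m).mul_ckpi (linIn_CF m c b)))

/-- Covers both components at once: s = 1 is β and s = −1 is β̲. Gauss contributes ∇_A C_{BBN} − ∇_B
C_{BAN} and Codazzi s(∇_B k_{AB} − ∇_A k_{BB}). The terms differentiated along e_A form a gradient,
those along e_B a divergence. -/
theorem linIn_transverse (s : ℝ) (A : Fin 2) : LinIn errHatData fun F x =>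
    -∑ B, F.Rm x (F.eS B x) (F.NS x) (F.eS B x) (F.eS A x)
      - s * ∑ B, F.Rm x (F.eS B x) (F.T x) (F.eS B x) (F.eS A x)
      - (F.grad (fun y => scalarPattern s (F.gk y)) x A
        + F.div2 (fun y => tensorPattern s (F.gk y)) x A) := by
  have h3 := fun c A B => (linIn_sCov3_tan_tan_zero linIn_CF c A B).errHat
  have h2 := fun c A B => (linIn_sCov2_tan linIn_kF c A B).errHat
  refine ((((LinIn.sum (s := Finset.univ) fun B : Fin 2 => (linIn_hatR B.succ 0 B.succ A.succ).add
    (linIn_gaussQuad B.succ 0 B.succ A.succ).errHat).neg.sub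
    (LinIn.sum (s := Finset.univ) fun B : Fin 2 => h3 B.succ B A)).add
    (LinIn.sum (s := Finset.univ) fun B : Fin 2 => h3 A.succ B B)).add
    ((LinIn.sum (s := Finset.univ) fun B : Fin 2 =>
      (h2 B.succ A B).sub (h2 A.succ B B)).const_mul s)).congr fun F x h => ?_
  have hg := fun B : Fin 2 => h.gauss B.succ 0 B.succ A.succ
  have hc := fun B : Fin 2 => h.codazzi B.succ B.succ A.succ
  simp only [fS_succ, fS_zero] at hg hc
  rw [h.grad_scalarPattern, h.div2_tensorPattern]
  simp only [hg, hc, gaussQuad, fS_succ, Finset.sum_add_distrib, Finset.sum_sub_distrib,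
    Finset.sum_neg_distrib]
  ring

theorem linIn_rho : LinIn errHatData fun F x =>
    F.rho x - F.div1 (fun y => divPattern (F.gk y)) x := by
  have hd : ∀ F x, Good F x → ∀ a b d, DifferentiableAt ℝ (fun y => F.CF y a b d) x :=
    fun F x h => h.CF_diff
  have h1 := fun c A => (linIn_sCov3_trace_right linIn_CF hd c A).errHat
  have h2 := fun c A => (linIn_sCov3_trace_left linIn_CF hd c A).errHat
  refine ((((LinIn.sum (s := Finset.univ) fun A : Fin 2 => LinIn.sum (s := Finset.univ)
    fun B : Fin 2 => (linIn_hatR A.succ B.succ A.succ B.succ).add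
    (linIn_gaussQuad A.succ B.succ A.succ B.succ).errHat).add
    (LinIn.sum (s := Finset.univ) fun A : Fin 2 => h1 A.succ A)).sub
    (LinIn.sum (s := Finset.univ) fun A : Fin 2 => h2 A.succ A)).const_mul (-2⁻¹)).congr
    fun F x h => ?_
  have hg := fun A B : Fin 2 => h.gauss A.succ B.succ A.succ B.succ
  simp only [fS_succ] at hg
  -- Interchanging A and B makes the second Gauss term a divergence with the same derivative index
  -- as the first.
  have hs : ∑ A : Fin 2, ∑ B : Fin 2, F.sCov3 F.CF x B.succ A.succ A.succ B.succ
      = ∑ A : Fin 2, ∑ B : Fin 2, F.sCov3 F.CF x A.succ B.succ B.succ A.succ := Finset.sum_comm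
  rw [h.rho_eq, h.div1_divPattern]
  simp only [hg, gaussQuad, fS_succ, Finset.sum_add_distrib, Finset.sum_sub_distrib]
  rw [hs]
  ring

/-- Codazzi for R(N, T, e₁, e₂) is the antisymmetrised tangential derivative of k_{AN}; no Gauss
equation is needed, hence no background curvature. -/
theorem linIn_sigma : LinIn errData fun F x =>
    F.sigma x - F.curl1 (fun y => curlPattern (F.gk y)) x := by
  refine ((linIn_sCov2_tan_zero linIn_kF (Fin.succ 0) 1).sub
    (linIn_sCov2_tan_zero linIn_kF (Fin.succ 1) 0)).congr fun F x h => ?_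
  have hc := h.codazzi 0 (Fin.succ 0) (Fin.succ 1)
  simp only [fS_succ, fS_zero] at hc
  rw [h.sigma_eq, hc, curl1_curlPattern]
  ring

theorem LinIn.hatS {V : Type*} [AddCommGroup V] [Module ℝ V] {d : LocalFrame → Coord → V}
    {T : LocalFrame → Coord → S2} (hT : ∀ A B, LinIn d fun F x => T F x A B) (A B : Fin 2) :
    LinIn d fun F x => LocalFrame.hatS (T F x) A B :=
  (hT A B).sub (.ite (A = B) ((LinIn.sum fun C => hT C C).const_mul 2⁻¹))

/-- Twice the second variation equation carries 2∇_T k and the two Codazzi terms carry 2∇_N k, so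
the transversal derivatives combine along L = T + N. The rest is tangential or quadratic, the
coefficient ⟨𝐃_T e_A, N⟩ being controlled by `wT_zero_succ`. -/
theorem linIn_alpha_aux (A B : Fin 2) : LinIn errData fun F x =>
    (2 * F.Rm x (F.T x) (F.eS A x) (F.T x) (F.eS B x)
      - F.Rm x (F.eS B x) (F.T x) (F.NS x) (F.eS A x)
      - F.Rm x (F.eS A x) (F.T x) (F.NS x) (F.eS B x))
    - (2 * F.cov2 F.L (fun y A B => F.kF y A.succ B.succ) x A B
      + (2 * F.cov1 (F.eS B) F.sLogn x A - F.cov1 (F.eS A) F.ep x B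
        - F.cov1 (F.eS B) F.ep x A)) := by
  have h2 := fun A B => linIn_sCov2_tan linIn_kF 0 A B
  have hz := fun c A => linIn_sCov2_zero_tan linIn_kF c A
  refine (((((((((linIn_acc A.succ).mul_ckpi (linIn_acc B.succ)).sub (LinIn.sum
    (s := Finset.univ) fun m => (linIn_kF B.succ m).mul_ckpi (linIn_kF m A.succ))).sub
    ((linIn_wT_succ_zero B).mul (linIn_kF 0 A.succ))).sub
    ((linIn_wT_succ_zero A).mul (linIn_kF B.succ 0))).sub
    ((linIn_w_succ_zero B.succ A).mul (linIn_acc 0))).const_mul 2).add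
    ((h2 A B).add (h2 B A))).sub ((hz A.succ B).add (hz B.succ A))).congr fun F x h => ?_
  have hsv := h.second_variation A.succ B.succ
  have hc1 := h.codazzi B.succ 0 A.succ
  have hc2 := h.codazzi A.succ 0 B.succ
  simp only [fS_succ, fS_zero] at hsv hc1 hc2
  have hsym : ∀ X A B, F.cov2 X (fun y A B => F.kF y A.succ B.succ) x A B
      = F.cov2 X (fun y A B => F.kF y A.succ B.succ) x B A := fun X A B => by
    have : ∀ A B : Fin 2, dir X (fun y => F.kF y A.succ B.succ) x
        = dir X (fun y => F.kF y B.succ A.succ) x := fun A B =>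
      dir_congr (h.eventually.mono fun y hy => hy.kF_symm _ _)
    simp only [cov2]
    rw [this A B, Finset.sum_congr rfl fun C _ => by rw [h.kF_symm (Fin.succ C) B.succ],
      Finset.sum_congr (f := fun C => F.conn X x B C * F.kF x A.succ (Fin.succ C)) rfl
        fun C _ => by rw [h.kF_symm A.succ (Fin.succ C)]]
    ring
  -- The tangential coefficients ⟨𝐃_T e_A, e_B⟩ depend on the choice of frame and are not error
  -- terms; they must be absorbed into ∇̸_L.
  have hL : F.cov2 F.L (fun y A B => F.kF y A.succ B.succ) x A B
      = (dir F.T (fun y => F.kF y B.succ A.succ) x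
          - ∑ C : Fin 2, F.wT x B.succ C.succ * F.kF x C.succ A.succ
          - ∑ C : Fin 2, F.wT x A.succ C.succ * F.kF x B.succ C.succ)
        + F.cov2 (F.fS 0) (fun y A B => F.kF y A.succ B.succ) x B A := by
    rw [hsym]
    have hcn : ∀ A B, F.conn (F.fS 0) x A B = F.w x 0 A.succ B.succ := fun _ _ => rfl
    have hdir : ∀ f : Coord → ℝ, dir F.L f x = dir F.T f x + dir (F.fS 0) f x := fun f =>
      dir_add_field (X := F.T) F.NS
    simp only [cov2, Good.conn_L, hcn, hdir, add_mul, Finset.sum_add_distrib]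
    ring
  have hep : ∀ X A, F.cov1 X F.ep x A = F.cov1 X (fun y A => F.kF y 0 A.succ) x A := fun X A =>
    cov1_congr (fun A => h.eventually.mono fun y hy => by
      rw [hy.ep_eq, hy.kF_symm]) A
  have hlog : F.cov1 (F.eS B) F.sLogn x A = dir (F.eS B) (fun y => F.acc y A.succ) x
      - ∑ C : Fin 2, F.w x B.succ A.succ C.succ * F.acc x C.succ := rfl
  rw [hsv, hc1, hc2, hL, hep, hep, hlog, hsym (F.fS 0) A B]
  simp only [Fin.sum_univ_succ (n := 2), fS_succ]
  ring

/-- The trace-free part is taken last. It commutes with ∇̸_L and turns k_{AB} into ε̂, so no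
transversal derivative of a trace remains. -/
theorem linIn_alpha (A B : Fin 2) : LinIn errData fun F x =>
    F.alpha x A B - (2 * F.cov2 F.L F.eh x A B + hessPattern (F.gradSlp x) A B) := by
  refine (LinIn.hatS linIn_alpha_aux A B).congr fun F x h => ?_
  have heh : F.cov2 F.L F.eh x A B
      = hatS (F.cov2 F.L (fun y A B => F.kF y A.succ B.succ) x) A B := by
    rw [← h.cov2_hatS (T := fun y A B => F.kF y A.succ B.succ) fun A B => h.kF_diff _ _]
    exact cov2_congr (fun A B => h.eventually.mono fun y hy => hy.eh_eq A B) A B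
  have hZ : hessPattern (F.gradSlp x) A B = hatS (fun A B => 2 * F.cov1 (F.eS B) F.sLogn x A
      - F.cov1 (F.eS A) F.ep x B - F.cov1 (F.eS B) F.ep x A) A B := rfl
  rw [h.alpha_eq, heh, hZ]
  simp only [LocalFrame.hatS, trS, Fin.sum_univ_two]
  split_ifs <;> ring

/-! ### From charts to coordinates -/

theorem isOpen_chartRegion {M : Type*} [TopologicalSpace M]
    [ChartedSpace (EuclideanSpace ℝ (Fin 3)) M] {W : Set (ℝ × M)} (hW : IsOpen W)
    (φ : OpenPartialHomeomorph M (EuclideanSpace ℝ (Fin 3))) : IsOpen (chartRegion W φ) := by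
  have ht : Continuous fun x : Coord => WithLp.toLp 2 (Fin.tail x) :=
    (PiLp.continuous_toLp 2 _).comp (continuous_pi fun i => continuous_apply i.succ)
  have hdom : IsOpen {x : Coord | Fin.tail x ∈ chartDom φ} := φ.open_target.preimage ht
  have hc : ContinuousOn (fun x : Coord => (x 0, chartPt φ (Fin.tail x)))
      {x : Coord | Fin.tail x ∈ chartDom φ} :=
    (continuous_apply 0).continuousOn.prodMk
      (φ.continuousOn_symm.comp ht.continuousOn fun x hx => hx)
  exact hc.isOpen_inter_preimage hdom hW

theorem good_loc {M : Type*} [TopologicalSpace M] [ChartedSpace (EuclideanSpace ℝ (Fin 3)) M]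
    [IsManifold (𝓡 3) ∞ M] {S : CMCSHSpacetime M} (O : CanonicalFrame S)
    {φ : OpenPartialHomeomorph M (EuclideanSpace ℝ (Fin 3))}
    (hφ : φ ∈ IsManifold.maximalAtlas (𝓡 3) ∞ M) {x : Coord} (hx : x ∈ chartRegion O.W φ) :
    Good (O.toFrameData.loc S.toSpacetimeData φ) x :=
  ⟨S.I, chartDom φ, chartRegion O.W φ, φ.open_target.preimage (PiLp.continuous_toLp 2 _),
    isOpen_chartRegion O.W_open φ, hx, fun _ hy => ⟨O.W_subset _ hy.2, hy.1⟩,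
    S.solution φ hφ, O.canonical φ hφ⟩

end LocalFrame

end

/-! ### Assembly of the universal expressions -/

open scoped TensorProduct in
/-- A family of linear functionals on the error data as a vector-valued bilinear map. -/
noncomputable def bilinearOf {ι : Type} (ℓ : ι → FactorData ⊗[ℝ] PiData →ₗ[ℝ] ℝ) :
    FactorData →ₗ[ℝ] PiData →ₗ[ℝ] (ι → ℝ) := TensorProduct.curry (LinearMap.pi ℓ)

theorem proposition6 :
    ∃ (p : GKData →ₗ[ℝ] ℝ) (P P' : GKData →ₗ[ℝ] S2)
      (q : GKData →ₗ[ℝ] ℝ) (Q Q' : GKData →ₗ[ℝ] S2)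
      (V₁ V₂ : GKData →ₗ[ℝ] S1)
      (Z : (Fin 2 → SlpData) →ₗ[ℝ] S2)
      (Eβ Eβb : FactorData →ₗ[ℝ] PiData →ₗ[ℝ] S1)
      (Eρ Eσ : FactorData →ₗ[ℝ] PiData →ₗ[ℝ] ℝ)
      (Eα : FactorData →ₗ[ℝ] PiData →ₗ[ℝ] S2)
      (Hβ Hβb : HatData →ₗ[ℝ] S1) (Hρ : HatData →ₗ[ℝ] ℝ),
      (IsFrameInvariant p ∧ IsFrameInvariant P ∧ IsFrameInvariant P' ∧ IsFrameInvariant q ∧ IsFrameInvariant Q ∧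
        IsFrameInvariant Q' ∧ IsFrameInvariant V₁ ∧ IsFrameInvariant V₂ ∧ IsFrameInvariant Z) ∧
      ∀ (M : Type*) [TopologicalSpace M] [ChartedSpace (EuclideanSpace ℝ (Fin 3)) M]
        [IsManifold (𝓡 3) ∞ M] (S : CMCSHSpacetime M) (O : CanonicalFrame S),
        ∀ φ ∈ IsManifold.maximalAtlas (𝓡 3) ∞ M, ∀ x ∈ chartRegion O.W φ,
        ∀ F : LocalFrame, F = O.toFrameData.loc S.toSpacetimeData φ →
          (∀ A, F.beta x A =
            F.grad (fun y => p (F.gk y)) x A + F.div2 (fun y => P (F.gk y)) x A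
              + F.curl2 (fun y => P' (F.gk y)) x A
              + (Eβ (F.factor x) (F.ckpi x) A + Hβ (F.hatR x) A)) ∧
          (∀ A, F.betab x A =
            F.grad (fun y => q (F.gk y)) x A + F.div2 (fun y => Q (F.gk y)) x A
              + F.curl2 (fun y => Q' (F.gk y)) x A
              + (Eβb (F.factor x) (F.ckpi x) A + Hβb (F.hatR x) A)) ∧
          F.rho x = F.div1 (fun y => V₁ (F.gk y)) x
            + (Eρ (F.factor x) (F.ckpi x) + Hρ (F.hatR x)) ∧
          F.sigma x = F.curl1 (fun y => V₂ (F.gk y)) x + Eσ (F.factor x) (F.ckpi x) ∧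
          (∀ A B, F.alpha x A B =
            2 * F.cov2 F.L F.eh x A B + Z (F.gradSlp x) A B
              + Eα (F.factor x) (F.ckpi x) A B) := by
  classical
  -- The functionals are fixed here, before any manifold, space-time or frame is introduced, which
  -- is the universality claimed.
  choose ℓβ hβ using LocalFrame.linIn_transverse 1
  choose ℓβb hβb using LocalFrame.linIn_transverse (-1)
  obtain ⟨ℓρ, hρ⟩ := LocalFrame.linIn_rho
  obtain ⟨ℓσ, hσ⟩ := LocalFrame.linIn_sigma
  choose ℓα hα using LocalFrame.linIn_alpha
  -- The curl potentials may be taken to be zero: `tensorPattern` is not symmetrised, so its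
  -- divergence already accounts for all the terms differentiated along e_B.
  refine ⟨scalarPattern 1, tensorPattern 1, 0, scalarPattern (-1), tensorPattern (-1), 0,
    divPattern, curlPattern, hessPattern,
    bilinearOf fun A => ℓβ A ∘ₗ LinearMap.inl ℝ _ _,
    bilinearOf fun A => ℓβb A ∘ₗ LinearMap.inl ℝ _ _,
    TensorProduct.curry (ℓρ ∘ₗ LinearMap.inl ℝ _ _), TensorProduct.curry ℓσ,
    TensorProduct.curry (LinearMap.pi fun A => LinearMap.pi fun B => ℓα A B),
    LinearMap.pi fun A => ℓβ A ∘ₗ LinearMap.inr ℝ _ _,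
    LinearMap.pi fun A => ℓβb A ∘ₗ LinearMap.inr ℝ _ _, ℓρ ∘ₗ LinearMap.inr ℝ _ _,
    ⟨scalarPattern_invariant 1, tensorPattern_invariant 1, zero_invariant,
      scalarPattern_invariant (-1), tensorPattern_invariant (-1), zero_invariant,
      divPattern_invariant, curlPattern_invariant, hessPattern_invariant⟩, ?_⟩
  intro M _ _ _ S O φ hφ x hx F hF
  have h : LocalFrame.Good F x := hF ▸ LocalFrame.good_loc O hφ hx
  -- A functional on the product of error data and background curvature is the sum of its
  -- restrictions to the two factors, giving the bilinear error and the g·R̂ term separately.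
  have hsplit : ∀ ℓ : TensorProduct ℝ FactorData PiData × HatData →ₗ[ℝ] ℝ,
      ℓ (F.errHatData x) = ℓ (LinearMap.inl ℝ _ _ (F.factor x ⊗ₜ F.ckpi x))
        + ℓ (LinearMap.inr ℝ _ _ (F.hatR x)) := fun ℓ => by
    rw [← map_add]; simp [LocalFrame.errHatData, LocalFrame.errData]
  have hcurl : ∀ A, F.curl2 (fun y => (0 : GKData →ₗ[ℝ] S2) (F.gk y)) x A = 0 := fun A => by
    simp [LocalFrame.curl2, LocalFrame.cov2, LocalMetric.dir_const]
  refine ⟨fun A => ?_, fun A => ?_, ?_, ?_, fun A B => ?_⟩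
  · have := hβ A F x h
    rw [hsplit] at this
    rw [hcurl, h.beta_eq]
    change _ = _ + _ + _ + (ℓβ A (LinearMap.inl ℝ _ _ (F.factor x ⊗ₜ F.ckpi x))
      + ℓβ A (LinearMap.inr ℝ _ _ (F.hatR x)))
    linarith
  · have := hβb A F x h
    rw [hsplit] at this
    rw [hcurl, h.betab_eq]
    change _ = _ + _ + _ + (ℓβb A (LinearMap.inl ℝ _ _ (F.factor x ⊗ₜ F.ckpi x))
      + ℓβb A (LinearMap.inr ℝ _ _ (F.hatR x)))
    linarith
  · have := hρ F x h
    rw [hsplit] at this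
    change _ = _ + (ℓρ (LinearMap.inl ℝ _ _ (F.factor x ⊗ₜ F.ckpi x))
      + ℓρ (LinearMap.inr ℝ _ _ (F.hatR x)))
    linarith
  · have := hσ F x h
    change _ = _ + ℓσ (F.errData x)
    linarith
  · have := hα A B F x h
    change _ = _ + _ + ℓα A B (F.errData x)
    linarith
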